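/- **Setting.** Let $d\in\{2,3\}$, $\Omega=[0,L]^d$ with periodic boundary conditions, and let $L,K,B,C,c,B_0,q,\kappa_1,\kappa_2>0$, $b\ge 0$, $\eta_0\in[0,1]$, $a,A\in\mathbb R$, with $A<0$ if $d=2$ and $A<B^2/(27C)$ if $d=3$. Put $s_+=\sqrt{-2A/C}$ if $d=2$ and $s_+=\frac{B+\sqrt{B^2-24AC}}{4C}$ if $d=3$. For an integer $J\ge1$ put $h=L/J$ and consider $J$-periodic grid functions on $(\mathbb Z/J)^d$, with forward, backward and central differences $D_k^{+},D_k^{-},D_k^{c}$ (step $h$), $\Delta_h=\sum_kD_k^+D_k^-$, $D_h^2U=(D_k^cD_l^cU)_{k,l}$, $\nabla_h\cdot(\nabla_h\cdot F)=\sum_{k,l}D_k^-D_l^-F^{kl}$, inner product $\langle U,V\rangle_h=h^d\sum_xU_xV_x$ (sum over one period; summed over components for matrix-valued functions), norm $\|\cdot\|_h$, and $\|\Phi\|_{H_h^2}^2=\|\Phi\|_h^2+\sum_k\|D_k^+\Phi\|_h^2+\|\Delta_h\Phi\|_h^2$. For a symmetric traceless matrix-valued grid function $Q$, a scalar grid function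 $u$ and $s\in\mathbb R$ let $M=Q/s_++I_d/d$, and with $f_{bn}(Q)=\frac A2\operatorname{tr}Q^2-\frac B3\operatorname{tr}Q^3+\frac C4(\operatorname{tr}Q^2)^2$ (for $d=2$ the cubic term vanishes) and $f_s(u)=\frac a2u^2+\frac b3u^3+\frac c4u^4$, $$E_{1h}=2B_0q^2\langle D_h^2u,Mu\rangle_h+B_0q^4\|Mu\|_h^2+\langle f_{bn}(Q),1\rangle_h+\langle f_s(u),1\rangle_h,\qquad g=e^{s}/e^{E_{1h}},$$ $$H=AQ-B\Big(Q^2-\tfrac{\operatorname{tr}Q^2}{d}I\Big)+C\operatorname{tr}(Q^2)Q+\tfrac{2B_0q^2}{s_+}\Big(uD_h^2u-\tfrac{\operatorname{tr}(uD_h^2u)}{d}I\Big)+\tfrac{2B_0q^4}{s_+^2}u^2Q,$$ $$\mu=au+bu^2+cu^3+2B_0q^2M:D_h^2u+2B_0q^2\nabla_h\cdot(\nabla_h\cdot(Mu))+2B_0q^4|M|^2u,$$ $$N_Q=-gH+g\kappa_1Q,\quad N_u=-g\mu+g\kappa_2u,\quad \mathcal L=-K\Delta_h+g\kappa_1,\quad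 \mathcal D=2B_0\Delta_h^2+g\kappa_2 .$$ A superscript $n$ means evaluation at $(Q_h^n,u_h^n,s^n)$. **Scheme.** Let $\varphi_1(z)=(e^z-1)/z$, $\mathcal Q(z)=z/(e^z-1)$. One step with time step $\tau>0$ is $$Q_h^{n+1}=e^{-\tau\mathcal L^n}Q_h^n+\tau\varphi_1(-\tau\mathcal L^n)N_Q^n,\qquad u_h^{n+1}=e^{-\tau\mathcal D^n}u_h^n+\tau\varphi_1(-\tau\mathcal D^n)N_u^n,$$ $$\tilde s^{n+1}=s^n+g^n\big(\langle H^n,Q_h^{n+1}-Q_h^n\rangle_h+\langle\mu^n,u_h^{n+1}-u_h^n\rangle_h\big),\qquad s^{n+1}=\xi\tilde s^{n+1}+(1-\xi)E_{1h}^{n+1},$$ where $\xi=\xi^{n+1}\in[0,1]$ is any number such that $s^{n+1}-\tilde s^{n+1}\le\eta_0\tau R^{n+1}$, with $$R^{n+1}=\tfrac1\tau\big(\langle(\mathcal Q(\tau\mathcal L^n)+\tfrac\tau2\mathcal L^n)\delta Q,\delta Q\rangle_h+\langle(\mathcal Q(\tau\mathcal D^n)+\tfrac\tau2\mathcal D^n)\delta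 u,\delta u\rangle_h\big),\quad \delta Q=Q_h^{n+1}-Q_h^n,\ \delta u=u_h^{n+1}-u_h^n.$$ **Theorem.** Let $Q^0\in H^2(\Omega)$ be periodic with values in the symmetric traceless $d\times d$ matrices and let $u^0\in H^4(\Omega)$ be periodic (both represented by continuous functions, and in the periodic Sobolev spaces). Let $T>0$ and $\sigma_0\ge0$. Consider all numerical solutions $(Q_h^n,u_h^n,s^n)_{0\le n\le N}$ of the scheme, for all $J\ge1$, $\tau>0$ and $N$ with $N\tau\le T$, started from the nodal values $Q_h^0,u_h^0$ of $Q^0,u^0$ and from some $s^0$ with $|s^0-E_{1h}^0|\le\sigma_0$ (in particular $s^0=E_{1h}^0$). Then for each $0<\varepsilon<\frac14$ there is a constant $C_\varepsilon$, independent of $n$, $N$, $\tau$ and $h$, such that $$\sup_{0\le n\le N}\|Q_h^n\|_{H_h^2}+\sup_{0\le n\le N}\|\Delta_hu_h^n\|_h\le C_\varepsilon,$$ and there is a constant $C'$, independent of $n$, $N$, $\tau$ and $h$, such that $$\sup_{0\le n\le N}\|N_Q^n\|_h+\sup_{0\le n\le N}\|N_u^n\|_h\le C'.$$ -/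

import Mathlib

open scoped ContDiff

noncomputable section

namespace Smectic

/-! ### Periodic Sobolev spaces on the cube `[0, L]^d` -/

/-- The fundamental cell `Ω = [0, L]^d`. -/
def cell (d : ℕ) (L : ℝ) : Set (Fin d → ℝ) := Set.Icc 0 (fun _ => L)

/-- `f` is `L`-periodic in each coordinate direction. -/
def IsPer {d : ℕ} (L : ℝ) (f : (Fin d → ℝ) → ℝ) : Prop :=
  ∀ (x : Fin d → ℝ) (k : Fin d), f (x + Pi.single k L) = f x

/-- `g` is the weak partial derivative of the periodic function `f` in direction `k`,
tested against smooth periodic functions. -/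
def IsWeakPartial {d : ℕ} (L : ℝ) (k : Fin d) (f g : (Fin d → ℝ) → ℝ) : Prop :=
  ∀ φ : (Fin d → ℝ) → ℝ, ContDiff ℝ ∞ φ → IsPer L φ →
    ∫ x in cell d L, f x * fderiv ℝ φ x (Pi.single k 1) = - ∫ x in cell d L, g x * φ x

/-- `f` belongs to the periodic Sobolev space `H^m(Ω)`: all weak derivatives of order at most `m`
exist and are square integrable. -/
def MemH {d : ℕ} (L : ℝ) : ℕ → ((Fin d → ℝ) → ℝ) → Prop
  | 0, f => IsPer L f ∧ MeasureTheory.MemLp f 2 (MeasureTheory.volume.restrict (cell d L))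
  | m + 1, f =>
      (IsPer L f ∧ MeasureTheory.MemLp f 2 (MeasureTheory.volume.restrict (cell d L))) ∧
        ∀ k : Fin d, ∃ g : (Fin d → ℝ) → ℝ, IsWeakPartial L k f g ∧ MemH L m g

/-! ### Periodic grid functions and difference operators -/

/-- Periodic scalar grid functions with `J` mesh cells in each of the `d` directions; the mesh
points are indexed by `(ℤ/J)^d`, which encodes the periodic extension. -/
abbrev Grid (d J : ℕ) : Type := (Fin d → ZMod J) → ℝ

/-- Matrix-valued periodic grid functions. -/
abbrev TGrid (d J : ℕ) : Type := (Fin d → ZMod J) → Matrix (Fin d) (Fin d) ℝ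

/-- The scalar component `Φ^{ij}` of a matrix-valued grid function. -/
def comp {d J : ℕ} (Φ : TGrid d J) (i j : Fin d) : Grid d J := fun x => Φ x i j

/-- The nodal values on the mesh of size `L / J` of a function on `[0, L]^d`. -/
def sample {E : Type} {d : ℕ} (L : ℝ) (J : ℕ) (f : (Fin d → ℝ) → E) : (Fin d → ZMod J) → E :=
  fun x => f (fun k => ((x k).val : ℝ) * (L / J))

section Operators

variable {d J : ℕ}

/-- `(shiftF k U)_x = U_{x + e_k}`. -/
def shiftF (k : Fin d) : Grid d J →ₗ[ℝ] Grid d J :=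
  LinearMap.funLeft ℝ ℝ (fun x : Fin d → ZMod J => x + Pi.single k 1)

/-- `(shiftB k U)_x = U_{x - e_k}`. -/
def shiftB (k : Fin d) : Grid d J →ₗ[ℝ] Grid d J :=
  LinearMap.funLeft ℝ ℝ (fun x : Fin d → ZMod J => x - Pi.single k 1)

/-- Forward difference `D_k^+`. -/
def Dp (h : ℝ) (k : Fin d) : Grid d J →ₗ[ℝ] Grid d J := h⁻¹ • (shiftF k - LinearMap.id)

/-- Backward difference `D_k^-`. -/
def Dm (h : ℝ) (k : Fin d) : Grid d J →ₗ[ℝ] Grid d J := h⁻¹ • (LinearMap.id - shiftB k)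

/-- Central difference `D_k^c`. -/
def Dc (h : ℝ) (k : Fin d) : Grid d J →ₗ[ℝ] Grid d J := (2 * h)⁻¹ • (shiftF k - shiftB k)

/-- Discrete Laplacian `Δ_h = ∑_k D_k^+ D_k^-`. -/
def lap (h : ℝ) : Grid d J →ₗ[ℝ] Grid d J := ∑ k : Fin d, Dp h k ∘ₗ Dm h k

/-- Discrete Hessian `D_h^2 U = (D_k^c D_l^c U)_{k,l}`. -/
def hess (h : ℝ) (U : Grid d J) : TGrid d J :=
  fun x => Matrix.of fun k l => Dc h k (Dc h l U) x

/-- Discrete double divergence `∇_h · (∇_h · F)`, the divergence being taken with backward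
differences. -/
def divdiv (h : ℝ) (F : TGrid d J) : Grid d J :=
  ∑ k : Fin d, Dm h k (∑ l : Fin d, Dm h l (comp F k l))

end Operators

/-! ### Discrete inner products and norms -/

section Norms

variable {d J : ℕ} [NeZero J]

/-- `⟨U, V⟩_h = h^d ∑ U V`, the sum running over one period of the mesh. -/
def ip (h : ℝ) (U V : Grid d J) : ℝ := h ^ d * ∑ x, U x * V x

/-- `⟨Φ, Ψ⟩_h` for matrix-valued grid functions. -/
def ipT (h : ℝ) (Φ Ψ : TGrid d J) : ℝ := ∑ i, ∑ j, ip h (comp Φ i j) (comp Ψ i j)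

/-- The discrete `l^2` norm of a scalar grid function. -/
def l2 (h : ℝ) (U : Grid d J) : ℝ := √(ip h U U)

/-- The discrete `l^2` norm of a matrix-valued grid function. -/
def l2T (h : ℝ) (Φ : TGrid d J) : ℝ := √(∑ i, ∑ j, l2 h (comp Φ i j) ^ 2)

/-- `‖∇_h Φ‖_h`, with forward differences. -/
def gradT (h : ℝ) (Φ : TGrid d J) : ℝ := √(∑ k, ∑ i, ∑ j, l2 h (Dp h k (comp Φ i j)) ^ 2)

/-- `‖Δ_h Φ‖_h`. -/
def lapT (h : ℝ) (Φ : TGrid d J) : ℝ := √(∑ i, ∑ j, l2 h (lap h (comp Φ i j)) ^ 2)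

/-- `‖Φ‖_{H_h^1}`. -/
def H1T (h : ℝ) (Φ : TGrid d J) : ℝ := √(l2T h Φ ^ 2 + gradT h Φ ^ 2)

/-- `‖Φ‖_{H_h^2}`. -/
def H2T (h : ℝ) (Φ : TGrid d J) : ℝ := √(H1T h Φ ^ 2 + lapT h Φ ^ 2)

end Norms

/-! ### Operator functions -/

section OperatorFunctions

variable {d J : ℕ} [NeZero J]

/-- `φ₁(B)` for the entire function `φ₁(z) = (e^z - 1) / z = ∑ z^n / (n+1)!`. -/
def phi1 (B : Grid d J →L[ℝ] Grid d J) : Grid d J →L[ℝ] Grid d J :=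
  ∑' n : ℕ, (((n + 1).factorial : ℝ)⁻¹) • B ^ n

/-- `𝒬(B)` for `𝒬(z) = z / (e^z - 1) = 1 / φ₁(z)`. -/
def calQ (B : Grid d J →L[ℝ] Grid d J) : Grid d J →L[ℝ] Grid d J := Ring.inverse (phi1 B)

end OperatorFunctions

/-! ### The model and the scheme -/

/-- The parameters of the model and of the scheme. -/
structure Params where
  /-- side length of the domain -/
  L : ℝ
  /-- elastic constant -/
  K : ℝ
  /-- nematic bulk constants -/
  A : ℝ
  B : ℝ
  C : ℝ
  /-- smectic bulk constants -/
  a : ℝ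
  b : ℝ
  c : ℝ
  /-- coupling strength and wave number -/
  B₀ : ℝ
  q : ℝ
  /-- stabilization parameters -/
  κ₁ : ℝ
  κ₂ : ℝ
  /-- relaxation parameter -/
  η₀ : ℝ

namespace Params

/-- Sign conditions, together with the temperature regime in which the coupled model (and the
scalar `s_+`) is defined. -/
structure Admissible (P : Params) (d : ℕ) : Prop where
  L_pos : 0 < P.L
  K_pos : 0 < P.K
  B_pos : 0 < P.B
  C_pos : 0 < P.C
  b_nonneg : 0 ≤ P.b
  c_pos : 0 < P.c
  B₀_pos : 0 < P.B₀
  q_pos : 0 < P.q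
  κ₁_pos : 0 < P.κ₁
  κ₂_pos : 0 < P.κ₂
  η₀_mem : P.η₀ ∈ Set.Icc (0 : ℝ) 1
  regime₂ : d = 2 → P.A < 0
  regime₃ : d = 3 → P.A < P.B ^ 2 / (27 * P.C)

/-- The scalar `s_+`. -/
def sPlus (P : Params) (d : ℕ) : ℝ :=
  if d = 3 then (P.B + √(P.B ^ 2 - 24 * P.A * P.C)) / (4 * P.C) else √(-2 * P.A / P.C)

/-- The mesh size `h = L / J`. -/
def h (P : Params) (J : ℕ) : ℝ := P.L / J

/-- Nematic bulk energy density. On symmetric traceless `2 × 2` matrices `tr (X^3) = 0`, so the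
cubic term is absent when `d = 2`. -/
def fbn (P : Params) {d : ℕ} (X : Matrix (Fin d) (Fin d) ℝ) : ℝ :=
  P.A / 2 * (X * X).trace - P.B / 3 * (X * X * X).trace + P.C / 4 * (X * X).trace ^ 2

/-- Smectic bulk energy density. -/
def fs (P : Params) (v : ℝ) : ℝ := P.a / 2 * v ^ 2 + P.b / 3 * v ^ 3 + P.c / 4 * v ^ 4

variable {d J : ℕ} [NeZero J]

/-- `M_h = Q_h / s_+ + I_d / d`. -/
def M (P : Params) (Q : TGrid d J) : TGrid d J :=
  fun x => (P.sPlus d)⁻¹ • Q x + (d : ℝ)⁻¹ • (1 : Matrix (Fin d) (Fin d) ℝ)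

/-- The product `M_h u_h`. -/
def Mu (P : Params) (Q : TGrid d J) (u : Grid d J) : TGrid d J := fun x => u x • P.M Q x

/-- The discrete nonlinear energy `E_{1h}`. -/
def E1 (P : Params) (Q : TGrid d J) (u : Grid d J) : ℝ :=
  2 * P.B₀ * P.q ^ 2 * ipT (P.h J) (hess (P.h J) u) (P.Mu Q u)
    + P.B₀ * P.q ^ 4 * l2T (P.h J) (P.Mu Q u) ^ 2
    + ip (P.h J) (fun x => P.fbn (Q x)) (fun _ => 1)
    + ip (P.h J) (fun x => P.fs (u x)) (fun _ => 1)

/-- The factor `g = e^s / e^{E_{1h}}`. -/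
def g (P : Params) (Q : TGrid d J) (u : Grid d J) (s : ℝ) : ℝ :=
  Real.exp s / Real.exp (P.E1 Q u)

/-- The discrete variation `H_h` with respect to `Q`. The term with coefficient `B` vanishes on
symmetric traceless matrices when `d = 2`. -/
def HQ (P : Params) (Q : TGrid d J) (u : Grid d J) : TGrid d J := fun x =>
  P.A • Q x
    - P.B • (Q x * Q x - ((Q x * Q x).trace / d) • (1 : Matrix (Fin d) (Fin d) ℝ))
    + (P.C * (Q x * Q x).trace) • Q x
    + (2 * P.B₀ * P.q ^ 2 / P.sPlus d) •
        (u x • hess (P.h J) u x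
          - ((u x • hess (P.h J) u x).trace / d) • (1 : Matrix (Fin d) (Fin d) ℝ))
    + (2 * P.B₀ * P.q ^ 4 / P.sPlus d ^ 2 * u x ^ 2) • Q x

/-- The discrete variation `μ_h` with respect to `u`. -/
def mu (P : Params) (Q : TGrid d J) (u : Grid d J) : Grid d J := fun x =>
  P.a * u x + P.b * u x ^ 2 + P.c * u x ^ 3
    + 2 * P.B₀ * P.q ^ 2 * ∑ k, ∑ l, P.M Q x k l * hess (P.h J) u x k l
    + 2 * P.B₀ * P.q ^ 2 * divdiv (P.h J) (P.Mu Q u) x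
    + 2 * P.B₀ * P.q ^ 4 * (∑ k, ∑ l, P.M Q x k l ^ 2) * u x

/-- The nonlinear term `N_Q = -g H_h + g κ₁ Q_h`. -/
def NQ (P : Params) (Q : TGrid d J) (u : Grid d J) (s : ℝ) : TGrid d J := fun x =>
  -(P.g Q u s • P.HQ Q u x) + (P.g Q u s * P.κ₁) • Q x

/-- The nonlinear term `N_u = -g μ_h + g κ₂ u_h`. -/
def Nu (P : Params) (Q : TGrid d J) (u : Grid d J) (s : ℝ) : Grid d J := fun x =>
  -(P.g Q u s * P.mu Q u x) + P.g Q u s * P.κ₂ * u x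

/-- The scalar operator `-K Δ_h + γ κ₁`, where `γ` is the current value of `g`; it acts on
matrix-valued grid functions componentwise. -/
def LQ (P : Params) (d J : ℕ) [NeZero J] (γ : ℝ) : Grid d J →L[ℝ] Grid d J :=
  LinearMap.toContinuousLinearMap (-P.K • lap (P.h J) + (γ * P.κ₁) • LinearMap.id)

/-- The operator `2 B₀ Δ_h² + γ κ₂`, where `γ` is the current value of `g`. -/
def Lu (P : Params) (d J : ℕ) [NeZero J] (γ : ℝ) : Grid d J →L[ℝ] Grid d J :=
  LinearMap.toContinuousLinearMap
    ((2 * P.B₀) • (lap (P.h J) ∘ₗ lap (P.h J)) + (γ * P.κ₂) • LinearMap.id)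

/-- `⟨𝒬(τ𝓛) U, U⟩_h + (τ/2) ⟨𝓛 U, U⟩_h`. -/
def dissSq (P : Params) (τ : ℝ) (Λ : Grid d J →L[ℝ] Grid d J) (U : Grid d J) : ℝ :=
  ip (P.h J) (calQ (τ • Λ) U) U + τ / 2 * ip (P.h J) (Λ U) U

/-- The discrete dissipation rate of the step from `(Q, u, s)` to `(Q', u')`. -/
def rate (P : Params) (τ : ℝ) (Q : TGrid d J) (u : Grid d J) (s : ℝ)
    (Q' : TGrid d J) (u' : Grid d J) : ℝ :=
  1 / τ * ((∑ i, ∑ j, P.dissSq τ (P.LQ d J (P.g Q u s)) (comp (Q' - Q) i j))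
    + P.dissSq τ (P.Lu d J (P.g Q u s)) (u' - u))

/-- The provisional auxiliary variable. -/
def sTilde (P : Params) (Q : TGrid d J) (u : Grid d J) (s : ℝ)
    (Q' : TGrid d J) (u' : Grid d J) : ℝ :=
  s + P.g Q u s * (ipT (P.h J) (P.HQ Q u) (Q' - Q) + ip (P.h J) (P.mu Q u) (u' - u))

/-- `(Q', u', s')` is obtained from `(Q, u, s)` by one step of length `τ` of the scheme, with some
feasible relaxation parameter `ξ`. -/
structure Step (P : Params) (τ : ℝ) (Q : TGrid d J) (u : Grid d J) (s : ℝ)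
    (Q' : TGrid d J) (u' : Grid d J) (s' : ℝ) : Prop where
  Q_eq : ∀ i j, comp Q' i j =
    NormedSpace.exp (-τ • P.LQ d J (P.g Q u s)) (comp Q i j)
      + τ • phi1 (-τ • P.LQ d J (P.g Q u s)) (comp (P.NQ Q u s) i j)
  u_eq : u' =
    NormedSpace.exp (-τ • P.Lu d J (P.g Q u s)) u
      + τ • phi1 (-τ • P.Lu d J (P.g Q u s)) (P.Nu Q u s)
  s_eq : ∃ ξ ∈ Set.Icc (0 : ℝ) 1,
    s' = ξ * P.sTilde Q u s Q' u' + (1 - ξ) * P.E1 Q' u' ∧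
      s' - P.sTilde Q u s Q' u' ≤ P.η₀ * τ * P.rate τ Q u s Q' u'

/-- `(Q^n, u^n, s^n)`, `0 ≤ n ≤ N`, is a numerical solution with time step `τ` on the mesh with
`J` cells per direction, started from the nodal values of `(Q₀, u₀)` and from an auxiliary variable
`s^0` that differs from `E_{1h}^0` by at most `σ₀` (so `σ₀ = 0` means `s^0 = E_{1h}^0`). -/
structure IsSolution (P : Params) (Q₀ : (Fin d → ℝ) → Matrix (Fin d) (Fin d) ℝ)
    (u₀ : (Fin d → ℝ) → ℝ) (σ₀ τ : ℝ) (N : ℕ)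
    (Q : ℕ → TGrid d J) (u : ℕ → Grid d J) (s : ℕ → ℝ) : Prop where
  Q_init : Q 0 = sample P.L J Q₀
  u_init : u 0 = sample P.L J u₀
  s_init : |s 0 - P.E1 (Q 0) (u 0)| ≤ σ₀
  step : ∀ n < N, P.Step τ (Q n) (u n) (s n) (Q (n + 1)) (u (n + 1)) (s (n + 1))

end Params

/-- The maximum of the values `f 0, …, f N`. -/
def maxUpTo (N : ℕ) (f : ℕ → ℝ) : ℝ :=
  (Finset.range (N + 1)).sup' Finset.nonempty_range_add_one f

end Smectic

end

noncomputable section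
namespace Smectic

/-! ### The discrete Fourier transform on `(ℤ/J)^d` -/

/-! The scheme is controlled by its own factor g = e^(s - E_{1h}). Let E be the quadratic energy
`elastic`, that is (K/2)‖∇_h Q‖² + B₀‖Δ_h u‖². Dividing a step by φ₁ in each Fourier mode and
testing with the increment gives an exact identity (`Step.energy_identity`): before relaxation, E +
s falls by at least the rate R. Relaxation returns at most η₀τR, so for τ ≤ 1 the quantity E + s
never increases (`Step.energy_le`).

This alone does not bound the state, since s has no lower bound. But E + E_{1h} is coercive,
uniformly in the mesh: it is at least c(‖Q‖²_{H¹} + ‖u‖²_{H²}) - K (`exists_energy_coercive`). Hence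
s - E_{1h} = (E + s) - (E + E_{1h}) is at most a constant minus c times the squared energy norms,
and g absorbs every polynomial in those norms (`exists_g_mul_pow_le`). By the discrete embeddings H²
⊂ ℓ^∞ and H¹ ⊂ ℓ⁶ (`exists_sobolevConst`), H and μ grow polynomially in the energy norms and at most
linearly in the higher ones. So, with no prior bound on the state beyond E + s ≤ C₀
(`exists_nonlinearBound`), ‖N_Q‖ ≤ C, ‖N_u‖ ≤ C(1 + ‖Q‖_{H²}), ‖N_Q‖_{H¹} ≤ C(1 + ‖Q‖_{H²} +
‖u‖_{H³}).

Since these bounds are linear, parabolic smoothing closes the argument. An exponential step gains as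
much regularity as the heat or biharmonic flow, without tying τ to h (`ETDStep.sob_sq_add_le`).
Three discrete Gronwall arguments suffice: boundedness of N_Q makes ‖Q‖_{H²} square summable in
time; this makes ‖N_u‖ square summable, which bounds u in H² and makes ‖u‖_{H⁴} square summable;
this makes ‖N_Q‖_{H¹} square summable, which bounds Q in H² (`exists_boundedState_of_le_one`). For τ
> 1 the energy may grow, but there are at most T steps, and one step maps bounded states to bounded
states (`exists_boundedState_step`).

At the start, the nodal values of a continuous periodic H² function are bounded in the discrete H²
norm (`exists_sob_two_sample_le`): a discrete Fourier coefficient is the sum of the continuous ones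
over all aliases, and Cauchy–Schwarz applies because ∑(1 + |l|²)⁻² converges on ℤ^d for d ≤ 3. -/

lemma Dc_eq {d J : ℕ} (h : ℝ) (j : Fin d) (U : Grid d J) :
    Dc h j U = (2 : ℝ)⁻¹ • (Dp h j U + Dm h j U) := by
  simp only [Dc, Dp, Dm, LinearMap.smul_apply, LinearMap.sub_apply, LinearMap.id_apply]
  rw [← smul_add, smul_smul, mul_inv]
  congr 1
  abel

section Fourier

variable {d J : ℕ} [NeZero J]

lemma conj_stdAddChar (a : ZMod J) :
    (starRingEnd ℂ) (ZMod.stdAddChar a) = ZMod.stdAddChar (-a) := by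
  rw [ZMod.stdAddChar_apply, ZMod.stdAddChar_apply, AddChar.map_neg_eq_inv,
    Circle.coe_inv_eq_conj]

lemma norm_stdAddChar (a : ZMod J) : ‖(ZMod.stdAddChar a : ℂ)‖ = 1 := by
  rw [ZMod.stdAddChar_apply, Circle.norm_coe]

/-- The character `x ↦ e^{2πi k·x/J}`. -/
def chi (k x : Fin d → ZMod J) : ℂ := ZMod.stdAddChar (k ⬝ᵥ x)

lemma chi_add (k x y : Fin d → ZMod J) : chi k (x + y) = chi k x * chi k y := by
  simp [chi, dotProduct_add, AddChar.map_add_eq_mul]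

lemma chi_single (k : Fin d → ZMod J) (j : Fin d) :
    chi k (Pi.single j 1) = ZMod.stdAddChar (k j) := by
  simp [chi]

lemma conj_chi (k x : Fin d → ZMod J) : (starRingEnd ℂ) (chi k x) = chi k (-x) := by
  simp [chi, conj_stdAddChar]

lemma norm_chi (k x : Fin d → ZMod J) : ‖chi k x‖ = 1 := norm_stdAddChar _

lemma chi_comm (k x : Fin d → ZMod J) : chi k x = chi x k := by
  simp [chi, dotProduct_comm]

lemma chi_neg_left (k x : Fin d → ZMod J) : chi (-k) x = chi k (-x) := by
  simp [chi]

/-- The character is a product over the coordinates, so the sum over k factors into d sums over ℤ/J,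
each of which vanishes unless its coordinate of x is zero. -/
lemma sum_chi (x : Fin d → ZMod J) :
    ∑ k : Fin d → ZMod J, chi k x = if x = 0 then (J : ℂ) ^ d else 0 := by
  have h1 : ∀ k : Fin d → ZMod J, chi k x = ∏ j, ZMod.stdAddChar (k j * x j) := by
    intro k
    simp only [chi, dotProduct]
    exact map_sum (ZMod.stdAddChar (N := J)).toAddMonoidHom _ _
  have h2 : ∀ j, ∑ a : ZMod J, (ZMod.stdAddChar (a * x j) : ℂ) = if x j = 0 then (J : ℂ) else 0 := by
    intro j
    rw [AddChar.sum_mulShift _ (ZMod.isPrimitive_stdAddChar J), ZMod.card]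
    split_ifs <;> simp
  simp_rw [h1]
  rw [← Fintype.piFinset_univ,
    ← Finset.prod_univ_sum (fun _ => Finset.univ) fun j a => (ZMod.stdAddChar (a * x j) : ℂ)]
  simp_rw [h2]
  split_ifs with hx
  · simp [hx]
  · obtain ⟨j, hj⟩ := Function.ne_iff.mp hx
    exact Finset.prod_eq_zero (Finset.mem_univ j) (if_neg (by simpa using hj))

/-- The discrete Fourier transform of a real grid function. -/
def fhat (k : Fin d → ZMod J) : Grid d J →ₗ[ℝ] ℂ where
  toFun U := ∑ x, (U x : ℂ) * chi k (-x)
  map_add' U V := by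
    simp [add_mul, Finset.sum_add_distrib]
  map_smul' c U := by
    simp [Finset.mul_sum, mul_assoc]

lemma fhat_apply (k : Fin d → ZMod J) (U : Grid d J) :
    fhat k U = ∑ x, (U x : ℂ) * chi k (-x) := rfl

lemma fourier_inversion (U : Grid d J) (x : Fin d → ZMod J) :
    ∑ k, fhat k U * chi k x = (J : ℂ) ^ d * U x := by
  simp_rw [fhat_apply, Finset.sum_mul, mul_assoc, ← chi_add]
  rw [Finset.sum_comm]
  simp_rw [← Finset.mul_sum, sum_chi]
  rw [Finset.sum_eq_single x]
  · simp [mul_comm]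
  · intro y _ hy
    rw [if_neg, mul_zero]
    intro h
    apply hy
    rw [neg_add_eq_zero] at h
    exact h
  · simp

lemma fourier_parseval (U V : Grid d J) :
    ∑ k, fhat k U * (starRingEnd ℂ) (fhat k V) = (J : ℂ) ^ d * ∑ x, ((U x * V x : ℝ) : ℂ) := by
  have h : ∀ k, fhat k U * (starRingEnd ℂ) (fhat k V) =
      ∑ x, (V x : ℂ) * (fhat k U * chi k x) := by
    intro k
    rw [fhat_apply k V, map_sum, Finset.mul_sum]
    refine Finset.sum_congr rfl fun x _ => ?_
    rw [map_mul, conj_chi, Complex.conj_ofReal, neg_neg]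
    ring
  simp_rw [h]
  rw [Finset.sum_comm]
  simp_rw [← Finset.mul_sum, fourier_inversion]
  rw [Finset.mul_sum]
  refine Finset.sum_congr rfl fun x _ => ?_
  push_cast
  ring

lemma J_pow_pos : 0 < (J : ℝ) ^ d := by
  have : 0 < (J : ℝ) := by exact_mod_cast Nat.pos_of_ne_zero (NeZero.ne J)
  positivity

lemma ip_eq_fourier (h : ℝ) (U V : Grid d J) :
    ip h U V = h ^ d / (J : ℝ) ^ d * ∑ k, (fhat k U * (starRingEnd ℂ) (fhat k V)).re := by
  have h1 := congrArg Complex.re (fourier_parseval U V)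
  rw [Complex.re_sum] at h1
  rw [h1]
  have h2 : ((J : ℂ) ^ d * ∑ x, ((U x * V x : ℝ) : ℂ)).re = (J : ℝ) ^ d * ∑ x, U x * V x := by
    rw [← Complex.ofReal_sum, ← Complex.ofReal_natCast, ← Complex.ofReal_pow, ← Complex.ofReal_mul,
      Complex.ofReal_re]
  rw [h2, ip]
  have := (J_pow_pos (d := d) (J := J)).ne'
  field_simp

/-- Turns identities between translation-invariant operators into identities between symbols. -/
lemma grid_ext_fhat {U V : Grid d J} (h : ∀ k, fhat k U = fhat k V) : U = V := by
  ext x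
  have h1 := fourier_inversion U x
  have h2 := fourier_inversion V x
  simp_rw [h] at h1
  rw [h1] at h2
  have : (J : ℂ) ^ d ≠ 0 := by exact_mod_cast (J_pow_pos (d := d) (J := J)).ne'
  exact_mod_cast mul_left_cancel₀ this h2

lemma fhat_shiftF (k : Fin d → ZMod J) (j : Fin d) (U : Grid d J) :
    fhat k (shiftF j U) = ZMod.stdAddChar (k j) * fhat k U := by
  rw [fhat_apply, fhat_apply, Finset.mul_sum, ← Equiv.sum_comp (Equiv.subRight (Pi.single j 1))]
  refine Finset.sum_congr rfl fun x _ => ?_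
  simp only [Equiv.subRight_apply, shiftF, LinearMap.funLeft_apply, sub_add_cancel, neg_sub]
  rw [sub_eq_add_neg, chi_add, chi_single]
  ring

lemma fhat_shiftB (k : Fin d → ZMod J) (j : Fin d) (U : Grid d J) :
    fhat k (shiftB j U) = (starRingEnd ℂ) (ZMod.stdAddChar (k j)) * fhat k U := by
  rw [fhat_apply, fhat_apply, Finset.mul_sum, ← Equiv.sum_comp (Equiv.addRight (Pi.single j 1))]
  refine Finset.sum_congr rfl fun x _ => ?_
  simp only [Equiv.coe_addRight, shiftB, LinearMap.funLeft_apply, add_sub_cancel_right, neg_add]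
  rw [chi_add, ← conj_chi k (Pi.single j 1), chi_single]
  ring

/-- `|e^{2πi k_j/J} - 1|² / h²`, the contribution of direction `j` to the symbol of `-Δ_h`. -/
def lamj (h : ℝ) (k : Fin d → ZMod J) (j : Fin d) : ℝ :=
  ‖(ZMod.stdAddChar (k j) : ℂ) - 1‖ ^ 2 / h ^ 2

/-- The symbol of `-Δ_h`. -/
def lam (h : ℝ) (k : Fin d → ZMod J) : ℝ := ∑ j, lamj h k j

lemma lamj_nonneg (h : ℝ) (k : Fin d → ZMod J) (j : Fin d) : 0 ≤ lamj h k j := by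
  unfold lamj; positivity

lemma lam_nonneg (h : ℝ) (k : Fin d → ZMod J) : 0 ≤ lam h k :=
  Finset.sum_nonneg fun j _ => lamj_nonneg h k j

lemma lamj_le_lam (h : ℝ) (k : Fin d → ZMod J) (j : Fin d) : lamj h k j ≤ lam h k :=
  Finset.single_le_sum (f := lamj h k) (fun i _ => lamj_nonneg h k i) (Finset.mem_univ j)

lemma fhat_Dp (h : ℝ) (k : Fin d → ZMod J) (j : Fin d) (U : Grid d J) :
    fhat k (Dp h j U) = (h : ℂ)⁻¹ * (ZMod.stdAddChar (k j) - 1) * fhat k U := by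
  simp only [Dp, LinearMap.smul_apply, LinearMap.sub_apply, LinearMap.id_apply, map_smul, map_sub,
    fhat_shiftF, Complex.real_smul, Complex.ofReal_inv]
  ring

lemma fhat_Dm (h : ℝ) (k : Fin d → ZMod J) (j : Fin d) (U : Grid d J) :
    fhat k (Dm h j U) = (h : ℂ)⁻¹ * (1 - (starRingEnd ℂ) (ZMod.stdAddChar (k j))) * fhat k U := by
  simp only [Dm, LinearMap.smul_apply, LinearMap.sub_apply, LinearMap.id_apply, map_smul, map_sub,
    fhat_shiftB, Complex.real_smul, Complex.ofReal_inv]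
  ring

lemma fhat_lap (h : ℝ) (k : Fin d → ZMod J) (U : Grid d J) :
    fhat k (lap h U) = -(lam h k : ℂ) * fhat k U := by
  have h1 : ∀ j, fhat k (Dp h j (Dm h j U)) = -(lamj h k j : ℂ) * fhat k U := by
    intro j
    rw [fhat_Dp, fhat_Dm]
    have h2 : ((lamj h k j : ℝ) : ℂ) = (h : ℂ)⁻¹ * (h : ℂ)⁻¹ *
        ((ZMod.stdAddChar (k j) - 1) * ((starRingEnd ℂ) (ZMod.stdAddChar (k j)) - 1)) := by
      have : ((starRingEnd ℂ) (ZMod.stdAddChar (k j)) - 1 : ℂ)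
        = (starRingEnd ℂ) (ZMod.stdAddChar (k j) - 1) := by simp
      rw [this, Complex.mul_conj, lamj, Complex.normSq_eq_norm_sq]
      push_cast
      ring
    rw [h2]
    ring
  simp only [lap, LinearMap.sum_apply, LinearMap.comp_apply, map_sum, h1, lam, Complex.ofReal_sum]
  rw [← Finset.sum_neg_distrib, Finset.sum_mul]

lemma norm_fhat_Dp (h : ℝ) (k : Fin d → ZMod J) (j : Fin d) (U : Grid d J) :
    ‖fhat k (Dp h j U)‖ ^ 2 = lamj h k j * ‖fhat k U‖ ^ 2 := by
  rw [fhat_Dp, norm_mul, norm_mul, norm_inv, Complex.norm_real, lamj, mul_pow, mul_pow, inv_pow,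
    Real.norm_eq_abs, sq_abs]
  ring

lemma norm_fhat_Dm (h : ℝ) (k : Fin d → ZMod J) (j : Fin d) (U : Grid d J) :
    ‖fhat k (Dm h j U)‖ ^ 2 = lamj h k j * ‖fhat k U‖ ^ 2 := by
  have : ‖1 - (starRingEnd ℂ) (ZMod.stdAddChar (k j) : ℂ)‖ = ‖(ZMod.stdAddChar (k j) : ℂ) - 1‖ := by
    rw [norm_sub_rev, ← RCLike.norm_conj ((ZMod.stdAddChar (k j) : ℂ) - 1)]
    simp
  rw [fhat_Dm, norm_mul, norm_mul, norm_inv, Complex.norm_real, lamj, mul_pow, mul_pow, inv_pow,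
    Real.norm_eq_abs, sq_abs, this]
  ring

lemma norm_fhat_shiftF (k : Fin d → ZMod J) (j : Fin d) (U : Grid d J) :
    ‖fhat k (shiftF j U)‖ = ‖fhat k U‖ := by
  rw [fhat_shiftF, norm_mul, norm_stdAddChar, one_mul]

lemma norm_fhat_shiftB (k : Fin d → ZMod J) (j : Fin d) (U : Grid d J) :
    ‖fhat k (shiftB j U)‖ = ‖fhat k U‖ := by
  rw [fhat_shiftB, norm_mul, RCLike.norm_conj, norm_stdAddChar, one_mul]

end Fourier

/-! ### Discrete Sobolev norms -/

section Sobolev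

variable {d J : ℕ} [NeZero J]

/-- The weighted Fourier coefficients entering the discrete `H^s` norm. -/
def sobMap (h : ℝ) (s : ℕ) : Grid d J →ₗ[ℝ] EuclideanSpace ℂ (Fin d → ZMod J) where
  toFun U := WithLp.toLp 2 fun k => √(h ^ d / (J : ℝ) ^ d * (1 + lam h k) ^ s) • fhat k U
  map_add' U V := by ext k; simp
  map_smul' c U := by ext k; simp; ring

/-- The discrete `H^s` norm, `‖U‖_s² = (h/J)^d ∑_k (1 + λ_k)^s |û_k|²`. -/
def sob (h : ℝ) (s : ℕ) : Seminorm ℝ (Grid d J) :=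
  (normSeminorm ℝ (EuclideanSpace ℂ (Fin d → ZMod J))).comp (sobMap h s)

lemma sob_sq {h : ℝ} (hh : 0 < h) (s : ℕ) (U : Grid d J) :
    sob h s U ^ 2 = h ^ d / (J : ℝ) ^ d * ∑ k, (1 + lam h k) ^ s * ‖fhat k U‖ ^ 2 := by
  simp only [sob, Seminorm.comp_apply, coe_normSeminorm]
  rw [EuclideanSpace.norm_sq_eq, Finset.mul_sum]
  refine Finset.sum_congr rfl fun k _ => ?_
  simp only [sobMap, LinearMap.coe_mk, AddHom.coe_mk]
  have := lam_nonneg h k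
  have hJ := J_pow_pos (d := d) (J := J)
  rw [norm_smul, mul_pow, Real.norm_eq_abs, sq_abs, Real.sq_sqrt (by positivity)]
  ring

lemma sob_le_of_sq {h : ℝ} {s : ℕ} {U : Grid d J} {a : ℝ} (ha : 0 ≤ a) (H : sob h s U ^ 2 ≤ a ^ 2) :
    sob h s U ≤ a := (sq_le_sq₀ (apply_nonneg _ _) ha).mp H

/-- Norm comparisons reduce to comparisons of symbols, one mode at a time. The mapping properties of
the shifts, the one-sided differences and the Laplacian all come from this. -/
lemma sob_le_sob {h : ℝ} (hh : 0 < h) {s t : ℕ} {U V : Grid d J}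
    (H : ∀ k, (1 + lam h k) ^ s * ‖fhat k U‖ ^ 2 ≤ (1 + lam h k) ^ t * ‖fhat k V‖ ^ 2) :
    sob h s U ≤ sob h t V := by
  apply sob_le_of_sq (apply_nonneg _ _)
  rw [sob_sq hh, sob_sq hh]
  have hJ := J_pow_pos (d := d) (J := J)
  exact mul_le_mul_of_nonneg_left (Finset.sum_le_sum fun k _ => H k) (by positivity)

lemma sob_mono {h : ℝ} (hh : 0 < h) {s t : ℕ} (hst : s ≤ t) (U : Grid d J) :
    sob h s U ≤ sob h t U := by
  refine sob_le_sob hh fun k => ?_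
  have := lam_nonneg h k
  gcongr
  linarith

lemma ip_self_eq {h : ℝ} (hh : 0 < h) (U : Grid d J) : ip h U U = sob h 0 U ^ 2 := by
  rw [sob_sq hh, ip_eq_fourier]
  congr 1
  refine Finset.sum_congr rfl fun k _ => ?_
  rw [Complex.mul_conj, Complex.ofReal_re, Complex.normSq_eq_norm_sq, pow_zero, one_mul]

lemma l2_eq_sob {h : ℝ} (hh : 0 < h) (U : Grid d J) : l2 h U = sob h 0 U := by
  rw [l2, ip_self_eq hh, Real.sqrt_sq (apply_nonneg _ _)]

lemma sob_shiftF {h : ℝ} (hh : 0 < h) (s : ℕ) (j : Fin d) (U : Grid d J) :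
    sob h s (shiftF j U) = sob h s U :=
  le_antisymm (sob_le_sob hh fun k => by rw [norm_fhat_shiftF])
    (sob_le_sob hh fun k => by rw [norm_fhat_shiftF])

lemma sob_shiftB {h : ℝ} (hh : 0 < h) (s : ℕ) (j : Fin d) (U : Grid d J) :
    sob h s (shiftB j U) = sob h s U :=
  le_antisymm (sob_le_sob hh fun k => by rw [norm_fhat_shiftB])
    (sob_le_sob hh fun k => by rw [norm_fhat_shiftB])

lemma sob_Dp_le {h : ℝ} (hh : 0 < h) (s : ℕ) (j : Fin d) (U : Grid d J) :
    sob h s (Dp h j U) ≤ sob h (s + 1) U := by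
  refine sob_le_sob hh fun k => ?_
  rw [norm_fhat_Dp, pow_succ (1 + lam h k), mul_assoc]
  have := lam_nonneg h k
  have := lamj_le_lam h k j
  gcongr
  linarith

lemma sob_Dm_le {h : ℝ} (hh : 0 < h) (s : ℕ) (j : Fin d) (U : Grid d J) :
    sob h s (Dm h j U) ≤ sob h (s + 1) U := by
  refine sob_le_sob hh fun k => ?_
  rw [norm_fhat_Dm, pow_succ (1 + lam h k), mul_assoc]
  have := lam_nonneg h k
  have := lamj_le_lam h k j
  gcongr
  linarith

lemma sob_Dc_le {h : ℝ} (hh : 0 < h) (s : ℕ) (j : Fin d) (U : Grid d J) :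
    sob h s (Dc h j U) ≤ sob h (s + 1) U := by
  rw [Dc_eq, map_smul_eq_mul, Real.norm_eq_abs, abs_of_pos (by norm_num)]
  have := map_add_le_add (sob h s) (Dp h j U) (Dm h j U)
  linarith [sob_Dp_le hh s j U, sob_Dm_le hh s j U]

lemma sob_lap_le {h : ℝ} (hh : 0 < h) (s : ℕ) (U : Grid d J) :
    sob h s (lap h U) ≤ sob h (s + 2) U := by
  refine sob_le_sob hh fun k => ?_
  have h0 := lam_nonneg h k
  rw [fhat_lap, norm_mul, norm_neg, Complex.norm_real, Real.norm_eq_abs, abs_of_nonneg h0, mul_pow,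
    pow_add, mul_assoc]
  gcongr
  linarith

lemma sob_one_sq {h : ℝ} (hh : 0 < h) (U : Grid d J) :
    sob h 1 U ^ 2 = sob h 0 U ^ 2 + ∑ j, sob h 0 (Dp h j U) ^ 2 := by
  simp_rw [sob_sq hh, norm_fhat_Dp]
  rw [← Finset.mul_sum, ← mul_add, Finset.sum_comm, ← Finset.sum_add_distrib]
  congr 1
  refine Finset.sum_congr rfl fun k _ => ?_
  rw [← Finset.mul_sum, ← Finset.sum_mul, ← lam]
  ring

/-- This is (1 + λ)² = 1 + 2λ + λ² summed over the modes. -/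
lemma sob_two_sq {h : ℝ} (hh : 0 < h) (U : Grid d J) :
    sob h 2 U ^ 2 = sob h 0 U ^ 2 + 2 * ∑ j, sob h 0 (Dp h j U) ^ 2 + sob h 0 (lap h U) ^ 2 := by
  have h1 : ∀ k, ‖fhat k (lap h U)‖ ^ 2 = lam h k ^ 2 * ‖fhat k U‖ ^ 2 := fun k => by
    rw [fhat_lap, norm_mul, norm_neg, Complex.norm_real, mul_pow, Real.norm_eq_abs, sq_abs]
  simp_rw [sob_sq hh, norm_fhat_Dp, h1]
  rw [← Finset.mul_sum, Finset.sum_comm, mul_left_comm, ← mul_add, ← mul_add,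
    Finset.mul_sum _ _ (2 : ℝ), ← Finset.sum_add_distrib, ← Finset.sum_add_distrib]
  congr 1
  refine Finset.sum_congr rfl fun k _ => ?_
  rw [← Finset.mul_sum, ← Finset.sum_mul, ← lam]
  ring

/-- `‖U‖_2` is controlled by `‖U‖` and `‖Δ_h U‖`. -/
lemma sob_two_sq_le {h : ℝ} (hh : 0 < h) (U : Grid d J) :
    sob h 2 U ^ 2 ≤ 2 * (sob h 0 U ^ 2 + sob h 0 (lap h U) ^ 2) := by
  have h1 : ∀ k, ‖fhat k (lap h U)‖ ^ 2 = lam h k ^ 2 * ‖fhat k U‖ ^ 2 := fun k => by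
    rw [fhat_lap, norm_mul, norm_neg, Complex.norm_real, mul_pow, Real.norm_eq_abs, sq_abs]
  have hJ := J_pow_pos (d := d) (J := J)
  simp_rw [sob_sq hh, h1]
  rw [← mul_add, mul_left_comm, ← Finset.sum_add_distrib, Finset.mul_sum _ _ (2 : ℝ)]
  refine mul_le_mul_of_nonneg_left (Finset.sum_le_sum fun k _ => ?_) (by positivity)
  have h2 : 0 ≤ ‖fhat k U‖ ^ 2 := by positivity
  nlinarith [mul_nonneg (sq_nonneg (1 - lam h k)) h2]

lemma abs_ip_le {h : ℝ} (hh : 0 < h) (U V : Grid d J) : |ip h U V| ≤ sob h 0 U * sob h 0 V := by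
  apply abs_le_of_sq_le_sq _ (mul_nonneg (apply_nonneg _ _) (apply_nonneg _ _))
  rw [mul_pow, ← ip_self_eq hh, ← ip_self_eq hh]
  simp only [ip]
  have := Finset.sum_mul_sq_le_sq_mul_sq Finset.univ U V
  have h2 : 0 ≤ (h ^ d) ^ 2 := by positivity
  calc (h ^ d * ∑ x, U x * V x) ^ 2 = (h ^ d) ^ 2 * (∑ x, U x * V x) ^ 2 := by ring
    _ ≤ (h ^ d) ^ 2 * ((∑ x, U x ^ 2) * ∑ x, V x ^ 2) := by gcongr
    _ = _ := by simp_rw [sq]; ring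

lemma ip_lap_self {h : ℝ} (hh : 0 < h) (U : Grid d J) :
    ip h (lap h U) U = - ∑ j, sob h 0 (Dp h j U) ^ 2 := by
  simp_rw [sob_sq hh, norm_fhat_Dp]
  rw [ip_eq_fourier, ← Finset.mul_sum, Finset.sum_comm, ← mul_neg, ← Finset.sum_neg_distrib]
  congr 1
  refine Finset.sum_congr rfl fun k _ => ?_
  rw [← Finset.mul_sum, ← Finset.sum_mul, ← lam, fhat_lap, mul_assoc, Complex.mul_conj,
    Complex.normSq_eq_norm_sq, ← Complex.ofReal_neg, ← Complex.ofReal_mul, Complex.ofReal_re]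
  ring

/-- The Hessian of central differences is dominated by the Laplacian. -/
lemma sum_hess_sq_le {h : ℝ} (hh : 0 < h) (U : Grid d J) :
    ∑ k, ∑ l, sob h 0 (Dc h k (Dc h l U)) ^ 2 ≤ sob h 0 (lap h U) ^ 2 := by
  -- The central difference is the mean of the two one-sided ones, whose moduli agree in each mode,
  -- so its symbol is no larger. The resulting constant 1 is what later lets the coupling energy be
  -- compared with a perfect square.
  have hc : ∀ (m : Fin d → ZMod J) (j : Fin d) (V : Grid d J),
      ‖fhat m (Dc h j V)‖ ^ 2 ≤ lamj h m j * ‖fhat m V‖ ^ 2 := by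
    intro m j V
    have h1 := norm_fhat_Dp h m j V
    have h2 := norm_fhat_Dm h m j V
    rw [Dc_eq, map_smul, norm_smul, map_add, mul_pow]
    have h3 := norm_add_le (fhat m (Dp h j V)) (fhat m (Dm h j V))
    have h4 : ‖(2 : ℝ)⁻¹‖ ^ 2 = 1 / 4 := by norm_num
    rw [h4]
    nlinarith [norm_nonneg (fhat m (Dp h j V) + fhat m (Dm h j V)),
      sq_nonneg (‖fhat m (Dp h j V)‖ - ‖fhat m (Dm h j V)‖)]
  have h1 : ∀ k, ‖fhat k (lap h U)‖ ^ 2 = lam h k ^ 2 * ‖fhat k U‖ ^ 2 := fun k => by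
    rw [fhat_lap, norm_mul, norm_neg, Complex.norm_real, mul_pow, Real.norm_eq_abs, sq_abs]
  have hJ := J_pow_pos (d := d) (J := J)
  simp_rw [sob_sq hh, h1, pow_zero, one_mul, ← Finset.mul_sum]
  refine mul_le_mul_of_nonneg_left ?_ (by positivity)
  calc ∑ k, ∑ l, ∑ m, ‖fhat m (Dc h k (Dc h l U))‖ ^ 2
      ≤ ∑ k, ∑ l, ∑ m, lamj h m k * lamj h m l * ‖fhat m U‖ ^ 2 := by
        gcongr with k _ l _ m _
        refine (hc m k _).trans ?_
        rw [mul_assoc]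
        exact mul_le_mul_of_nonneg_left (hc m l U) (lamj_nonneg h m k)
    _ = ∑ m, lam h m ^ 2 * ‖fhat m U‖ ^ 2 := by
        have : ∀ k : Fin d, ∑ l, ∑ m, lamj h m k * lamj h m l * ‖fhat m U‖ ^ 2
          = ∑ m, ∑ l, lamj h m k * lamj h m l * ‖fhat m U‖ ^ 2 := fun k => Finset.sum_comm
        simp_rw [this]
        rw [Finset.sum_comm]
        refine Finset.sum_congr rfl fun m _ => ?_
        simp_rw [← Finset.sum_mul, ← Finset.mul_sum, ← Finset.sum_mul]
        rw [← lam]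
        ring

end Sobolev

/-! ### The embedding of the discrete `H²` into `ℓ^∞` -/

/-- A summable weight on `ℤ` whose threefold products dominate `(1 + |m|²)⁻²`. -/
def wt (m : ℝ) : ℝ := (1 + m ^ 2) ^ (-(2 / 3) : ℝ)

lemma wt_pos (m : ℝ) : 0 < wt m := Real.rpow_pos_of_pos (by positivity) _

lemma summable_wt : Summable fun m : ℤ => wt m := by
  have h1 := Real.summable_abs_int_rpow (b := 4 / 3) (by norm_num)
  -- At m = 0 the real power |m|^(-4/3) takes the value 0, so an indicator has to supply the missing
  -- term.
  have h2 : Summable fun m : ℤ => if m = 0 then (1 : ℝ) else 0 :=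
    summable_of_hasFiniteSupport ((Set.finite_singleton 0).subset fun m hm => by
      by_contra h
      exact hm (if_neg h))
  refine Summable.of_nonneg_of_le (fun m => (wt_pos _).le) (fun m => ?_) (h1.add h2)
  by_cases hm : m = 0
  · subst hm
    simp [wt]
  · have hpos : 0 < |(m : ℝ)| := by positivity
    rw [if_neg hm, add_zero, wt]
    have h3 : |(m : ℝ)| ^ (-(4 / 3) : ℝ) = (|(m : ℝ)| ^ 2) ^ (-(2 / 3) : ℝ) := by
      rw [← Real.rpow_natCast, ← Real.rpow_mul hpos.le]
      norm_num
    rw [h3, sq_abs]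
    apply Real.rpow_le_rpow_of_nonpos (by positivity) (by linarith) (by norm_num)

/-- Each factor 1 + v_j² is at most 1 + S and there are at most three of them. The exponent -2/3
turns (1 + S)³ into (1 + S)⁻² while keeping the one-dimensional weight summable, its decay being
|m|^(-4/3). -/
lemma one_add_sum_sq_inv_le {d : ℕ} (hd : d ≤ 3) (v : Fin d → ℝ) :
    ((1 + ∑ j, v j ^ 2) ^ 2)⁻¹ ≤ ∏ j, wt (v j) := by
  set S := ∑ j, v j ^ 2 with hS
  have hS0 : 0 ≤ S := Finset.sum_nonneg fun j _ => sq_nonneg _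
  have h1 : ∏ j, (1 + v j ^ 2) ≤ (1 + S) ^ 3 := by
    calc ∏ j, (1 + v j ^ 2) ≤ ∏ _j : Fin d, (1 + S) := by
          gcongr with j _
          exact Finset.single_le_sum (f := fun j => v j ^ 2) (fun i _ => sq_nonneg _)
            (Finset.mem_univ j)
      _ = (1 + S) ^ d := by simp
      _ ≤ (1 + S) ^ 3 := pow_le_pow_right₀ (by linarith) hd
  have h2 : ∏ j, wt (v j) = (∏ j, (1 + v j ^ 2)) ^ (-(2 / 3) : ℝ) := by
    simp only [wt]
    exact Real.finsetProd_rpow _ _ (fun j _ => by positivity) _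
  have h3 : ((1 + S) ^ 2)⁻¹ = ((1 + S) ^ 3) ^ (-(2 / 3) : ℝ) := by
    rw [← Real.rpow_natCast (1 + S) 3, ← Real.rpow_mul (by linarith), ← Real.rpow_natCast,
      ← Real.rpow_neg (by linarith)]
    norm_num
  rw [h2, h3]
  exact Real.rpow_le_rpow_of_nonpos (Finset.prod_pos fun j _ => by positivity) h1 (by norm_num)

/-! ### Lower bounds for the symbol of the discrete Laplacian -/

section Symbol

variable {d J : ℕ} [NeZero J]

lemma norm_stdAddChar_sub_one (m : ℤ) :
    ‖(ZMod.stdAddChar (m : ZMod J) : ℂ) - 1‖ = 2 * |Real.sin (Real.pi * m / J)| := by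
  rw [ZMod.stdAddChar_coe]
  have h1 : (2 * Real.pi * Complex.I * m / J : ℂ)
      = Complex.I * ((2 * Real.pi * m / J : ℝ) : ℂ) := by
    push_cast
    ring
  rw [h1, Complex.norm_exp_I_mul_ofReal_sub_one, Real.norm_eq_abs, abs_mul, abs_two]
  congr 3
  ring

lemma natCast_J_pos : 0 < (J : ℝ) := by exact_mod_cast Nat.pos_of_ne_zero (NeZero.ne J)

/-- Jordan's inequality sin x ≥ 2x/π on [0, π/2] applies up to the highest mesh frequency, because
the minimal representative satisfies |v| ≤ J/2. The constant is therefore independent of J. -/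
lemma lamj_ge {L : ℝ} (hL : 0 < L) (k : Fin d → ZMod J) (j : Fin d) :
    16 / L ^ 2 * ((k j).valMinAbs : ℝ) ^ 2 ≤ lamj (L / J) k j := by
  have hJ := natCast_J_pos (J := J)
  set v := (k j).valMinAbs with hv
  have hkv : k j = (v : ZMod J) := (ZMod.coe_valMinAbs (k j)).symm
  have hva : |(v : ℝ)| ≤ J / 2 := by
    have h1 : v.natAbs ≤ J / 2 := ZMod.natAbs_valMinAbs_le (k j)
    have h2 : ((v.natAbs : ℕ) : ℝ) ≤ ((J / 2 : ℕ) : ℝ) := by exact_mod_cast h1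
    rw [Nat.cast_natAbs, Int.cast_abs] at h2
    exact h2.trans Nat.cast_div_le
  have h1 : 2 * |(v : ℝ)| / J ≤ |Real.sin (Real.pi * v / J)| := by
    have h2 : |Real.sin (Real.pi * v / J)| = |Real.sin (Real.pi * |(v : ℝ)| / J)| := by
      rcases abs_choice (v : ℝ) with h | h <;> rw [h]
      rw [mul_neg, neg_div, Real.sin_neg, abs_neg]
    have h3 : Real.pi * |(v : ℝ)| / J ≤ Real.pi / 2 := by
      rw [div_le_iff₀ hJ]
      nlinarith [Real.pi_pos]
    have h4 := Real.mul_le_sin (x := Real.pi * |(v : ℝ)| / J) (by positivity) h3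
    rw [h2]
    refine le_trans (le_of_eq ?_) (h4.trans (le_abs_self _))
    field_simp
  rw [lamj, hkv, norm_stdAddChar_sub_one]
  have h5 : (2 * |(v : ℝ)| / J) ^ 2 ≤ |Real.sin (Real.pi * v / J)| ^ 2 := by gcongr
  rw [div_pow, mul_pow, sq_abs] at h5
  rw [div_pow, mul_pow]
  calc 16 / L ^ 2 * (v : ℝ) ^ 2 = 2 ^ 2 * (2 ^ 2 * (v : ℝ) ^ 2 / J ^ 2) / (L ^ 2 / J ^ 2) := by
        field_simp
        ring
    _ ≤ _ := by gcongr

lemma exists_le_one_add_lam {L : ℝ} (hL : 0 < L) : ∃ c : ℝ, 0 < c ∧ ∀ (d J : ℕ) [NeZero J]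
    (k : Fin d → ZMod J), c * (1 + ∑ j, ((k j).valMinAbs : ℝ) ^ 2) ≤ 1 + lam (L / J) k := by
  refine ⟨min 1 (16 / L ^ 2), by positivity, fun d J _ k => ?_⟩
  have h1 : 16 / L ^ 2 * ∑ j, ((k j).valMinAbs : ℝ) ^ 2 ≤ lam (L / J) k := by
    rw [Finset.mul_sum]
    exact Finset.sum_le_sum fun j _ => lamj_ge hL k j
  have h2 : 0 ≤ ∑ j, ((k j).valMinAbs : ℝ) ^ 2 := Finset.sum_nonneg fun j _ => sq_nonneg _
  nlinarith [min_le_left 1 (16 / L ^ 2), min_le_right 1 (16 / L ^ 2)]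

/-- Minimal representatives inject ℤ/J into ℤ, so the sum over mesh frequencies is dominated by a
product of d convergent series that do not involve J. -/
lemma exists_sum_one_add_lam_inv_le (d : ℕ) (hd : d ≤ 3) {L : ℝ} (hL : 0 < L) :
    ∃ S : ℝ, 0 < S ∧ ∀ (J : ℕ) [NeZero J],
      ∑ k : Fin d → ZMod J, ((1 + lam (L / J) k) ^ 2)⁻¹ ≤ S := by
  obtain ⟨c, hc, hlam⟩ := exists_le_one_add_lam hL
  have hW : 0 < ∑' m : ℤ, wt m := summable_wt.tsum_pos (fun m => (wt_pos _).le) 0 (wt_pos _)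
  refine ⟨(c ^ 2)⁻¹ * (∑' m : ℤ, wt m) ^ d, by positivity, fun J _ => ?_⟩
  calc ∑ k : Fin d → ZMod J, ((1 + lam (L / J) k) ^ 2)⁻¹
      ≤ ∑ k : Fin d → ZMod J, (c ^ 2)⁻¹ * ∏ j, wt ((k j).valMinAbs : ℝ) := by
        gcongr with k _
        refine le_trans ?_ (mul_le_mul_of_nonneg_left
          (one_add_sum_sq_inv_le hd fun j => ((k j).valMinAbs : ℝ)) (by positivity))
        rw [← mul_inv, ← mul_pow]
        have h2 : 0 ≤ ∑ j, ((k j).valMinAbs : ℝ) ^ 2 := Finset.sum_nonneg fun j _ => sq_nonneg _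
        have := hlam d J k
        gcongr
    _ = (c ^ 2)⁻¹ * ∏ _j : Fin d, ∑ a : ZMod J, wt (a.valMinAbs : ℝ) := by
        rw [← Finset.mul_sum, ← Fintype.piFinset_univ,
          ← Finset.prod_univ_sum (fun _ => Finset.univ) fun _ (a : ZMod J) =>
            wt (a.valMinAbs : ℝ)]
    _ ≤ (c ^ 2)⁻¹ * ∏ _j : Fin d, ∑' m : ℤ, wt m := by
        have h1 : ∑ a : ZMod J, wt (a.valMinAbs : ℝ) ≤ ∑' m : ℤ, wt m := by
          calc ∑ a : ZMod J, wt (a.valMinAbs : ℝ) = ∑' a : ZMod J, wt (a.valMinAbs : ℝ) :=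
                (tsum_fintype _).symm
            _ ≤ _ := tsum_comp_le_tsum_of_inj summable_wt (fun m => (wt_pos _).le)
                (ZMod.injective_valMinAbs (n := J))
        have h2 : 0 ≤ ∑ a : ZMod J, wt (a.valMinAbs : ℝ) :=
          Finset.sum_nonneg fun a _ => (wt_pos _).le
        gcongr
    _ = _ := by simp

end Symbol

/-- The discrete Sobolev embedding `H² ⊂ ℓ^∞` in dimension at most three. -/
theorem exists_abs_le_sob_two (d : ℕ) (hd : d ≤ 3) {L : ℝ} (hL : 0 < L) :
    ∃ C : ℝ, 0 < C ∧ ∀ (J : ℕ) [NeZero J] (U : Grid d J) (x : Fin d → ZMod J),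
      |U x| ≤ C * sob (L / J) 2 U := by
  obtain ⟨S, hS, hsum⟩ := exists_sum_one_add_lam_inv_le d hd hL
  refine ⟨√(S / L ^ d), by positivity, fun J _ U x => ?_⟩
  have hJ := natCast_J_pos (J := J)
  have hh : 0 < L / J := by positivity
  apply abs_le_of_sq_le_sq _ (by positivity)
  rw [mul_pow, Real.sq_sqrt (by positivity), sob_sq hh]
  have h1 : (J : ℝ) ^ d * |U x| ≤ ∑ k, ‖fhat k U‖ := by
    have h2 := congrArg norm (fourier_inversion U x)
    rw [norm_mul, norm_pow, Complex.norm_natCast, Complex.norm_real, Real.norm_eq_abs] at h2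
    rw [← h2]
    refine (norm_sum_le _ _).trans (le_of_eq ?_)
    simp [norm_chi]
  -- Cauchy–Schwarz with the weights (1 + λ)⁻¹ and 1 + λ.
  have h3 : (∑ k, ‖fhat k U‖) ^ 2 ≤
      (∑ k : Fin d → ZMod J, ((1 + lam (L / J) k) ^ 2)⁻¹) *
        ∑ k, (1 + lam (L / J) k) ^ 2 * ‖fhat k U‖ ^ 2 := by
    have h4 := Finset.sum_mul_sq_le_sq_mul_sq Finset.univ
      (fun k : Fin d → ZMod J => (1 + lam (L / J) k)⁻¹)
      (fun k => (1 + lam (L / J) k) * ‖fhat k U‖)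
    have h5 : ∀ k : Fin d → ZMod J, (1 + lam (L / J) k) ≠ 0 := fun k => by
      have := lam_nonneg (L / J) k
      positivity
    simp only [mul_pow, inv_pow] at h4
    simpa only [inv_mul_cancel_left₀ (h5 _)] using h4
  have h6 : 0 ≤ ∑ k, (1 + lam (L / J) k) ^ 2 * ‖fhat k U‖ ^ 2 :=
    Finset.sum_nonneg fun k _ => by positivity
  have h7 : ((J : ℝ) ^ d * |U x|) ^ 2 ≤ S * ∑ k, (1 + lam (L / J) k) ^ 2 * ‖fhat k U‖ ^ 2 :=
    (pow_le_pow_left₀ (by positivity) h1 2).trans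
      (h3.trans (mul_le_mul_of_nonneg_right (hsum J) h6))
  rw [mul_pow, sq_abs] at h7
  have hJd : 0 < ((J : ℝ) ^ d) ^ 2 := by positivity
  rw [← mul_le_mul_iff_right₀ hJd]
  refine h7.trans (le_of_eq ?_)
  rw [div_pow]
  field_simp

/-! ### The discrete Gagliardo–Nirenberg–Sobolev inequality -/

/-- Walk from y to x by unit steps. The walk takes fewer than J steps, so it visits each point of
the cycle at most once and its increments form part of the total variation. -/
lemma sub_le_total_variation {J : ℕ} [NeZero J] (w : ZMod J → ℝ) (x y : ZMod J) :
    w x - w y ≤ ∑ z, |w (z + 1) - w z| := by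
  have h1 : ∀ n : ℕ, w (y + n) - w y ≤
      ∑ i ∈ Finset.range n, |w (y + i + 1) - w (y + i)| := by
    intro n
    induction n with
    | zero => simp
    | succ n ih =>
      rw [Finset.sum_range_succ]
      have := le_abs_self (w (y + n + 1) - w (y + n))
      push_cast
      rw [← add_assoc]
      linarith
  have h2 := h1 (x - y).val
  rw [ZMod.natCast_zmod_val, add_sub_cancel] at h2
  refine h2.trans ?_
  have hinj : Set.InjOn (fun i : ℕ => y + (i : ZMod J)) (Finset.range (x - y).val) := by
    intro i hi i' hi' h
    have hi := (Finset.mem_range.mp (by exact_mod_cast hi)).trans (ZMod.val_lt (x - y))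
    have hi' := (Finset.mem_range.mp (by exact_mod_cast hi')).trans (ZMod.val_lt (x - y))
    have h3 := add_left_cancel h
    rw [ZMod.natCast_eq_natCast_iff', Nat.mod_eq_of_lt hi, Nat.mod_eq_of_lt hi'] at h3
    exact h3
  rw [← Finset.sum_image (f := fun z => |w (z + 1) - w z|) hinj]
  exact Finset.sum_le_sum_of_subset_of_nonneg (Finset.subset_univ _) fun _ _ _ => abs_nonneg _

/-- Averaging the total variation bound over y gives mean plus variation. The weight L/J and the
difference quotient are arranged so that the right side is a Riemann sum. -/
lemma le_line_sum {J : ℕ} [NeZero J] {L : ℝ} (hL : 0 < L) (w : ZMod J → ℝ) (x : ZMod J) :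
    w x ≤ L / J * ∑ y, (w y / L + |(L / J)⁻¹ * (w (y + 1) - w y)|) := by
  have hJ := natCast_J_pos (J := J)
  have h1 : ∑ y : ZMod J, (w x - w y) ≤ ∑ _y : ZMod J, ∑ z, |w (z + 1) - w z| :=
    Finset.sum_le_sum fun y _ => sub_le_total_variation w x y
  simp only [Finset.sum_sub_distrib, Finset.sum_const, Finset.card_univ, ZMod.card,
    nsmul_eq_mul] at h1
  simp_rw [abs_mul, Finset.sum_add_distrib, ← Finset.mul_sum, ← Finset.sum_div]
  rw [abs_of_pos (by positivity)]
  have h2 : L / J * ((∑ y, w y) / L + (L / J)⁻¹ * ∑ z, |w (z + 1) - w z|)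
      = (J : ℝ)⁻¹ * (∑ y, w y + J * ∑ z, |w (z + 1) - w z|) := by
    field_simp
  rw [h2, inv_mul_eq_div, le_div_iff₀ hJ]
  linarith

lemma update_add_single {d J : ℕ} (x : Fin d → ZMod J) (j : Fin d) (a : ZMod J) :
    Function.update x j a + Pi.single j 1 = Function.update x j (a + 1) := by
  ext i
  by_cases hi : i = j
  · subst hi; simp
  · simp [hi]

lemma le_grid_line_sum {d J : ℕ} [NeZero J] {L : ℝ} (hL : 0 < L) (v : Grid d J)
    (x : Fin d → ZMod J) (j : Fin d) :
    v x ≤ L / J * ∑ a, (v (Function.update x j a) / L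
      + ∑ i, |Dp (L / J) i v (Function.update x j a)|) := by
  have hJ := natCast_J_pos (J := J)
  have h1 := le_line_sum hL (fun a => v (Function.update x j a)) (x j)
  simp only [Function.update_eq_self] at h1
  refine h1.trans ?_
  gcongr with a _
  refine le_trans (le_of_eq ?_) (Finset.single_le_sum (f := fun i =>
    |Dp (L / J) i v (Function.update x j a)|) (fun i _ => abs_nonneg _) (Finset.mem_univ j))
  simp [Dp, shiftF, LinearMap.funLeft_apply, update_add_single]

/-- The grid-lines inequality for finite sums. -/
lemma sum_prod_line_sum_rpow_le {d J : ℕ} [NeZero J] (hd : 1 < d) (f : Grid d J)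
    (hf : ∀ x, 0 ≤ f x) :
    ∑ x, ∏ i, (∑ a, f (Function.update x i a)) ^ ((1 : ℝ) / ((d : ℝ) - 1)) ≤
      (∑ x, f x) ^ ((d : ℝ) / (d - 1)) := by
  let _ : MeasurableSpace (ZMod J) := ⊤
  have : DiscreteMeasurableSpace (ZMod J) := ⟨fun _ => trivial⟩
  have hd1 : (1 : ℝ) < d := by exact_mod_cast hd
  have hp : Real.HolderConjugate (Fintype.card (Fin d)) ((d : ℝ) / (d - 1)) := by
    rw [Fintype.card_fin]
    exact Real.HolderConjugate.conjExponent hd1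
  -- For counting measure on each factor every point has product mass 1, so the grid-lines
  -- inequality for integrals becomes the one for sums.
  have key := MeasureTheory.lintegral_prod_lintegral_pow_le
    (μ := fun _ : Fin d => (MeasureTheory.Measure.count : MeasureTheory.Measure (ZMod J))) hp
    (f := fun x => ENNReal.ofReal (f x)) (Measurable.of_discrete)
  have hs : ∀ x : Fin d → ZMod J, MeasureTheory.Measure.pi (fun _ : Fin d =>
      (MeasureTheory.Measure.count : MeasureTheory.Measure (ZMod J))) {x} = 1 := by
    intro x
    rw [MeasureTheory.Measure.pi_singleton]
    simp
  simp only [MeasureTheory.lintegral_fintype, hs, mul_one, MeasureTheory.Measure.count_singleton,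
    Fintype.card_fin] at key
  have hpos : (0 : ℝ) ≤ 1 / ((d : ℝ) - 1) := by
    have : 0 < (d : ℝ) - 1 := by linarith
    positivity
  have hpos' : (0 : ℝ) ≤ (d : ℝ) / ((d : ℝ) - 1) := by
    have : 0 < (d : ℝ) - 1 := by linarith
    positivity
  have hline : ∀ (x : Fin d → ZMod J) (i : Fin d), 0 ≤ ∑ a, f (Function.update x i a) :=
    fun x i => Finset.sum_nonneg fun a _ => hf _
  have h1 : ∀ (x : Fin d → ZMod J), ∏ i, (∑ a, ENNReal.ofReal (f (Function.update x i a)))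
      ^ ((1 : ℝ) / ((d : ℝ) - 1)) = ENNReal.ofReal
        (∏ i, (∑ a, f (Function.update x i a)) ^ ((1 : ℝ) / ((d : ℝ) - 1))) := by
    intro x
    rw [ENNReal.ofReal_prod_of_nonneg fun i _ => Real.rpow_nonneg (hline x i) _]
    refine Finset.prod_congr rfl fun i _ => ?_
    rw [← ENNReal.ofReal_sum_of_nonneg fun a _ => hf _,
      ENNReal.ofReal_rpow_of_nonneg (hline x i) hpos]
  simp_rw [h1] at key
  rw [← ENNReal.ofReal_sum_of_nonneg fun x _ =>
      Finset.prod_nonneg fun i _ => Real.rpow_nonneg (hline x i) _,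
    ← ENNReal.ofReal_sum_of_nonneg fun x _ => hf x,
    ENNReal.ofReal_rpow_of_nonneg (Finset.sum_nonneg fun x _ => hf x) hpos'] at key
  exact (ENNReal.ofReal_le_ofReal_iff
    (Real.rpow_nonneg (Finset.sum_nonneg fun x _ => hf x) _)).mp key

/-- The discrete `W^{1,1} ⊂ L^{d/(d-1)}` inequality. -/
lemma sum_rpow_le_of_nonneg {d J : ℕ} [NeZero J] (hd : 1 < d) {L : ℝ} (hL : 0 < L) (v : Grid d J)
    (hv : ∀ x, 0 ≤ v x) :
    (L / J) ^ d * ∑ x, v x ^ ((d : ℝ) / (d - 1)) ≤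
      ((L / J) ^ d * ∑ x, (v x / L + ∑ i, |Dp (L / J) i v x|)) ^ ((d : ℝ) / (d - 1)) := by
  have hJ := natCast_J_pos (J := J)
  set h := L / J with hh_def
  have hh : 0 < h := by positivity
  have hd1 : (1 : ℝ) < d := by exact_mod_cast hd
  have hdm : (0 : ℝ) < (d : ℝ) - 1 := by linarith
  set f : Grid d J := fun x => v x / L + ∑ i, |Dp h i v x| with hf_def
  have hf : ∀ x, 0 ≤ f x := fun x =>
    add_nonneg (div_nonneg (hv x) hL.le) (Finset.sum_nonneg fun i _ => abs_nonneg _)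
  have hline : ∀ (x : Fin d → ZMod J) (i : Fin d), 0 ≤ ∑ a, f (Function.update x i a) :=
    fun x i => Finset.sum_nonneg fun a _ => hf _
  have h1 : ∀ x, v x ^ ((d : ℝ) / (d - 1)) ≤ h ^ ((d : ℝ) / (d - 1)) *
      ∏ i, (∑ a, f (Function.update x i a)) ^ ((1 : ℝ) / ((d : ℝ) - 1)) := by
    intro x
    have h2 : ∀ a : ℝ, 0 ≤ a → a ^ ((d : ℝ) / (d - 1)) =
        ∏ _i : Fin d, a ^ ((1 : ℝ) / ((d : ℝ) - 1)) := by
      intro a ha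
      rw [Finset.prod_const, Finset.card_univ, Fintype.card_fin, ← Real.rpow_natCast,
        ← Real.rpow_mul ha]
      congr 1
      field_simp
    rw [h2 _ (hv x), h2 h hh.le, ← Finset.prod_mul_distrib]
    refine Finset.prod_le_prod (fun i _ => Real.rpow_nonneg (hv x) _) fun i _ => ?_
    rw [← Real.mul_rpow hh.le (hline x i)]
    exact Real.rpow_le_rpow (hv x) (le_grid_line_sum hL v x i) (by positivity)
  calc h ^ d * ∑ x, v x ^ ((d : ℝ) / (d - 1))
      ≤ h ^ d * ∑ x, h ^ ((d : ℝ) / (d - 1)) *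
        ∏ i, (∑ a, f (Function.update x i a)) ^ ((1 : ℝ) / ((d : ℝ) - 1)) := by
        gcongr with x _
        exact h1 x
    _ ≤ h ^ d * (h ^ ((d : ℝ) / (d - 1)) * (∑ x, f x) ^ ((d : ℝ) / (d - 1))) := by
        rw [← Finset.mul_sum]
        gcongr
        exact sum_prod_line_sum_rpow_le hd f hf
    _ = _ := by
        rw [Real.mul_rpow (by positivity) (Finset.sum_nonneg fun x _ => hf x), ← mul_assoc]
        congr 1
        -- The powers of h match because d + d/(d-1) = d · d/(d-1).
        rw [← Real.rpow_natCast h d, ← Real.rpow_mul hh.le, ← Real.rpow_add hh]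
        congr 1
        field_simp
        ring

lemma sob_zero_sq {d J : ℕ} [NeZero J] {h : ℝ} (hh : 0 < h) (U : Grid d J) :
    sob h 0 U ^ 2 = h ^ d * ∑ x, U x ^ 2 := by
  rw [← ip_self_eq hh, ip]
  simp_rw [sq]

lemma sob_zero_le_of_abs_le {d J : ℕ} [NeZero J] {h : ℝ} (hh : 0 < h) {U V : Grid d J}
    (H : ∀ x, |U x| ≤ |V x|) : sob h 0 U ≤ sob h 0 V := by
  apply sob_le_of_sq (apply_nonneg _ _)
  rw [sob_zero_sq hh, sob_zero_sq hh]
  gcongr h ^ d * ∑ x, ?_ with x _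
  exact sq_le_sq.mpr (H x)

lemma sum_abs_mul_le {d J : ℕ} [NeZero J] {h : ℝ} (hh : 0 < h) (U V : Grid d J) :
    h ^ d * ∑ x, |U x| * |V x| ≤ sob h 0 U * sob h 0 V := by
  have h1 := (le_abs_self _).trans (abs_ip_le hh (fun x => |U x|) (fun x => |V x|))
  refine h1.trans ?_
  gcongr <;> exact sob_zero_le_of_abs_le hh fun x => by simp

lemma sob_zero_abs_pow_shiftF {d J : ℕ} [NeZero J] {h : ℝ} (hh : 0 < h) (m : ℕ) (j : Fin d)
    (U : Grid d J) :
    sob h 0 (fun x => |shiftF j U x| ^ m) = sob h 0 (fun x => |U x| ^ m) :=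
  sob_shiftF hh 0 j (fun x => |U x| ^ m)

/-- A discrete chain rule: the algebraic inequality `hc` replaces the mean value theorem, and its
two endpoint powers become the shifted and the unshifted factor. -/
lemma abs_Dp_abs_pow_le {d J : ℕ} {h : ℝ} (hh : 0 < h) (m : ℕ) {c : ℝ}
    (hc : ∀ a b : ℝ, 0 ≤ a → 0 ≤ b → |a ^ (m + 1) - b ^ (m + 1)| ≤ c * (|a - b| * (a ^ m + b ^ m)))
    (hc0 : 0 ≤ c) (j : Fin d) (U : Grid d J) (x : Fin d → ZMod J) :
    |Dp h j (fun y => |U y| ^ (m + 1)) x| ≤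
      c * (|Dp h j U x| * |shiftF j U x| ^ m + |Dp h j U x| * |U x| ^ m) := by
  simp only [Dp, shiftF, LinearMap.smul_apply, LinearMap.sub_apply, LinearMap.id_apply,
    Pi.smul_apply, Pi.sub_apply, LinearMap.funLeft_apply, smul_eq_mul]
  rw [abs_mul, abs_mul, abs_of_pos (inv_pos.mpr hh)]
  set a := U (x + Pi.single j 1)
  set b := U x
  have h1 := hc |a| |b| (abs_nonneg _) (abs_nonneg _)
  have h2 := abs_abs_sub_abs_le_abs_sub a b
  have h3 : c * (|(|a| - |b|)| * (|a| ^ m + |b| ^ m)) ≤ c * (|a - b| * (|a| ^ m + |b| ^ m)) := by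
    gcongr
  calc h⁻¹ * |(|a| ^ (m + 1) - |b| ^ (m + 1))| ≤ h⁻¹ * (c * (|a - b| * (|a| ^ m + |b| ^ m))) := by
        gcongr
        exact h1.trans h3
    _ = _ := by ring

/-- The `L¹` norms of `|U|^{m+1}` and of its differences, in terms of `‖|U|^m‖` and `‖U‖_1`. -/
lemma sum_abs_pow_add_Dp_le {d J : ℕ} [NeZero J] {h L : ℝ} (hh : 0 < h) (hL : 0 < L) (m : ℕ) {c : ℝ}
    (hc : ∀ a b : ℝ, 0 ≤ a → 0 ≤ b → |a ^ (m + 1) - b ^ (m + 1)| ≤ c * (|a - b| * (a ^ m + b ^ m)))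
    (hc0 : 0 ≤ c) (U : Grid d J) :
    h ^ d * ∑ x, (|U x| ^ (m + 1) / L + ∑ i, |Dp h i (fun y => |U y| ^ (m + 1)) x|) ≤
      (1 / L + 2 * c * d) * (sob h 0 (fun x => |U x| ^ m) * sob h 1 U) := by
  set Z := sob h 0 (fun x => |U x| ^ m) with hZ
  have hZ0 : 0 ≤ Z := apply_nonneg _ _
  set Y := sob h 1 U with hY
  have hY0 : 0 ≤ Y := apply_nonneg _ _
  have h1 : h ^ d * ∑ x, |U x| ^ (m + 1) ≤ Z * Y := by
    have := sum_abs_mul_le hh (fun x => |U x| ^ m) U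
    simp only [abs_pow, abs_abs, ← pow_succ] at this
    exact this.trans (mul_le_mul_of_nonneg_left (sob_mono hh (by norm_num) U) hZ0)
  have h2 : ∀ i : Fin d, h ^ d * ∑ x, |Dp h i (fun y => |U y| ^ (m + 1)) x| ≤ 2 * c * (Z * Y) := by
    intro i
    have hD : sob h 0 (Dp h i U) ≤ Y := sob_Dp_le hh 0 i U
    have h3 := sum_abs_mul_le hh (Dp h i U) (fun x => |shiftF i U x| ^ m)
    have h4 := sum_abs_mul_le hh (Dp h i U) (fun x => |U x| ^ m)
    simp only [abs_pow, abs_abs] at h3 h4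
    rw [sob_zero_abs_pow_shiftF hh] at h3
    calc h ^ d * ∑ x, |Dp h i (fun y => |U y| ^ (m + 1)) x|
        ≤ h ^ d * ∑ x, c * (|Dp h i U x| * |shiftF i U x| ^ m + |Dp h i U x| * |U x| ^ m) := by
          gcongr with x _
          exact abs_Dp_abs_pow_le hh m hc hc0 i U x
      _ = c * (h ^ d * ∑ x, |Dp h i U x| * |shiftF i U x| ^ m
            + h ^ d * ∑ x, |Dp h i U x| * |U x| ^ m) := by
          rw [← Finset.mul_sum, Finset.sum_add_distrib]
          ring
      _ ≤ c * (Y * Z + Y * Z) := by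
          have h5 : sob h 0 (Dp h i U) * Z ≤ Y * Z := mul_le_mul_of_nonneg_right hD hZ0
          exact mul_le_mul_of_nonneg_left (add_le_add (h3.trans h5) (h4.trans h5)) hc0
      _ = _ := by ring
  rw [Finset.sum_add_distrib, Finset.sum_comm, ← Finset.sum_div, mul_add, Finset.mul_sum]
  calc h ^ d * ((∑ x, |U x| ^ (m + 1)) / L)
        + ∑ i, h ^ d * ∑ x, |Dp h i (fun y => |U y| ^ (m + 1)) x|
      = (h ^ d * ∑ x, |U x| ^ (m + 1)) / L
        + ∑ i, h ^ d * ∑ x, |Dp h i (fun y => |U y| ^ (m + 1)) x| := by ring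
    _ ≤ Z * Y / L + ∑ _i : Fin d, 2 * c * (Z * Y) := by
        exact add_le_add (div_le_div_of_nonneg_right h1 hL.le) (Finset.sum_le_sum fun i _ => h2 i)
    _ = _ := by
        rw [Finset.sum_const, Finset.card_univ, Fintype.card_fin, nsmul_eq_mul]
        ring

/-- The discrete embedding `H¹ ⊂ ℓ⁶` in dimensions two and three. -/
theorem exists_sob_zero_cube_le (d : ℕ) (hd : d = 2 ∨ d = 3) {L : ℝ} (hL : 0 < L) :
    ∃ C : ℝ, 0 < C ∧ ∀ (J : ℕ) [NeZero J] (U : Grid d J),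
      sob (L / J) 0 (fun x => |U x| ^ 3) ≤ C * sob (L / J) 1 U ^ 3 := by
  rcases hd with rfl | rfl
  · have hc : ∀ a b : ℝ, 0 ≤ a → 0 ≤ b →
        |a ^ (2 + 1) - b ^ (2 + 1)| ≤ (3 / 2) * (|a - b| * (a ^ 2 + b ^ 2)) := by
      intro a b ha hb
      have h1 : a ^ (2 + 1) - b ^ (2 + 1) = (a - b) * (a ^ 2 + a * b + b ^ 2) := by ring
      rw [h1, abs_mul, abs_of_nonneg (by positivity : 0 ≤ a ^ 2 + a * b + b ^ 2)]
      nlinarith [mul_nonneg (abs_nonneg (a - b)) (sq_nonneg (a - b))]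
    set C := 1 / L + 2 * (3 / 2) * ((2 : ℕ) : ℝ) with hC
    have hC0 : 0 < C := by positivity
    refine ⟨C ^ 2, by positivity, fun J _ U => ?_⟩
    have hh : 0 < L / J := div_pos hL natCast_J_pos
    -- In two dimensions the W^{1,1} exponent is 2, so the inequality is applied to |U|³. With Z =
    -- ‖|U|³‖, W = ‖|U|²‖ and Y = ‖U‖_1 it gives Z ≤ C W Y, while Cauchy–Schwarz gives W² ≤ Z Y.
    -- Eliminating W leaves Z² ≤ C² Z Y³, from which Z is cancelled.
    have h1 := sum_rpow_le_of_nonneg (d := 2) (by norm_num) hL (fun x => |U x| ^ 3)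
      (fun x => by positivity)
    have h2 := sum_abs_pow_add_Dp_le hh hL 2 hc (by norm_num) U
    have h3 := sum_abs_mul_le hh (fun x => |U x| ^ 3) U
    simp only [abs_pow, abs_abs] at h3
    set Z := sob (L / J) 0 (fun x => |U x| ^ 3) with hZ
    set W := sob (L / J) 0 (fun x => |U x| ^ 2) with hW
    set Y := sob (L / J) 1 U with hY
    have hZ0 : 0 ≤ Z := apply_nonneg _ _
    have hW0 : 0 ≤ W := apply_nonneg _ _
    have hY0 : 0 ≤ Y := apply_nonneg _ _
    have h4 : W ^ 2 ≤ Z * Y := by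
      rw [hW, sob_zero_sq hh]
      refine le_trans (le_of_eq ?_) (h3.trans
        (mul_le_mul_of_nonneg_left (sob_mono hh (by norm_num) U) hZ0))
      congr 1
      exact Finset.sum_congr rfl fun x _ => by ring
    have h5 : Z ^ 2 ≤ (C * (W * Y)) ^ 2 := by
      have e : (((2 : ℕ) : ℝ) / (((2 : ℕ) : ℝ) - 1)) = ((2 : ℕ) : ℝ) := by norm_num
      rw [e] at h1
      simp only [Real.rpow_natCast] at h1
      rw [hZ, sob_zero_sq hh]
      refine h1.trans (pow_le_pow_left₀ ?_ h2 2)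
      refine mul_nonneg (by positivity) (Finset.sum_nonneg fun x _ => ?_)
      exact add_nonneg (by positivity) (Finset.sum_nonneg fun i _ => abs_nonneg _)
    rcases hZ0.eq_or_lt with h0 | h0
    · rw [← h0]; positivity
    · have h6 : Z * Z ≤ Z * (C ^ 2 * Y ^ 3) := by
        calc Z * Z = Z ^ 2 := by ring
          _ ≤ C ^ 2 * Y ^ 2 * W ^ 2 := by rw [mul_pow, mul_pow] at h5; linarith
          _ ≤ C ^ 2 * Y ^ 2 * (Z * Y) := by gcongr
          _ = _ := by ring
      exact le_of_mul_le_mul_left h6 h0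
  · have hc : ∀ a b : ℝ, 0 ≤ a → 0 ≤ b →
        |a ^ (3 + 1) - b ^ (3 + 1)| ≤ 2 * (|a - b| * (a ^ 3 + b ^ 3)) := by
      intro a b ha hb
      have h1 : a ^ (3 + 1) - b ^ (3 + 1) = (a - b) * (a ^ 3 + a ^ 2 * b + a * b ^ 2 + b ^ 3) := by
        ring
      rw [h1, abs_mul, abs_of_nonneg (by positivity : 0 ≤ a ^ 3 + a ^ 2 * b + a * b ^ 2 + b ^ 3)]
      have h2 : a ^ 3 + a ^ 2 * b + a * b ^ 2 + b ^ 3 ≤ 2 * (a ^ 3 + b ^ 3) := by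
        nlinarith [mul_nonneg (add_nonneg ha hb) (sq_nonneg (a - b))]
      calc |a - b| * _ ≤ |a - b| * (2 * (a ^ 3 + b ^ 3)) := by gcongr
        _ = _ := by ring
    set C := 1 / L + 2 * 2 * ((3 : ℕ) : ℝ) with hC
    have hC0 : 0 < C := by positivity
    refine ⟨C ^ 3, by positivity, fun J _ U => ?_⟩
    have hh : 0 < L / J := div_pos hL natCast_J_pos
    -- In three dimensions the exponent is 3/2, and |U|⁴ is chosen because (|U|⁴)^(3/2) = |U|⁶. This
    -- gives Z² ≤ (C Z Y)^(3/2), which is squared to clear the fractional power before Z³ is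
    -- cancelled.
    have h1 := sum_rpow_le_of_nonneg (d := 3) (by norm_num) hL (fun x => |U x| ^ 4)
      (fun x => by positivity)
    have h2 := sum_abs_pow_add_Dp_le hh hL 3 hc (by norm_num) U
    set Z := sob (L / J) 0 (fun x => |U x| ^ 3) with hZ
    set Y := sob (L / J) 1 U with hY
    have hZ0 : 0 ≤ Z := apply_nonneg _ _
    have hY0 : 0 ≤ Y := apply_nonneg _ _
    have hrp : ∀ a : ℝ, 0 ≤ a → (a ^ (((3 : ℕ) : ℝ) / (((3 : ℕ) : ℝ) - 1))) ^ 2 = a ^ 3 := by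
      intro a ha
      rw [← Real.rpow_natCast, ← Real.rpow_mul ha, ← Real.rpow_natCast a 3]
      congr 1
      norm_num
    have h4 : ∀ x, (|U x| ^ 4) ^ (((3 : ℕ) : ℝ) / (((3 : ℕ) : ℝ) - 1)) = (|U x| ^ 3) ^ 2 := by
      intro x
      rw [← Real.rpow_natCast, ← Real.rpow_natCast, ← Real.rpow_natCast,
        ← Real.rpow_mul (abs_nonneg _), ← Real.rpow_mul (abs_nonneg _)]
      congr 1
      norm_num
    simp only [h4] at h1
    rw [← sob_zero_sq hh (fun x => |U x| ^ 3)] at h1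
    have h5 : (Z ^ 2) ^ 2 ≤ (C * (Z * Y)) ^ 3 := by
      have hS0 : 0 ≤ (L / J) ^ 3 * ∑ x, (|U x| ^ 4 / L
          + ∑ i, |Dp (L / J) i (fun y => |U y| ^ 4) x|) :=
        mul_nonneg (by positivity) (Finset.sum_nonneg fun x _ =>
          add_nonneg (by positivity) (Finset.sum_nonneg fun i _ => abs_nonneg _))
      refine (pow_le_pow_left₀ (by positivity) h1 2).trans ?_
      rw [hrp _ hS0]
      exact pow_le_pow_left₀ hS0 h2 3
    rcases hZ0.eq_or_lt with h0 | h0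
    · rw [← h0]; positivity
    · have h6 : Z ^ 3 * Z ≤ Z ^ 3 * (C ^ 3 * Y ^ 3) := by
        calc Z ^ 3 * Z = (Z ^ 2) ^ 2 := by ring
          _ ≤ _ := h5
          _ = _ := by ring
      exact le_of_mul_le_mul_left h6 (by positivity)

/-! ### Products of grid functions -/

lemma eq_zero_of_sob_eq_zero {d J : ℕ} [NeZero J] {h : ℝ} (hh : 0 < h) {s : ℕ} {U : Grid d J}
    (H : sob h s U = 0) : U = 0 := by
  have h0 : sob h 0 U = 0 :=
    le_antisymm ((sob_mono hh (Nat.zero_le s) U).trans H.le) (apply_nonneg _ _)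
  have h1 := sob_zero_sq hh U
  rw [h0, zero_pow (by norm_num)] at h1
  have h2 : ∑ x, U x ^ 2 = 0 := by
    rcases mul_eq_zero.mp h1.symm with h | h
    · exact absurd h (by positivity)
    · exact h
  ext x
  exact pow_eq_zero_iff (two_ne_zero) |>.mp
    ((Finset.sum_eq_zero_iff_of_nonneg fun x _ => sq_nonneg _).mp h2 x (Finset.mem_univ x))

lemma sob_zero_const {d J : ℕ} [NeZero J] {L : ℝ} (hL : 0 < L) :
    sob (L / J) 0 (1 : Grid d J) ^ 2 = L ^ d := by
  have hJ := natCast_J_pos (J := J)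
  rw [sob_zero_sq (by positivity)]
  simp only [Pi.one_apply, one_pow, Finset.sum_const, Finset.card_univ, Fintype.card_pi_const,
    ZMod.card, nsmul_eq_mul, Nat.cast_pow, mul_one]
  rw [div_pow]
  field_simp

lemma sob_one_const {d J : ℕ} [NeZero J] {L : ℝ} (hL : 0 < L) :
    sob (L / J) 1 (1 : Grid d J) ^ 2 = L ^ d := by
  have hJ := natCast_J_pos (J := J)
  rw [sob_one_sq (by positivity), sob_zero_const hL]
  have : ∀ j : Fin d, Dp (L / J) j (1 : Grid d J) = 0 := by
    intro j
    ext x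
    simp [Dp, shiftF, LinearMap.funLeft_apply]
  simp [this]

lemma sob_one_le {d J : ℕ} [NeZero J] {h : ℝ} (hh : 0 < h) (U : Grid d J) :
    sob h 1 U ≤ sob h 0 U + ∑ j, sob h 0 (Dp h j U) := by
  have h1 : 0 ≤ ∑ j, sob h 0 (Dp h j U) := Finset.sum_nonneg fun j _ => apply_nonneg _ _
  have h2 : 0 ≤ sob h 0 U := apply_nonneg _ _
  refine sob_le_of_sq (add_nonneg h2 h1) ?_
  rw [sob_one_sq hh]
  have h3 : ∑ j, sob h 0 (Dp h j U) ^ 2 ≤ (∑ j, sob h 0 (Dp h j U)) ^ 2 :=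
    Finset.sum_sq_le_sq_sum_of_nonneg fun j _ => apply_nonneg _ _
  nlinarith [mul_nonneg h1 h2]

lemma mul₃_le_add_cube {p q r : ℝ} (hp : 0 ≤ p) (hq : 0 ≤ q) (hr : 0 ≤ r) :
    p * q * r ≤ (p ^ 3 + q ^ 3 + r ^ 3) / 3 := by
  have h1 : 0 ≤ (p + q + r) * ((p - q) ^ 2 + (q - r) ^ 2 + (r - p) ^ 2) := by positivity
  have h2 : (p + q + r) * ((p - q) ^ 2 + (q - r) ^ 2 + (r - p) ^ 2)
      = 2 * (p ^ 3 + q ^ 3 + r ^ 3) - 6 * (p * q * r) := by ring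
  linarith

/-- The Hölder inequality ℓ⁶ · ℓ⁶ · ℓ⁶ ⊂ ℓ² obtained from the arithmetic–geometric mean: after
normalizing by a, b, c the product is bounded pointwise by the mean of the cubes, whose ℓ² norms are
given. -/
lemma sob_zero_mul₃_le_of_cube {d J : ℕ} [NeZero J] {h a b c C : ℝ} (hh : 0 < h) (ha : 0 < a)
    (hb : 0 < b) (hc : 0 < c) {f g k : Grid d J}
    (hf : sob h 0 (fun x => |f x| ^ 3) ≤ C * a ^ 3) (hg : sob h 0 (fun x => |g x| ^ 3) ≤ C * b ^ 3)
    (hk : sob h 0 (fun x => |k x| ^ 3) ≤ C * c ^ 3) :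
    sob h 0 (f * g * k) ≤ C * (a * b * c) := by
  set F : Grid d J := fun x => |f x| ^ 3 with hF
  set G : Grid d J := fun x => |g x| ^ 3 with hG
  set K : Grid d J := fun x => |k x| ^ 3 with hK
  have habc : 0 < a * b * c / 3 := by positivity
  have h1 : sob h 0 (f * g * k) ≤
      sob h 0 ((a * b * c / 3) • ((a ^ 3)⁻¹ • F + (b ^ 3)⁻¹ • G + (c ^ 3)⁻¹ • K)) := by
    refine sob_zero_le_of_abs_le hh fun x => le_trans ?_ (le_abs_self _)
    simp only [Pi.mul_apply, Pi.smul_apply, Pi.add_apply, smul_eq_mul, abs_mul, hF, hG, hK]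
    have h2 := mul₃_le_add_cube (p := |f x| / a) (q := |g x| / b) (r := |k x| / c)
      (by positivity) (by positivity) (by positivity)
    refine le_trans (le_of_eq ?_) ((mul_le_mul_of_nonneg_left h2
      (by positivity : 0 ≤ a * b * c)).trans (le_of_eq ?_))
    · field_simp
    · simp only [div_pow]
      field_simp
  have h2 := map_add_le_add (sob h 0) ((a ^ 3)⁻¹ • F + (b ^ 3)⁻¹ • G) ((c ^ 3)⁻¹ • K)
  have h3 := map_add_le_add (sob h 0) ((a ^ 3)⁻¹ • F) ((b ^ 3)⁻¹ • G)
  have h4 : ∀ (y : ℝ) (V : Grid d J), 0 < y → sob h 0 V ≤ C * y ^ 3 →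
      sob h 0 ((y ^ 3)⁻¹ • V) ≤ C := by
    intro y V hy hV
    have hy3 : 0 < y ^ 3 := by positivity
    rw [map_smul_eq_mul, Real.norm_eq_abs, abs_of_pos (inv_pos.mpr hy3), inv_mul_le_iff₀ hy3]
    linarith
  rw [map_smul_eq_mul, Real.norm_eq_abs, abs_of_pos habc] at h1
  have h5 := h4 a F ha hf
  have h6 := h4 b G hb hg
  have h7 := h4 c K hc hk
  calc _ ≤ _ := h1
    _ ≤ a * b * c / 3 * (C + C + C) := mul_le_mul_of_nonneg_left (by linarith) habc.le
    _ = _ := by ring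

/-- `C` is a constant in the discrete Sobolev inequalities on the torus of side length `L`. -/
structure SobolevConst (d : ℕ) (L C : ℝ) : Prop where
  L_pos : 0 < L
  one_le : 1 ≤ C
  sup_le : ∀ (J : ℕ) [NeZero J] (U : Grid d J) (x : Fin d → ZMod J), |U x| ≤ C * sob (L / J) 2 U
  mul₃_le : ∀ (J : ℕ) [NeZero J] (f g k : Grid d J),
    sob (L / J) 0 (f * g * k) ≤ C * (sob (L / J) 1 f * sob (L / J) 1 g * sob (L / J) 1 k)
  mul₂_le : ∀ (J : ℕ) [NeZero J] (f g : Grid d J),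
    sob (L / J) 0 (f * g) ≤ C * (sob (L / J) 1 f * sob (L / J) 1 g)

theorem exists_sobolevConst (d : ℕ) (hd : d = 2 ∨ d = 3) {L : ℝ} (hL : 0 < L) :
    ∃ C, SobolevConst d L C := by
  obtain ⟨C₁, hC₁, hsup⟩ := exists_abs_le_sob_two d (by omega) hL
  obtain ⟨C₂, hC₂, hcube⟩ := exists_sob_zero_cube_le d hd hL
  have tri : ∀ (J : ℕ) [NeZero J] (f g k : Grid d J),
      sob (L / J) 0 (f * g * k) ≤ C₂ * (sob (L / J) 1 f * sob (L / J) 1 g * sob (L / J) 1 k) := by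
    intro J _ f g k
    have hJ := natCast_J_pos (J := J)
    have hh : 0 < L / J := by positivity
    rcases (apply_nonneg (sob (d := d) (J := J) (L / J) 1) f).eq_or_lt with h | ha
    · rw [← h, eq_zero_of_sob_eq_zero hh h.symm]; simp
    rcases (apply_nonneg (sob (d := d) (J := J) (L / J) 1) g).eq_or_lt with h | hb
    · rw [← h, eq_zero_of_sob_eq_zero hh h.symm]; simp
    rcases (apply_nonneg (sob (d := d) (J := J) (L / J) 1) k).eq_or_lt with h | hc
    · rw [← h, eq_zero_of_sob_eq_zero hh h.symm]; simp
    exact sob_zero_mul₃_le_of_cube hh ha hb hc (hcube J f) (hcube J g) (hcube J k)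
  have hLd : 0 ≤ √(L ^ d) := Real.sqrt_nonneg _
  refine ⟨1 + C₁ + C₂ + C₂ * √(L ^ d), hL, ?_, fun J _ U x => (hsup J U x).trans ?_,
    fun J _ f g k => (tri J f g k).trans ?_, fun J _ f g => ?_⟩
  · nlinarith [mul_nonneg hC₂.le hLd]
  · gcongr
    nlinarith [mul_nonneg hC₂.le hLd]
  · gcongr
    nlinarith [mul_nonneg hC₂.le hLd]
  -- The bilinear bound is the trilinear one with third factor 1, whose H¹ norm is L^(d/2).
  · have h1 := tri J f g 1
    have h2 : sob (L / J) 1 (1 : Grid d J) = √(L ^ d) := by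
      rw [← sob_one_const (J := J) hL, Real.sqrt_sq (apply_nonneg _ _)]
    rw [mul_one, h2] at h1
    have h3 : 0 ≤ sob (L / J) 1 f * sob (L / J) 1 g :=
      mul_nonneg (apply_nonneg _ _) (apply_nonneg _ _)
    nlinarith

lemma Dp_mul {d J : ℕ} (h : ℝ) (j : Fin d) (f g : Grid d J) :
    Dp h j (f * g) = Dp h j f * g + shiftF j f * Dp h j g := by
  ext x
  simp only [Dp, shiftF, LinearMap.smul_apply, LinearMap.sub_apply, LinearMap.id_apply,
    Pi.smul_apply, Pi.sub_apply, LinearMap.funLeft_apply, smul_eq_mul, Pi.mul_apply, Pi.add_apply]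
  ring

lemma Dm_mul {d J : ℕ} (h : ℝ) (j : Fin d) (f g : Grid d J) :
    Dm h j (f * g) = Dm h j f * g + shiftB j f * Dm h j g := by
  ext x
  simp only [Dm, shiftB, LinearMap.smul_apply, LinearMap.sub_apply, LinearMap.id_apply,
    Pi.smul_apply, Pi.sub_apply, LinearMap.funLeft_apply, smul_eq_mul, Pi.mul_apply, Pi.add_apply]
  ring

lemma SobolevConst.C_pos {d : ℕ} {L C : ℝ} (S : SobolevConst d L C) : 0 < C :=
  zero_lt_one.trans_le S.one_le

namespace SobolevConst

variable {d J : ℕ} [NeZero J] {L C : ℝ}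

lemma h_pos (S : SobolevConst d L C) : 0 < L / J := div_pos S.L_pos natCast_J_pos

lemma sob_zero_mul_le (S : SobolevConst d L C) (f g : Grid d J) :
    sob (L / J) 0 (f * g) ≤ C * (sob (L / J) 2 f * sob (L / J) 0 g) := by
  have hh := S.h_pos (J := J)
  have h1 : sob (L / J) 0 (f * g) ≤ sob (L / J) 0 ((C * sob (L / J) 2 f) • g) := by
    refine sob_zero_le_of_abs_le hh fun x => ?_
    simp only [Pi.mul_apply, Pi.smul_apply, smul_eq_mul]
    rw [abs_mul, abs_mul]
    exact mul_le_mul_of_nonneg_right ((S.sup_le J f x).trans (le_abs_self _)) (abs_nonneg _)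
  refine h1.trans (le_of_eq ?_)
  rw [map_smul_eq_mul, Real.norm_eq_abs,
    abs_of_nonneg (mul_nonneg S.C_pos.le (apply_nonneg _ _)), mul_assoc]

/-- In the product rule, the term with the difference on f is a product of two H¹ functions, and the
other term uses the sup bound for f. -/
lemma sob_one_mul_le (S : SobolevConst d L C) (f g : Grid d J) :
    sob (L / J) 1 (f * g) ≤ (1 + 2 * d) * C * (sob (L / J) 2 f * sob (L / J) 1 g) := by
  have hh := S.h_pos (J := J)
  have hC := S.C_pos
  set X := sob (L / J) 2 f * sob (L / J) 1 g with hX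
  have h0 : sob (L / J) 0 (f * g) ≤ C * X := (S.sob_zero_mul_le f g).trans (by
    rw [hX]
    gcongr
    exact sob_mono hh (by norm_num) g)
  have h1 : ∀ j, sob (L / J) 0 (Dp (L / J) j (f * g)) ≤ 2 * C * X := by
    intro j
    rw [Dp_mul]
    refine (map_add_le_add _ _ _).trans ?_
    have h2 : sob (L / J) 0 (Dp (L / J) j f * g) ≤ C * X := (S.mul₂_le J _ _).trans (by
      rw [hX]
      gcongr
      exact sob_Dp_le hh 1 j f)
    have h3 : sob (L / J) 0 (shiftF j f * Dp (L / J) j g) ≤ C * X :=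
      (S.sob_zero_mul_le _ _).trans (by
        rw [hX, sob_shiftF hh]
        gcongr
        exact sob_Dp_le hh 0 j g)
    linarith
  refine (sob_one_le hh _).trans ?_
  calc _ ≤ C * X + ∑ _j : Fin d, 2 * C * X := add_le_add h0 (Finset.sum_le_sum fun j _ => h1 j)
    _ = _ := by
      rw [Finset.sum_const, Finset.card_univ, Fintype.card_fin, nsmul_eq_mul]
      ring

/-- A difference falls on one factor at a time and only that factor pays the higher norm Z.
Linearity in Z is what the Gronwall arguments need. -/
lemma sob_one_mul₃_le (S : SobolevConst d L C) {f g k : Grid d J} {Y Z : ℝ} (hYZ : Y ≤ Z)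
    (hf : sob (L / J) 1 f ≤ Y) (hg : sob (L / J) 1 g ≤ Y) (hk : sob (L / J) 1 k ≤ Y)
    (hf' : sob (L / J) 2 f ≤ Z) (hg' : sob (L / J) 2 g ≤ Z) (hk' : sob (L / J) 2 k ≤ Z) :
    sob (L / J) 1 (f * g * k) ≤ (1 + 3 * d) * C * (Y ^ 2 * Z) := by
  have hh := S.h_pos (J := J)
  have hC := S.C_pos
  have hY : 0 ≤ Y := (apply_nonneg _ _).trans hf
  have hZ : 0 ≤ Z := hY.trans hYZ
  have tri : ∀ {a b c : Grid d J} {α β γ : ℝ}, sob (L / J) 1 a ≤ α → sob (L / J) 1 b ≤ β →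
      sob (L / J) 1 c ≤ γ → sob (L / J) 0 (a * b * c) ≤ C * (α * β * γ) := by
    intro a b c α β γ h1 h2 h3
    have h1' : 0 ≤ α := (apply_nonneg _ _).trans h1
    have h2' : 0 ≤ β := (apply_nonneg _ _).trans h2
    refine (S.mul₃_le J a b c).trans ?_
    gcongr
  have h0 : sob (L / J) 0 (f * g * k) ≤ C * (Y ^ 2 * Z) := (tri hf hg hk).trans (by
    rw [sq]
    gcongr)
  have h1 : ∀ j, sob (L / J) 0 (Dp (L / J) j (f * g * k)) ≤ 3 * C * (Y ^ 2 * Z) := by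
    intro j
    have e : shiftF j (f * g) = shiftF j f * shiftF j g := rfl
    rw [Dp_mul, Dp_mul, add_mul, e]
    have t1 := tri ((sob_Dp_le hh 1 j f).trans hf') hg hk
    have t2 := tri ((sob_shiftF hh 1 j f).le.trans hf) ((sob_Dp_le hh 1 j g).trans hg') hk
    have t3 := tri ((sob_shiftF hh 1 j f).le.trans hf) ((sob_shiftF hh 1 j g).le.trans hg)
      ((sob_Dp_le hh 1 j k).trans hk')
    have t4 := map_add_le_add (sob (L / J) 0)
      (Dp (L / J) j f * g * k + shiftF j f * Dp (L / J) j g * k)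
      (shiftF j f * shiftF j g * Dp (L / J) j k)
    have t5 := map_add_le_add (sob (L / J) 0)
      (Dp (L / J) j f * g * k) (shiftF j f * Dp (L / J) j g * k)
    have e1 : C * (Z * Y * Y) = C * (Y ^ 2 * Z) := by ring
    have e2 : C * (Y * Z * Y) = C * (Y ^ 2 * Z) := by ring
    have e3 : C * (Y * Y * Z) = C * (Y ^ 2 * Z) := by ring
    linarith
  refine (sob_one_le hh _).trans ?_
  calc _ ≤ C * (Y ^ 2 * Z) + ∑ _j : Fin d, 3 * C * (Y ^ 2 * Z) :=
        add_le_add h0 (Finset.sum_le_sum fun j _ => h1 j)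
    _ = _ := by
      rw [Finset.sum_const, Finset.card_univ, Fintype.card_fin, nsmul_eq_mul]
      ring

/-- The outer difference costs one order, so one product rule leaves H¹ norms of products of an H²
factor with a difference of an H² factor. -/
lemma sob_zero_Dm_Dm_mul_le (S : SobolevConst d L C) (k l : Fin d) (f g : Grid d J) :
    sob (L / J) 0 (Dm (L / J) k (Dm (L / J) l (f * g))) ≤
      2 * ((1 + 2 * d) * C) * (sob (L / J) 2 f * sob (L / J) 2 g) := by
  have hh := S.h_pos (J := J)
  have hC := S.C_pos
  refine (sob_Dm_le hh 0 k _).trans ?_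
  rw [Dm_mul]
  have h1 := S.sob_one_mul_le g (Dm (L / J) l f)
  have h2 := S.sob_one_mul_le (shiftB l f) (Dm (L / J) l g)
  rw [sob_shiftB hh] at h2
  rw [mul_comm g] at h1
  refine (map_add_le_add _ _ _).trans ((add_le_add h1 h2).trans ?_)
  have h3 := sob_Dm_le hh 1 l f
  have h4 := sob_Dm_le hh 1 l g
  calc (1 + 2 * d) * C * (sob (L / J) 2 g * sob (L / J) 1 (Dm (L / J) l f)) +
        (1 + 2 * d) * C * (sob (L / J) 2 f * sob (L / J) 1 (Dm (L / J) l g))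
      ≤ (1 + 2 * d) * C * (sob (L / J) 2 g * sob (L / J) 2 f) +
        (1 + 2 * d) * C * (sob (L / J) 2 f * sob (L / J) 2 g) := by gcongr
    _ = _ := by ring

end SobolevConst

/-! ### Operator functions in Fourier variables -/

/-- The entire function `φ₁(z) = ∑ z^n / (n+1)!`. -/
def phiFun (z : ℝ) : ℝ := ∑' n : ℕ, (((n + 1).factorial : ℝ)⁻¹) * z ^ n

lemma summable_phiFun (z : ℝ) : Summable fun n : ℕ => (((n + 1).factorial : ℝ)⁻¹) * z ^ n := by
  refine Summable.of_norm_bounded (Real.summable_pow_div_factorial |z|) fun n => ?_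
  rw [norm_mul, norm_pow, Real.norm_eq_abs z, Real.norm_eq_abs, abs_of_pos (by positivity),
    inv_mul_eq_div]
  gcongr
  exact Nat.le_succ n

lemma mul_phiFun (z : ℝ) : z * phiFun z = Real.exp z - 1 := by
  have h1 : HasSum (fun n : ℕ => z ^ n / (n.factorial : ℝ)) (Real.exp z) := by
    rw [Real.exp_eq_exp_ℝ]
    exact NormedSpace.expSeries_div_hasSum_exp z
  have h2 := (hasSum_nat_add_iff' 1).mpr h1
  have h3 := (summable_phiFun z).hasSum.mul_left z
  have h4 : (fun n : ℕ => z * ((((n + 1).factorial : ℝ)⁻¹) * z ^ n))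
      = fun n : ℕ => z ^ (n + 1) / ((n + 1).factorial : ℝ) := by
    ext n
    rw [pow_succ]
    field_simp
  rw [h4] at h3
  have h5 := h3.unique h2
  simpa [phiFun] using h5

lemma phiFun_zero : phiFun 0 = 1 := by
  rw [phiFun, tsum_eq_single 0]
  · simp
  · intro n hn
    simp [hn]

/-- By z φ₁(z) = e^z - 1, whose right side has the sign of z. -/
lemma phiFun_pos (z : ℝ) : 0 < phiFun z := by
  have h := mul_phiFun z
  rcases lt_trichotomy z 0 with hz | rfl | hz
  · have : Real.exp z < 1 := by simpa using hz
    nlinarith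
  · rw [phiFun_zero]; norm_num
  · have : 1 < Real.exp z := Real.one_lt_exp_iff.mpr hz
    by_contra hc
    nlinarith

lemma phiFun_neg_le_one {z : ℝ} (hz : 0 ≤ z) : phiFun (-z) ≤ 1 := by
  rcases hz.eq_or_lt with rfl | hz
  · rw [neg_zero, phiFun_zero]
  · have h := mul_phiFun (-z)
    have h2 := Real.add_one_le_exp (-z)
    by_contra hc
    nlinarith

/-- `1 / φ₁(-z) = 1 / φ₁(z) + z`. -/
lemma phiFun_neg_inv (z : ℝ) : (phiFun (-z))⁻¹ = (phiFun z)⁻¹ + z := by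
  have h1 := (phiFun_pos z).ne'
  have h2 := (phiFun_pos (-z)).ne'
  suffices h : phiFun z = phiFun (-z) * (1 + z * phiFun z) by
    field_simp
    linarith
  rw [mul_phiFun, add_sub_cancel]
  by_cases hz : z = 0
  · subst hz; simp
  · have h3 := mul_phiFun z
    have h4 := mul_phiFun (-z)
    have h5 : Real.exp (-z) * Real.exp z = 1 := by rw [← Real.exp_add]; simp
    apply mul_left_cancel₀ hz
    linear_combination h3 + Real.exp z * h4 + h5

section Symbols

variable {d J : ℕ} [NeZero J]

/-- Evaluation of an operator at `U`, followed by a Fourier coefficient. -/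
def evalHat (k : Fin d → ZMod J) (U : Grid d J) : (Grid d J →L[ℝ] Grid d J) →L[ℝ] ℂ :=
  (LinearMap.toContinuousLinearMap (fhat k)).comp (ContinuousLinearMap.apply ℝ (Grid d J) U)

lemma evalHat_apply (k : Fin d → ZMod J) (U : Grid d J) (B : Grid d J →L[ℝ] Grid d J) :
    evalHat k U B = fhat k (B U) := rfl

lemma fhat_pow {B : Grid d J →L[ℝ] Grid d J} {k : Fin d → ZMod J} {b : ℝ}
    (hB : ∀ U, fhat k (B U) = (b : ℂ) * fhat k U) (n : ℕ) (U : Grid d J) :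
    fhat k ((B ^ n) U) = ((b ^ n : ℝ) : ℂ) * fhat k U := by
  induction n generalizing U with
  | zero => simp
  | succ n ih =>
    rw [pow_succ, mul_apply_eq_comp, ih, hB]
    push_cast
    ring

lemma fhat_exp {B : Grid d J →L[ℝ] Grid d J} {k : Fin d → ZMod J} {b : ℝ}
    (hB : ∀ U, fhat k (B U) = (b : ℂ) * fhat k U) (U : Grid d J) :
    fhat k (NormedSpace.exp B U) = ((Real.exp b : ℝ) : ℂ) * fhat k U := by
  have h1 := (NormedSpace.exp_series_hasSum_exp' (𝕂 := ℝ) B).mapL (evalHat k U)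
  have h2 : HasSum (fun n : ℕ => b ^ n / (n.factorial : ℝ)) (Real.exp b) := by
    rw [Real.exp_eq_exp_ℝ]
    exact NormedSpace.expSeries_div_hasSum_exp b
  have h3 := (Complex.hasSum_ofReal.mpr h2).mul_right (fhat k U)
  rw [evalHat_apply] at h1
  refine h1.unique ?_
  refine h3.congr_fun fun n => ?_
  rw [map_smul, evalHat_apply, fhat_pow hB, Complex.real_smul]
  push_cast
  ring

lemma fhat_phi1 {B : Grid d J →L[ℝ] Grid d J} {k : Fin d → ZMod J} {b : ℝ}
    (hB : ∀ U, fhat k (B U) = (b : ℂ) * fhat k U) (U : Grid d J) :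
    fhat k (phi1 B U) = ((phiFun b : ℝ) : ℂ) * fhat k U := by
  have h0 : Summable fun n : ℕ => (((n + 1).factorial : ℝ)⁻¹) • B ^ n := by
    refine Summable.of_norm_bounded (Real.summable_pow_div_factorial ‖B‖) fun n => ?_
    rw [norm_smul, Real.norm_eq_abs, abs_of_pos (by positivity), inv_mul_eq_div]
    gcongr
    · exact norm_pow_le B n
    · exact Nat.le_succ n
  have h1 := h0.hasSum.mapL (evalHat k U)
  have h3 := (Complex.hasSum_ofReal.mpr (summable_phiFun b).hasSum).mul_right (fhat k U)
  rw [evalHat_apply] at h1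
  refine h1.unique ?_
  refine h3.congr_fun fun n => ?_
  rw [map_smul, evalHat_apply, fhat_pow hB, Complex.real_smul]
  push_cast
  ring

/-- `Ring.inverse` is a genuine inverse here: φ₁ is positive on the real line, so `phi1 B` is
injective, hence bijective in finite dimension. -/
lemma fhat_calQ {B : Grid d J →L[ℝ] Grid d J} {b : (Fin d → ZMod J) → ℝ}
    (hB : ∀ k U, fhat k (B U) = (b k : ℂ) * fhat k U) (k : Fin d → ZMod J) (U : Grid d J) :
    fhat k (calQ B U) = (((phiFun (b k))⁻¹ : ℝ) : ℂ) * fhat k U := by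
  have hne : ∀ k, ((phiFun (b k) : ℝ) : ℂ) ≠ 0 := fun k => by
    exact_mod_cast (phiFun_pos (b k)).ne'
  have hinj : Function.Injective (phi1 B) := by
    intro V W h
    refine grid_ext_fhat fun k => ?_
    have := congrArg (fhat k) h
    rw [fhat_phi1 (hB k), fhat_phi1 (hB k)] at this
    exact mul_left_cancel₀ (hne k) this
  have hunit : IsUnit (phi1 B) := by
    rw [ContinuousLinearMap.isUnit_iff_bijective]
    exact ⟨hinj, (LinearMap.injective_iff_surjective (f := (phi1 B).toLinearMap)).mp hinj⟩
  have h1 : phi1 B (calQ B U) = U := by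
    have := Ring.mul_inverse_cancel _ hunit
    rw [← mul_apply_eq_comp, calQ, this]
    rfl
  have h2 := congrArg (fhat k) h1
  rw [fhat_phi1 (hB k)] at h2
  rw [← h2, ← mul_assoc, ← Complex.ofReal_mul, inv_mul_cancel₀ (phiFun_pos (b k)).ne']
  simp

end Symbols

/-! ### One step of the exponential integrator -/

lemma norm_add_sq_le_weighted (x y : ℂ) {t : ℝ} (ht : 0 < t) :
    ‖x + y‖ ^ 2 ≤ (1 + t) * ‖x‖ ^ 2 + (1 + 1 / t) * ‖y‖ ^ 2 := by
  have h1 : ‖x + y‖ ^ 2 ≤ (‖x‖ + ‖y‖) ^ 2 := pow_le_pow_left₀ (norm_nonneg _) (norm_add_le x y) 2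
  have h2 : 2 * (‖x‖ * ‖y‖) ≤ t * ‖x‖ ^ 2 + 1 / t * ‖y‖ ^ 2 := by
    have h3 : 0 ≤ (t * ‖x‖ - ‖y‖) ^ 2 / t := by positivity
    have h4 : (t * ‖x‖ - ‖y‖) ^ 2 / t = t * ‖x‖ ^ 2 - 2 * (‖x‖ * ‖y‖) + 1 / t * ‖y‖ ^ 2 := by
      field_simp
      ring
    linarith
  nlinarith

/-- The factor 1 + τβ on the left is the parabolic gain. It survives because (1 + z)e^(-z) ≤ 1 and
(1 + z)φ₁(-z) ≤ 2 for all z = τβ ≥ 0, so stiff modes impose no restriction on τ. The growth factor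
is only 1 + τ, so the estimate can be iterated. -/
lemma mode_step_le {τ β : ℝ} (hτ : 0 < τ) (hβ : 0 ≤ β) (a b : ℂ) :
    (1 + τ * β) * ‖(Real.exp (-(τ * β)) : ℂ) * a + (τ * phiFun (-(τ * β)) : ℝ) * b‖ ^ 2 ≤
      (1 + τ) * (‖a‖ ^ 2 + 4 * τ / (1 + β) * ‖b‖ ^ 2) := by
  set z := τ * β with hz
  have hz0 : 0 ≤ z := by positivity
  set φ := phiFun (-z) with hφ
  have hφ0 : 0 < φ := phiFun_pos _
  have hφ1 : φ ≤ 1 := phiFun_neg_le_one hz0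
  have hzφ : z * φ ≤ 1 := by
    have := mul_phiFun (-z)
    have := Real.exp_pos (-z)
    rw [hφ]
    linarith
  have he : (1 + z) * Real.exp (-z) ≤ 1 := by
    have h1 := Real.add_one_le_exp z
    have h2 : Real.exp z * Real.exp (-z) = 1 := by rw [← Real.exp_add]; simp
    have := Real.exp_pos (-z)
    nlinarith
  -- The weight in Young's inequality. It makes 1 + t at most (1 + τ)(1 + z), and 1/t turns the
  -- square τ² of the forcing into τ/(1 + β).
  have ht : 0 < τ * (1 + β) := by positivity
  have h1 := norm_add_sq_le_weighted ((Real.exp (-z) : ℂ) * a) ((τ * φ : ℝ) * b) ht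
  have e1 : ‖(Real.exp (-z) : ℂ) * a‖ ^ 2 = Real.exp (-z) ^ 2 * ‖a‖ ^ 2 := by
    rw [norm_mul, mul_pow, Complex.norm_real, Real.norm_eq_abs, sq_abs]
  have e2 : ‖((τ * φ : ℝ) : ℂ) * b‖ ^ 2 = τ ^ 2 * φ ^ 2 * ‖b‖ ^ 2 := by
    rw [norm_mul, mul_pow, Complex.norm_real, Real.norm_eq_abs, sq_abs, mul_pow]
  rw [e1, e2] at h1
  have hA : (1 + z) * ((1 + τ * (1 + β)) * Real.exp (-z) ^ 2) ≤ 1 + τ := by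
    have h2 : 1 + τ * (1 + β) ≤ (1 + τ) * (1 + z) := by rw [hz]; nlinarith [mul_nonneg hτ.le hz0]
    have h3 : ((1 + z) * Real.exp (-z)) ^ 2 ≤ 1 :=
      pow_le_one₀ (by positivity) he
    calc (1 + z) * ((1 + τ * (1 + β)) * Real.exp (-z) ^ 2)
        ≤ (1 + z) * ((1 + τ) * (1 + z) * Real.exp (-z) ^ 2) := by gcongr
      _ = (1 + τ) * ((1 + z) * Real.exp (-z)) ^ 2 := by ring
      _ ≤ (1 + τ) * 1 := by gcongr
      _ = _ := mul_one _
  have hB : (1 + z) * ((1 + 1 / (τ * (1 + β))) * (τ ^ 2 * φ ^ 2)) ≤ (1 + τ) * (4 * τ / (1 + β)) := by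
    have h2 : 1 + τ * (1 + β) ≤ (1 + τ) * (1 + z) := by rw [hz]; nlinarith [mul_nonneg hτ.le hz0]
    have h3 : ((1 + z) * φ) ^ 2 ≤ 2 ^ 2 := pow_le_pow_left₀ (by positivity) (by linarith) 2
    calc (1 + z) * ((1 + 1 / (τ * (1 + β))) * (τ ^ 2 * φ ^ 2))
        = τ / (1 + β) * ((1 + z) * φ ^ 2 * (1 + τ * (1 + β))) := by field_simp; ring
      _ ≤ τ / (1 + β) * ((1 + z) * φ ^ 2 * ((1 + τ) * (1 + z))) := by gcongr
      _ = τ / (1 + β) * (1 + τ) * ((1 + z) * φ) ^ 2 := by ring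
      _ ≤ τ / (1 + β) * (1 + τ) * 2 ^ 2 := by gcongr
      _ = _ := by ring
  calc (1 + z) * ‖(Real.exp (-z) : ℂ) * a + (τ * φ : ℝ) * b‖ ^ 2
      ≤ (1 + z) * ((1 + τ * (1 + β)) * (Real.exp (-z) ^ 2 * ‖a‖ ^ 2) +
        (1 + 1 / (τ * (1 + β))) * (τ ^ 2 * φ ^ 2 * ‖b‖ ^ 2)) := by gcongr
    _ = (1 + z) * ((1 + τ * (1 + β)) * Real.exp (-z) ^ 2) * ‖a‖ ^ 2 +
        (1 + z) * ((1 + 1 / (τ * (1 + β))) * (τ ^ 2 * φ ^ 2)) * ‖b‖ ^ 2 := by ring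
    _ ≤ (1 + τ) * ‖a‖ ^ 2 + (1 + τ) * (4 * τ / (1 + β)) * ‖b‖ ^ 2 := by gcongr
    _ = _ := by ring

/-- Young's inequality with weight 1. The factor 2 forbids long iteration, but the forcing gains the
full (1 + β)⁻², since τφ₁(-z)(1 + β) = τφ₁(-z) + zφ₁(-z) ≤ 1 + τ. One step thus takes ℓ² forcing to
H² without a time sum. -/
lemma mode_jump_le {τ β : ℝ} (hτ : 0 < τ) (hβ : 0 ≤ β) (a b : ℂ) :
    ‖(Real.exp (-(τ * β)) : ℂ) * a + (τ * phiFun (-(τ * β)) : ℝ) * b‖ ^ 2 ≤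
      2 * ‖a‖ ^ 2 + 2 * ((1 + τ) / (1 + β)) ^ 2 * ‖b‖ ^ 2 := by
  set z := τ * β with hz
  have hz0 : 0 ≤ z := by positivity
  set φ := phiFun (-z) with hφ
  have hφ0 : 0 < φ := phiFun_pos _
  have hφ1 : φ ≤ 1 := phiFun_neg_le_one hz0
  have hzφ : z * φ ≤ 1 := by
    have := mul_phiFun (-z)
    have := Real.exp_pos (-z)
    rw [hφ]
    linarith
  have h1 := norm_add_sq_le_weighted ((Real.exp (-z) : ℂ) * a) ((τ * φ : ℝ) * b) one_pos
  have e1 : ‖(Real.exp (-z) : ℂ) * a‖ ^ 2 = Real.exp (-z) ^ 2 * ‖a‖ ^ 2 := by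
    rw [norm_mul, mul_pow, Complex.norm_real, Real.norm_eq_abs, sq_abs]
  have e2 : ‖((τ * φ : ℝ) : ℂ) * b‖ ^ 2 = (τ * φ) ^ 2 * ‖b‖ ^ 2 := by
    rw [norm_mul, mul_pow, Complex.norm_real, Real.norm_eq_abs, sq_abs]
  rw [e1, e2] at h1
  have h2 : Real.exp (-z) ^ 2 ≤ 1 :=
    pow_le_one₀ (Real.exp_pos _).le (Real.exp_le_one_iff.mpr (by linarith))
  have h3 : τ * φ ≤ (1 + τ) / (1 + β) := by
    rw [le_div_iff₀ (by positivity)]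
    calc τ * φ * (1 + β) = τ * φ + z * φ := by rw [hz]; ring
      _ ≤ τ * 1 + 1 := by gcongr
      _ = _ := by ring
  have h4 : (τ * φ) ^ 2 ≤ ((1 + τ) / (1 + β)) ^ 2 := by gcongr
  calc _ ≤ _ := h1
    _ = 2 * (Real.exp (-z) ^ 2 * ‖a‖ ^ 2) + 2 * (τ * φ) ^ 2 * ‖b‖ ^ 2 := by ring
    _ ≤ 2 * (1 * ‖a‖ ^ 2) + 2 * ((1 + τ) / (1 + β)) ^ 2 * ‖b‖ ^ 2 := by gcongr
    _ = _ := by ring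

/-- Dividing the step by φ cancels the explicit stabilization and leaves (q + τ(ν + γκ))(a' - a) =
-τ(γg + νa). Testing with a' - a and polarizing ν Re(a · conj(a' - a)) gives the identity; half of
the operator and γκ/2 remain as dissipation. -/
lemma mode_energy_identity {τ γ κ ν φ q : ℝ} (hτ : 0 < τ) (hφ : φ ≠ 0)
    (hinv : φ⁻¹ = q + τ * (ν + γ * κ)) {a a' g : ℂ}
    (h : a' = ((1 - τ * (ν + γ * κ) * φ : ℝ) : ℂ) * a + ((τ * φ : ℝ) : ℂ) *
      (-(γ • g) + (γ * κ) • a)) :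
    γ * (g * (starRingEnd ℂ) (a' - a)).re +
      (((ν : ℂ) * a' * (starRingEnd ℂ) a').re - ((ν : ℂ) * a * (starRingEnd ℂ) a).re) / 2 =
      -(1 / τ * (((q : ℂ) * (a' - a) * (starRingEnd ℂ) (a' - a)).re +
        τ / 2 * (((ν + γ * κ : ℝ) : ℂ) * (a' - a) * (starRingEnd ℂ) (a' - a)).re)) -
      γ * κ / 2 * ((a' - a) * (starRingEnd ℂ) (a' - a)).re := by
  have hre := congrArg Complex.re h
  have him := congrArg Complex.im h
  simp only [Complex.add_re, Complex.add_im, Complex.re_ofReal_mul, Complex.im_ofReal_mul,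
    Complex.neg_re, Complex.neg_im, Complex.smul_re, Complex.smul_im, smul_eq_mul] at hre him
  have hre' : (q + τ * (ν + γ * κ)) * (a'.re - a.re) = τ * (-(γ * g.re) - ν * a.re) := by
    rw [← hinv, hre]
    field_simp
    ring
  have him' : (q + τ * (ν + γ * κ)) * (a'.im - a.im) = τ * (-(γ * g.im) - ν * a.im) := by
    rw [← hinv, him]
    field_simp
    ring
  simp only [Complex.mul_re, Complex.mul_im, Complex.conj_re, Complex.conj_im, Complex.sub_re,
    Complex.sub_im, Complex.ofReal_re, Complex.ofReal_im]
  field_simp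
  linear_combination (2 * (a'.re - a.re)) * hre' + (2 * (a'.im - a.im)) * him'

section Step

variable {d J : ℕ} [NeZero J]

/-- `U'` arises from `U` by one step of the exponential Euler method with an operator of symbol
`β` and the forcing term `F`. -/
def ETDStep (τ : ℝ) (β : (Fin d → ZMod J) → ℝ) (U F U' : Grid d J) : Prop :=
  ∀ k, fhat k U' = (Real.exp (-(τ * β k)) : ℂ) * fhat k U
    + (τ * phiFun (-(τ * β k)) : ℝ) * fhat k F

lemma etdStep_of_eq {Λ : Grid d J →L[ℝ] Grid d J} {β : (Fin d → ZMod J) → ℝ} {τ : ℝ}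
    (hΛ : ∀ k U, fhat k (Λ U) = (β k : ℂ) * fhat k U) {U F U' : Grid d J}
    (h : U' = NormedSpace.exp (-τ • Λ) U + τ • phi1 (-τ • Λ) F) : ETDStep τ β U F U' := by
  intro k
  have hB : ∀ V, fhat k ((-τ • Λ) V) = ((-(τ * β k) : ℝ) : ℂ) * fhat k V := by
    intro V
    rw [smul_apply, map_smul, hΛ, Complex.real_smul]
    push_cast
    ring
  rw [h, map_add, map_smul, fhat_exp hB, fhat_phi1 hB, Complex.real_smul]
  push_cast
  ring

/-- The parabolic energy estimate for one step. -/
lemma ETDStep.sob_sq_add_le {τ h c : ℝ} (hτ : 0 < τ) (hh : 0 < h) (hc : 0 < c) {m : ℕ} (r : ℕ)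
    {β : (Fin d → ZMod J) → ℝ} (hβ : ∀ k, 0 ≤ β k)
    (hcβ : ∀ k, c * (1 + lam h k) ^ m ≤ 1 + β k) {U F U' : Grid d J} (hU : ETDStep τ β U F U') :
    sob h (m + r) U' ^ 2 + τ * c * sob h (2 * m + r) U' ^ 2 ≤
      (1 + τ) ^ 2 * (sob h (m + r) U ^ 2 + 4 * τ / c * sob h r F ^ 2) := by
  have hJ := J_pow_pos (d := d) (J := J)
  have hq : 0 ≤ h ^ d / (J : ℝ) ^ d := by positivity
  have key : ∀ k, (1 + lam h k) ^ (m + r) * ‖fhat k U'‖ ^ 2 +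
      τ * c * ((1 + lam h k) ^ (2 * m + r) * ‖fhat k U'‖ ^ 2) ≤
      (1 + τ) ^ 2 * ((1 + lam h k) ^ (m + r) * ‖fhat k U‖ ^ 2 +
        4 * τ / c * ((1 + lam h k) ^ r * ‖fhat k F‖ ^ 2)) := by
    intro k
    have hβk := hβ k
    have hl := lam_nonneg h k
    have h1 := mode_step_le hτ hβk (fhat k U) (fhat k F)
    rw [← hU k] at h1
    set w := 1 + lam h k with hw
    have hw0 : 0 < w := by positivity
    -- The origin of the second factor 1 + τ: the weight w^m is controlled by 1 + β and not by β
    -- alone, because β may vanish at zero frequency up to the stabilization.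
    have h2 : 1 + τ * (c * w ^ m) ≤ (1 + τ) * (1 + τ * β k) := by
      have h3 := mul_le_mul_of_nonneg_left (hcβ k) hτ.le
      nlinarith [mul_nonneg hτ.le (mul_nonneg hτ.le hβk)]
    have h3 : w ^ m * (4 * τ / (1 + β k)) ≤ 4 * τ / c := by
      rw [mul_div_assoc', div_le_div_iff₀ (by positivity) hc]
      have := mul_le_mul_of_nonneg_left (hcβ k) (by positivity : 0 ≤ 4 * τ)
      linarith
    calc w ^ (m + r) * ‖fhat k U'‖ ^ 2 + τ * c * (w ^ (2 * m + r) * ‖fhat k U'‖ ^ 2)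
        = w ^ (m + r) * ((1 + τ * (c * w ^ m)) * ‖fhat k U'‖ ^ 2) := by ring
      _ ≤ w ^ (m + r) * ((1 + τ) * (1 + τ * β k) * ‖fhat k U'‖ ^ 2) := by gcongr
      _ = (1 + τ) * w ^ (m + r) * ((1 + τ * β k) * ‖fhat k U'‖ ^ 2) := by ring
      _ ≤ (1 + τ) * w ^ (m + r) * ((1 + τ) * (‖fhat k U‖ ^ 2 +
          4 * τ / (1 + β k) * ‖fhat k F‖ ^ 2)) := by gcongr
      _ = (1 + τ) ^ 2 * (w ^ (m + r) * ‖fhat k U‖ ^ 2 +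
          w ^ m * (4 * τ / (1 + β k)) * (w ^ r * ‖fhat k F‖ ^ 2)) := by ring
      _ ≤ _ := by gcongr
  simp only [sob_sq hh]
  have hs := mul_le_mul_of_nonneg_left (Finset.sum_le_sum fun k (_ : k ∈ Finset.univ) => key k) hq
  simp only [Finset.sum_add_distrib, ← Finset.mul_sum] at hs
  linarith

/-- A single step loses no regularity, whatever its length. -/
lemma ETDStep.sob_two_sq_le {τ h c : ℝ} (hτ : 0 < τ) (hh : 0 < h) (hc : 0 < c)
    {β : (Fin d → ZMod J) → ℝ} (hβ : ∀ k, 0 ≤ β k)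
    (hcβ : ∀ k, c * (1 + lam h k) ≤ 1 + β k) {U F U' : Grid d J} (hU : ETDStep τ β U F U') :
    sob h 2 U' ^ 2 ≤ 2 * sob h 2 U ^ 2 + 2 * ((1 + τ) / c) ^ 2 * sob h 0 F ^ 2 := by
  have hJ := J_pow_pos (d := d) (J := J)
  have hq : 0 ≤ h ^ d / (J : ℝ) ^ d := by positivity
  have key : ∀ k, (1 + lam h k) ^ 2 * ‖fhat k U'‖ ^ 2 ≤
      2 * ((1 + lam h k) ^ 2 * ‖fhat k U‖ ^ 2) +
        2 * ((1 + τ) / c) ^ 2 * ((1 + lam h k) ^ 0 * ‖fhat k F‖ ^ 2) := by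
    intro k
    have hβk := hβ k
    have hl := lam_nonneg h k
    have h1 := mode_jump_le hτ hβk (fhat k U) (fhat k F)
    rw [← hU k] at h1
    set w := 1 + lam h k with hw
    have hw0 : 0 < w := by positivity
    have h3 : w * ((1 + τ) / (1 + β k)) ≤ (1 + τ) / c := by
      rw [mul_div_assoc', div_le_div_iff₀ (by positivity) hc]
      have := mul_le_mul_of_nonneg_left (hcβ k) (by positivity : 0 ≤ 1 + τ)
      linarith
    have h4 : (w * ((1 + τ) / (1 + β k))) ^ 2 ≤ ((1 + τ) / c) ^ 2 :=
      pow_le_pow_left₀ (by positivity) h3 2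
    calc w ^ 2 * ‖fhat k U'‖ ^ 2
        ≤ w ^ 2 * (2 * ‖fhat k U‖ ^ 2 + 2 * ((1 + τ) / (1 + β k)) ^ 2 * ‖fhat k F‖ ^ 2) := by gcongr
      _ = 2 * (w ^ 2 * ‖fhat k U‖ ^ 2) +
          2 * (w * ((1 + τ) / (1 + β k))) ^ 2 * (w ^ 0 * ‖fhat k F‖ ^ 2) := by ring
      _ ≤ _ := by gcongr
  simp only [sob_sq hh]
  have hs := mul_le_mul_of_nonneg_left (Finset.sum_le_sum fun k (_ : k ∈ Finset.univ) => key k) hq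
  simp only [Finset.sum_add_distrib, ← Finset.mul_sum] at hs
  linarith

/-- The energy identity of one step: `A` is the stiff operator, `G` the variation of the nonlinear
energy, multiplied by `γ`, and `κ` the stabilization. -/
lemma ETDStep.energy_identity {P : Params} {τ γ κ : ℝ} (hτ : 0 < τ)
    {A : Grid d J →ₗ[ℝ] Grid d J} {Λ : Grid d J →L[ℝ] Grid d J} {ν : (Fin d → ZMod J) → ℝ}
    (hA : ∀ k U, fhat k (A U) = (ν k : ℂ) * fhat k U)
    (hΛ : ∀ k U, fhat k (Λ U) = ((ν k + γ * κ : ℝ) : ℂ) * fhat k U)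
    {U G U' : Grid d J}
    (hU : ETDStep τ (fun k => ν k + γ * κ) U (-(γ • G) + (γ * κ) • U) U') :
    γ * ip (P.h J) G (U' - U) + (ip (P.h J) (A U') U' - ip (P.h J) (A U) U) / 2 =
      -(1 / τ * P.dissSq τ Λ (U' - U)) - γ * κ / 2 * ip (P.h J) (U' - U) (U' - U) := by
  have hQ := fhat_calQ (B := τ • Λ) (b := fun k => τ * (ν k + γ * κ)) (fun k V => by
    rw [smul_apply, map_smul, hΛ, Complex.real_smul]
    push_cast
    ring)
  have key : ∀ k, γ * (fhat k G * (starRingEnd ℂ) (fhat k (U' - U))).re +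
      ((fhat k (A U') * (starRingEnd ℂ) (fhat k U')).re -
        (fhat k (A U) * (starRingEnd ℂ) (fhat k U)).re) / 2 =
      -(1 / τ * ((fhat k (calQ (τ • Λ) (U' - U)) * (starRingEnd ℂ) (fhat k (U' - U))).re +
        τ / 2 * (fhat k (Λ (U' - U)) * (starRingEnd ℂ) (fhat k (U' - U))).re)) -
      γ * κ / 2 * (fhat k (U' - U) * (starRingEnd ℂ) (fhat k (U' - U))).re := by
    intro k
    rw [hQ, hΛ, hA, hA]
    set z := τ * (ν k + γ * κ) with hz
    have hφ := (phiFun_pos (-z)).ne'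
    have hinv := phiFun_neg_inv z
    set q := (phiFun z)⁻¹ with hq
    have he : Real.exp (-z) = 1 - z * phiFun (-z) := by
      have := mul_phiFun (-z)
      linarith
    have h1 := hU k
    simp only [← hz, he, map_add, map_neg, map_smul] at h1
    rw [map_sub]
    exact mode_energy_identity hτ hφ hinv h1
  have hs := congrArg (fun t => P.h J ^ d / (J : ℝ) ^ d * t)
    (Finset.sum_congr rfl fun k (_ : k ∈ Finset.univ) => key k)
  simp only [Params.dissSq, ip_eq_fourier]
  simp only [Finset.sum_add_distrib, Finset.sum_sub_distrib, Finset.sum_neg_distrib,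
    ← Finset.mul_sum, ← Finset.sum_div] at hs
  linarith

end Step

namespace Params

/-! ### The energy law -/

section EnergyLaw

variable {d J : ℕ} [NeZero J] {P : Params}

lemma Admissible.h_pos (hP : P.Admissible d) : 0 < P.h J := div_pos hP.L_pos natCast_J_pos

lemma g_pos (Q : TGrid d J) (u : Grid d J) (s : ℝ) : 0 < P.g Q u s := by
  unfold g; positivity

lemma fhat_LQ (γ : ℝ) (k : Fin d → ZMod J) (U : Grid d J) :
    fhat k (P.LQ d J γ U) = ((P.K * lam (P.h J) k + γ * P.κ₁ : ℝ) : ℂ) * fhat k U := by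
  have h : P.LQ d J γ U = -P.K • lap (P.h J) U + (γ * P.κ₁) • U := rfl
  rw [h, map_add, map_smul, map_smul, fhat_lap, Complex.real_smul, Complex.real_smul]
  push_cast
  ring

lemma fhat_Lu (γ : ℝ) (k : Fin d → ZMod J) (U : Grid d J) :
    fhat k (P.Lu d J γ U) = ((2 * P.B₀ * lam (P.h J) k ^ 2 + γ * P.κ₂ : ℝ) : ℂ) * fhat k U := by
  have h : P.Lu d J γ U = (2 * P.B₀) • lap (P.h J) (lap (P.h J) U) + (γ * P.κ₂) • U := rfl
  rw [h, map_add, map_smul, map_smul, fhat_lap, fhat_lap, Complex.real_smul, Complex.real_smul]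
  push_cast
  ring

lemma comp_NQ (Q : TGrid d J) (u : Grid d J) (s : ℝ) (i j : Fin d) :
    comp (P.NQ Q u s) i j =
      -(P.g Q u s • comp (P.HQ Q u) i j) + (P.g Q u s * P.κ₁) • comp Q i j := by
  ext x
  simp [comp, NQ]

lemma Nu_eq (Q : TGrid d J) (u : Grid d J) (s : ℝ) :
    P.Nu Q u s = -(P.g Q u s • P.mu Q u) + (P.g Q u s * P.κ₂) • u := by
  ext x
  simp [Nu]

lemma Step.etdQ {τ : ℝ} {Q Q' : TGrid d J} {u u' : Grid d J} {s s' : ℝ}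
    (hS : P.Step τ Q u s Q' u' s') (i j : Fin d) :
    ETDStep τ (fun k => P.K * lam (P.h J) k + P.g Q u s * P.κ₁) (comp Q i j)
      (comp (P.NQ Q u s) i j) (comp Q' i j) :=
  etdStep_of_eq (fhat_LQ _) (hS.Q_eq i j)

lemma Step.etdu {τ : ℝ} {Q Q' : TGrid d J} {u u' : Grid d J} {s s' : ℝ}
    (hS : P.Step τ Q u s Q' u' s') :
    ETDStep τ (fun k => 2 * P.B₀ * lam (P.h J) k ^ 2 + P.g Q u s * P.κ₂) u (P.Nu Q u s) u' :=
  etdStep_of_eq (fhat_Lu _) hS.u_eq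

/-- The quadratic part of the discrete energy. -/
def elastic (P : Params) (Q : TGrid d J) (u : Grid d J) : ℝ :=
  P.K / 2 * ∑ i, ∑ j, ∑ l, sob (P.h J) 0 (Dp (P.h J) l (comp Q i j)) ^ 2
    + P.B₀ * sob (P.h J) 0 (lap (P.h J) u) ^ 2

lemma Admissible.elastic_nonneg (hP : P.Admissible d) (Q : TGrid d J) (u : Grid d J) :
    0 ≤ P.elastic Q u := by
  have h1 := hP.K_pos
  have h2 := hP.B₀_pos
  have h3 : 0 ≤ ∑ i, ∑ j, ∑ l, sob (P.h J) 0 (Dp (P.h J) l (comp Q i j)) ^ 2 :=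
    Finset.sum_nonneg fun i _ => Finset.sum_nonneg fun j _ => Finset.sum_nonneg fun l _ =>
      sq_nonneg _
  unfold elastic
  positivity

lemma dissSq_nonneg (hP : P.Admissible d) {τ : ℝ} (hτ : 0 < τ) {Λ : Grid d J →L[ℝ] Grid d J}
    {β : (Fin d → ZMod J) → ℝ} (hβ : ∀ k, 0 ≤ β k)
    (hΛ : ∀ k U, fhat k (Λ U) = (β k : ℂ) * fhat k U) (U : Grid d J) :
    0 ≤ P.dissSq τ Λ U := by
  have hh := hP.h_pos (J := J)
  have hJ := J_pow_pos (d := d) (J := J)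
  have hQ := fhat_calQ (B := τ • Λ) (b := fun k => τ * β k) (fun k V => by
    rw [smul_apply, map_smul, hΛ, Complex.real_smul]
    push_cast
    ring)
  have hre : ∀ (c : ℝ) (a : ℂ), ((c : ℂ) * a * (starRingEnd ℂ) a).re = c * ‖a‖ ^ 2 := by
    intro c a
    rw [mul_assoc, Complex.re_ofReal_mul, Complex.mul_conj, Complex.ofReal_re,
      Complex.normSq_eq_norm_sq]
  simp only [dissSq, ip_eq_fourier, hQ, hΛ, hre]
  have h1 : 0 ≤ ∑ k, (phiFun (τ * β k))⁻¹ * ‖fhat k U‖ ^ 2 := Finset.sum_nonneg fun k _ => by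
    have := phiFun_pos (τ * β k)
    positivity
  have h2 : 0 ≤ ∑ k, β k * ‖fhat k U‖ ^ 2 := Finset.sum_nonneg fun k _ => by
    have := hβ k
    positivity
  positivity

lemma Admissible.symbolQ_nonneg (hP : P.Admissible d) {γ : ℝ} (hγ : 0 ≤ γ) (k : Fin d → ZMod J) :
    0 ≤ P.K * lam (P.h J) k + γ * P.κ₁ := by
  have := hP.K_pos
  have := hP.κ₁_pos
  have := lam_nonneg (P.h J) k
  positivity

lemma Admissible.symbolu_nonneg (hP : P.Admissible d) {γ : ℝ} (hγ : 0 ≤ γ) (k : Fin d → ZMod J) :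
    0 ≤ 2 * P.B₀ * lam (P.h J) k ^ 2 + γ * P.κ₂ := by
  have := hP.B₀_pos
  have := hP.κ₂_pos
  positivity

lemma Admissible.rate_nonneg (hP : P.Admissible d) {τ : ℝ} (hτ : 0 < τ) (Q Q' : TGrid d J)
    (u u' : Grid d J) (s : ℝ) : 0 ≤ P.rate τ Q u s Q' u' := by
  have hγ := (g_pos (P := P) Q u s).le
  have h1 : 0 ≤ ∑ i, ∑ j, P.dissSq τ (P.LQ d J (P.g Q u s)) (comp (Q' - Q) i j) :=
    Finset.sum_nonneg fun i _ => Finset.sum_nonneg fun j _ =>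
      dissSq_nonneg hP hτ (hP.symbolQ_nonneg hγ) (fhat_LQ _) _
  have h2 := dissSq_nonneg hP hτ (hP.symbolu_nonneg hγ) (fhat_Lu (P := P) _) (u' - u)
  unfold rate
  positivity

/-- The modified energy law of the scheme before relaxation. -/
lemma Step.energy_identity (hP : P.Admissible d) {τ : ℝ} (hτ : 0 < τ) {Q Q' : TGrid d J}
    {u u' : Grid d J} {s s' : ℝ} (hS : P.Step τ Q u s Q' u' s') :
    P.elastic Q' u' + P.sTilde Q u s Q' u' = P.elastic Q u + s - P.rate τ Q u s Q' u'
      - P.g Q u s * P.κ₁ / 2 * (∑ i, ∑ j, sob (P.h J) 0 (comp (Q' - Q) i j) ^ 2)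
      - P.g Q u s * P.κ₂ / 2 * sob (P.h J) 0 (u' - u) ^ 2 := by
  have hh := hP.h_pos (J := J)
  set γ := P.g Q u s with hγ
  have hQ : ∀ i j, γ * ip (P.h J) (comp (P.HQ Q u) i j) (comp (Q' - Q) i j)
      + P.K / 2 * ∑ l, sob (P.h J) 0 (Dp (P.h J) l (comp Q' i j)) ^ 2
      - P.K / 2 * ∑ l, sob (P.h J) 0 (Dp (P.h J) l (comp Q i j)) ^ 2
      = -(1 / τ * P.dissSq τ (P.LQ d J γ) (comp (Q' - Q) i j))
        - γ * P.κ₁ / 2 * sob (P.h J) 0 (comp (Q' - Q) i j) ^ 2 := by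
    intro i j
    have h1 := hS.etdQ i j
    rw [comp_NQ, ← hγ] at h1
    have h2 := ETDStep.energy_identity (P := P) hτ (A := -P.K • lap (P.h J))
      (ν := fun k => P.K * lam (P.h J) k) (fun k U => by
        rw [LinearMap.smul_apply, map_smul, fhat_lap, Complex.real_smul]
        push_cast
        ring) (fhat_LQ γ) h1
    have h3 : ∀ U : Grid d J, ip (P.h J) ((-P.K • lap (P.h J)) U) U
        = P.K * ∑ l, sob (P.h J) 0 (Dp (P.h J) l U) ^ 2 := by
      intro U
      have e : ip (P.h J) ((-P.K • lap (P.h J)) U) U = -P.K * ip (P.h J) (lap (P.h J) U) U := by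
        simp only [ip, LinearMap.smul_apply, Pi.smul_apply, smul_eq_mul, mul_assoc,
          ← Finset.mul_sum]
        ring
      rw [e, ip_lap_self hh]
      ring
    rw [h3, h3, ip_self_eq hh] at h2
    have e : comp (Q' - Q) i j = comp Q' i j - comp Q i j := rfl
    rw [e]
    linarith
  have hu : γ * ip (P.h J) (P.mu Q u) (u' - u) + P.B₀ * sob (P.h J) 0 (lap (P.h J) u') ^ 2
      - P.B₀ * sob (P.h J) 0 (lap (P.h J) u) ^ 2
      = -(1 / τ * P.dissSq τ (P.Lu d J γ) (u' - u))
        - γ * P.κ₂ / 2 * sob (P.h J) 0 (u' - u) ^ 2 := by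
    have h1 := hS.etdu
    rw [Nu_eq, ← hγ] at h1
    have h2 := ETDStep.energy_identity (P := P) hτ
      (A := (2 * P.B₀) • (lap (P.h J) ∘ₗ lap (P.h J)))
      (ν := fun k => 2 * P.B₀ * lam (P.h J) k ^ 2) (fun k U => by
        rw [LinearMap.smul_apply, map_smul, LinearMap.comp_apply, fhat_lap, fhat_lap,
          Complex.real_smul]
        push_cast
        ring) (fhat_Lu γ) h1
    have h3 : ∀ U : Grid d J, ip (P.h J) (((2 * P.B₀) • (lap (P.h J) ∘ₗ lap (P.h J))) U) U
        = 2 * P.B₀ * sob (P.h J) 0 (lap (P.h J) U) ^ 2 := by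
      intro U
      rw [← ip_self_eq hh, ip_eq_fourier, ip_eq_fourier, mul_left_comm (2 * P.B₀),
        Finset.mul_sum _ _ (2 * P.B₀)]
      congr 1
      refine Finset.sum_congr rfl fun k _ => ?_
      rw [LinearMap.smul_apply, map_smul, LinearMap.comp_apply, fhat_lap, fhat_lap, smul_mul_assoc,
        Complex.smul_re, smul_eq_mul, map_mul, map_neg, Complex.conj_ofReal]
      congr 2
      ring
    rw [h3, h3, ip_self_eq hh] at h2
    linarith
  have hQs := congrArg (fun F : Fin d → Fin d → ℝ => ∑ i, ∑ j, F i j)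
    (funext fun i => funext fun j => hQ i j)
  simp only [Finset.sum_add_distrib, Finset.sum_sub_distrib, Finset.sum_neg_distrib,
    ← Finset.mul_sum] at hQs
  simp only [elastic, sTilde, rate, ipT, ← hγ]
  linarith

/-- For `τ ≤ 1` the modified energy decreases. -/
lemma Step.energy_le (hP : P.Admissible d) {τ : ℝ} (hτ : 0 < τ) (hτ1 : τ ≤ 1) {Q Q' : TGrid d J}
    {u u' : Grid d J} {s s' : ℝ} (hS : P.Step τ Q u s Q' u' s') :
    P.elastic Q' u' + s' ≤ P.elastic Q u + s := by
  have h1 := hS.energy_identity hP hτ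
  obtain ⟨ξ, _, _, h2⟩ := hS.s_eq
  have h3 := hP.rate_nonneg hτ Q Q' u u' s
  have h4 := hP.η₀_mem
  have h5 := hP.κ₁_pos
  have h6 := hP.κ₂_pos
  have h7 := g_pos (P := P) Q u s
  have h8 : 0 ≤ P.g Q u s * P.κ₁ / 2 * (∑ i, ∑ j, sob (P.h J) 0 (comp (Q' - Q) i j) ^ 2) :=
    mul_nonneg (by positivity) (Finset.sum_nonneg fun i _ => Finset.sum_nonneg fun j _ =>
      sq_nonneg _)
  have h9 : 0 ≤ P.g Q u s * P.κ₂ / 2 * sob (P.h J) 0 (u' - u) ^ 2 := by positivity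
  -- Here τ ≤ 1 enters: relaxation adds at most η₀τR, and the identity has already removed R.
  have h10 : P.η₀ * τ ≤ 1 := mul_le_one₀ h4.2 hτ.le hτ1
  have h11 := mul_le_mul_of_nonneg_right h10 h3
  linarith

lemma Dc_comm (h : ℝ) (k l : Fin d) (U : Grid d J) : Dc h k (Dc h l U) = Dc h l (Dc h k U) := by
  refine grid_ext_fhat fun m => ?_
  simp only [Dc_eq, map_smul, map_add, fhat_Dp, fhat_Dm, Complex.real_smul]
  ring

lemma hess_symm (h : ℝ) (U : Grid d J) (x : Fin d → ZMod J) : (hess h U x).IsSymm := by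
  ext k l
  simp only [hess, Matrix.transpose_apply, Matrix.of_apply]
  rw [Dc_comm]

lemma HQ_symm {Q : TGrid d J} (hQ : ∀ x, (Q x).IsSymm) (u : Grid d J) (x : Fin d → ZMod J) :
    (P.HQ Q u x).IsSymm := by
  have h1 := hQ x
  have h2 := hess_symm (P.h J) u x
  have h3 : (Q x * Q x).IsSymm := by
    rw [Matrix.IsSymm, Matrix.transpose_mul, h1.eq]
  have h4 : (1 : Matrix (Fin d) (Fin d) ℝ).IsSymm := Matrix.isSymm_one
  unfold HQ
  exact ((((h1.smul _).sub ((h3.sub (h4.smul _)).smul _)).add (h1.smul _)).add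
    (((h2.smul _).sub (h4.smul _)).smul _)).add (h1.smul _)

/-- Symmetry has to be propagated because tr(Q²) equals |Q|², and so makes the bulk energy coercive,
only for symmetric Q. It persists since the same scalar operator acts on every component. -/
lemma Step.symm {τ : ℝ} {Q Q' : TGrid d J} {u u' : Grid d J} {s s' : ℝ}
    (hS : P.Step τ Q u s Q' u' s') (hQ : ∀ x, (Q x).IsSymm) (x : Fin d → ZMod J) :
    (Q' x).IsSymm := by
  have hc : ∀ (Φ : TGrid d J), (∀ x, (Φ x).IsSymm) → ∀ i j, comp Φ i j = comp Φ j i := by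
    intro Φ hΦ i j
    ext x
    exact (hΦ x).apply j i
  have hN : ∀ i j, comp (P.NQ Q u s) i j = comp (P.NQ Q u s) j i := by
    refine hc _ fun x => ?_
    unfold NQ
    exact ((HQ_symm hQ u x).smul _).neg.add ((hQ x).smul _)
  have h1 : ∀ i j, comp Q' i j = comp Q' j i := by
    intro i j
    rw [hS.Q_eq i j, hS.Q_eq j i, hc Q hQ i j, hN i j]
  ext i j
  exact congrFun (h1 j i) x

end EnergyLaw

/-! ### Coercivity of the discrete energy -/

/-- Half of αr⁴ completes the square with the cubic term, r²(αr + β)²/(2α), and the other half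
completes it with all remaining quadratic terms, (αr² - E)²/(2α). -/
lemma exists_quartic_lower_bound {α : ℝ} (hα : 0 < α) (β γ : ℝ) :
    ∃ K : ℝ, ∀ r : ℝ, r ^ 2 - K ≤ α * r ^ 4 + β * r ^ 3 + γ * r ^ 2 := by
  set E := β ^ 2 / (2 * α) - γ + 1 with hE
  refine ⟨E ^ 2 / (2 * α), fun r => ?_⟩
  have h1 : 0 ≤ r ^ 2 * (α * r + β) ^ 2 / (2 * α) := by positivity
  have h2 : 0 ≤ (α * r ^ 2 - E) ^ 2 / (2 * α) := by positivity
  have h3 : r ^ 2 * (α * r + β) ^ 2 / (2 * α)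
      = α / 2 * r ^ 4 + β * r ^ 3 + β ^ 2 / (2 * α) * r ^ 2 := by
    field_simp
    ring
  have h4 : (α * r ^ 2 - E) ^ 2 / (2 * α) = α / 2 * r ^ 4 - E * r ^ 2 + E ^ 2 / (2 * α) := by
    field_simp
    ring
  rw [h3] at h1
  rw [h4] at h2
  have h5 : E * r ^ 2 = β ^ 2 / (2 * α) * r ^ 2 - γ * r ^ 2 + r ^ 2 := by rw [hE]; ring
  linarith

section Matrices

variable {d : ℕ}

lemma trace_mul_self_of_isSymm {X : Matrix (Fin d) (Fin d) ℝ} (hX : X.IsSymm) :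
    (X * X).trace = ∑ i, ∑ j, X i j ^ 2 := by
  simp only [Matrix.trace, Matrix.diag_apply, Matrix.mul_apply]
  refine Finset.sum_congr rfl fun i _ => Finset.sum_congr rfl fun j _ => ?_
  rw [hX.apply i j, sq]

/-- Cauchy–Schwarz for the Frobenius product together with submultiplicativity of the Frobenius
norm. -/
lemma trace_mul₃_sq_le (X : Matrix (Fin d) (Fin d) ℝ) :
    (X * X * X).trace ^ 2 ≤ (∑ i, ∑ j, X i j ^ 2) ^ 3 := by
  set ρ := ∑ i, ∑ j, X i j ^ 2 with hρ
  have hρ0 : 0 ≤ ρ := Finset.sum_nonneg fun i _ => Finset.sum_nonneg fun j _ => sq_nonneg _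
  have hcs : ∀ F G : Fin d → Fin d → ℝ, (∑ i, ∑ j, F i j * G i j) ^ 2 ≤
      (∑ i, ∑ j, F i j ^ 2) * ∑ i, ∑ j, G i j ^ 2 := by
    intro F G
    have := Finset.sum_mul_sq_le_sq_mul_sq (Finset.univ ×ˢ Finset.univ)
      (fun p : Fin d × Fin d => F p.1 p.2) (fun p => G p.1 p.2)
    simpa only [Finset.sum_product] using this
  have h1 : ∑ i, ∑ j, (X * X) i j ^ 2 ≤ ρ ^ 2 := by
    calc ∑ i, ∑ j, (X * X) i j ^ 2 ≤ ∑ i, ∑ j, (∑ k, X i k ^ 2) * ∑ k, X k j ^ 2 := by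
          gcongr with i _ j _
          rw [Matrix.mul_apply]
          exact Finset.sum_mul_sq_le_sq_mul_sq _ _ _
      _ = ρ * ∑ j, ∑ k, X k j ^ 2 := by
          simp_rw [← Finset.mul_sum]
          rw [← Finset.sum_mul]
      _ = ρ ^ 2 := by rw [Finset.sum_comm, ← hρ, sq]
  have h2 : (X * X * X).trace = ∑ i, ∑ j, (X * X) i j * X.transpose i j := by
    simp only [Matrix.trace, Matrix.diag_apply, Matrix.mul_apply (M := X * X),
      Matrix.transpose_apply]
  have h3 : ∑ i, ∑ j, X.transpose i j ^ 2 = ρ := by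
    simp only [Matrix.transpose_apply]
    rw [Finset.sum_comm]
  rw [h2]
  refine (hcs _ _).trans ?_
  rw [h3]
  calc _ ≤ ρ ^ 2 * ρ := by gcongr
    _ = ρ ^ 3 := by ring

end Matrices

section Coercive

variable {d J : ℕ} [NeZero J] {P : Params}

lemma sum_sob_zero_sq (P : Params) (hP : P.Admissible d) (Φ : TGrid d J) :
    ∑ i, ∑ j, sob (P.h J) 0 (comp Φ i j) ^ 2 = P.h J ^ d * ∑ x, ∑ i, ∑ j, Φ x i j ^ 2 := by
  have hh := hP.h_pos (J := J)
  simp_rw [sob_zero_sq hh, ← Finset.mul_sum]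
  congr 1
  have : ∀ i : Fin d, ∑ j, ∑ x, comp Φ i j x ^ 2 = ∑ x, ∑ j, comp Φ i j x ^ 2 :=
    fun i => Finset.sum_comm
  simp_rw [this]
  rw [Finset.sum_comm]
  rfl

lemma l2T_sq (hP : P.Admissible d) (Φ : TGrid d J) :
    l2T (P.h J) Φ ^ 2 = ∑ i, ∑ j, sob (P.h J) 0 (comp Φ i j) ^ 2 := by
  have hh := hP.h_pos (J := J)
  rw [l2T, Real.sq_sqrt (Finset.sum_nonneg fun i _ => Finset.sum_nonneg fun j _ => sq_nonneg _)]
  simp_rw [l2_eq_sob hh]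

/-- Cauchy–Schwarz over nodes and components, then the Hessian bound with constant 1, the sharpness
needed to compare the coupling energy with B₀(‖Δ_h u‖ - q²‖Mu‖)². -/
lemma ipT_hess_sq_le (hP : P.Admissible d) (u : Grid d J) (Φ : TGrid d J) :
    ipT (P.h J) (hess (P.h J) u) Φ ^ 2 ≤
      sob (P.h J) 0 (lap (P.h J) u) ^ 2 * l2T (P.h J) Φ ^ 2 := by
  have hh := hP.h_pos (J := J)
  rw [l2T_sq hP]
  refine le_trans ?_ (mul_le_mul_of_nonneg_right (sum_hess_sq_le hh u)
    (Finset.sum_nonneg fun i _ => Finset.sum_nonneg fun j _ => sq_nonneg _))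
  have h1 : |ipT (P.h J) (hess (P.h J) u) Φ| ≤ ∑ p ∈ Finset.univ ×ˢ Finset.univ,
      sob (P.h J) 0 (Dc (P.h J) p.1 (Dc (P.h J) p.2 u)) * sob (P.h J) 0 (comp Φ p.1 p.2) := by
    rw [ipT, Finset.sum_product]
    refine (Finset.abs_sum_le_sum_abs _ _).trans (Finset.sum_le_sum fun i _ => ?_)
    refine (Finset.abs_sum_le_sum_abs _ _).trans (Finset.sum_le_sum fun j _ => ?_)
    exact abs_ip_le hh _ _
  rw [← sq_abs]
  refine (pow_le_pow_left₀ (abs_nonneg _) h1 2).trans ?_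
  refine (Finset.sum_mul_sq_le_sq_mul_sq _ _ _).trans (le_of_eq ?_)
  rw [Finset.sum_product, Finset.sum_product]

lemma sum_M_sq_le (hd : 0 < d) (P : Params) (X : Matrix (Fin d) (Fin d) ℝ) :
    ∑ i, ∑ j, ((P.sPlus d)⁻¹ • X + (d : ℝ)⁻¹ • (1 : Matrix (Fin d) (Fin d) ℝ)) i j ^ 2 ≤
      2 * ((P.sPlus d)⁻¹) ^ 2 * (∑ i, ∑ j, X i j ^ 2) + 2 := by
  have hd1 : (1 : ℝ) ≤ d := by exact_mod_cast hd
  have h1 : ∀ i j : Fin d, ((P.sPlus d)⁻¹ • X + (d : ℝ)⁻¹ • (1 : Matrix (Fin d) (Fin d) ℝ)) i j ^ 2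
      ≤ 2 * ((P.sPlus d)⁻¹) ^ 2 * X i j ^ 2 + 2 * (d : ℝ)⁻¹ ^ 2 * (if i = j then 1 else 0) := by
    intro i j
    simp only [Matrix.add_apply, Matrix.smul_apply, Matrix.one_apply, smul_eq_mul]
    split_ifs
    · nlinarith [sq_nonneg ((P.sPlus d)⁻¹ * X i j - (d : ℝ)⁻¹)]
    · nlinarith [sq_nonneg ((P.sPlus d)⁻¹ * X i j)]
  calc _ ≤ ∑ i, ∑ j, (2 * ((P.sPlus d)⁻¹) ^ 2 * X i j ^ 2
        + 2 * (d : ℝ)⁻¹ ^ 2 * (if i = j then 1 else 0)) :=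
        Finset.sum_le_sum fun i _ => Finset.sum_le_sum fun j _ => h1 i j
    _ = 2 * ((P.sPlus d)⁻¹) ^ 2 * (∑ i, ∑ j, X i j ^ 2) + 2 * (d : ℝ)⁻¹ := by
        simp only [Finset.sum_add_distrib, ← Finset.mul_sum, Finset.sum_ite_eq, Finset.mem_univ,
          if_true, Finset.sum_const, Finset.card_univ, Fintype.card_fin, nsmul_eq_mul]
        field_simp
    _ ≤ _ := by
        have := inv_le_one_of_one_le₀ hd1
        linarith

/-- The bulk energy dominates the quadratic terms and a small multiple of the coupling. -/
lemma exists_bulk_lower_bound (hd : 0 < d) (hP : P.Admissible d) : ∃ θ K : ℝ, 0 < θ ∧ θ ≤ 1 ∧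
    ∀ (X : Matrix (Fin d) (Fin d) ℝ) (v : ℝ), X.IsSymm →
      (∑ i, ∑ j, X i j ^ 2) + v ^ 2 - K ≤ P.fbn X + P.fs v - θ * (P.B₀ * P.q ^ 4 * (v ^ 2 *
        ∑ i, ∑ j, ((P.sPlus d)⁻¹ • X + (d : ℝ)⁻¹ • (1 : Matrix (Fin d) (Fin d) ℝ)) i j ^ 2)) := by
  have hC := hP.C_pos
  have hc := hP.c_pos
  have hB := hP.B_pos
  have hB₀ := hP.B₀_pos
  have hq := hP.q_pos
  set σ := (P.sPlus d)⁻¹ with hσ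
  set D := P.B₀ * P.q ^ 4 with hD
  have hD0 : 0 < D := by positivity
  -- The quartic terms carry C/4 and c/4. Half of each, C/8 and c/8, pays for the coupling; the
  -- other half goes into the quartic lower bounds.
  set m := min P.C P.c / 8 with hm
  have hm0 : 0 < m := by positivity
  have hmC : m ≤ P.C / 8 := by rw [hm]; gcongr; exact min_le_left _ _
  have hmc : m ≤ P.c / 8 := by rw [hm]; gcongr; exact min_le_right _ _
  -- The coupling contributes θDσ² · 2v²|Q|² ≤ θDσ²(|Q|⁴ + v⁴), so θDσ² ≤ m is required; the summand
  -- 1 only keeps the denominator positive.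
  set θ := min 1 (m / (D * σ ^ 2 + 1)) with hθ
  have hden : 0 < D * σ ^ 2 + 1 := by positivity
  have hθ0 : 0 < θ := by positivity
  have hθm : θ * (D * σ ^ 2) ≤ m := by
    have h1 : θ * (D * σ ^ 2 + 1) ≤ m := by
      rw [← le_div_iff₀ hden]
      exact min_le_right _ _
    linarith
  obtain ⟨K₁, hK₁⟩ := exists_quartic_lower_bound (α := P.C / 8) (by positivity) (-(P.B / 3)) (P.A / 2)
  obtain ⟨K₂, hK₂⟩ := exists_quartic_lower_bound (α := P.c / 8) (by positivity) (P.b / 3)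
    (P.a / 2 - 2 * (θ * D))
  refine ⟨θ, K₁ + K₂, hθ0, min_le_left _ _, fun X v hX => ?_⟩
  set ρ := ∑ i, ∑ j, X i j ^ 2 with hρ
  have hρ0 : 0 ≤ ρ := Finset.sum_nonneg fun i _ => Finset.sum_nonneg fun j _ => sq_nonneg _
  set r := √ρ with hr
  have hr2 : r ^ 2 = ρ := Real.sq_sqrt hρ0
  have hr0 : 0 ≤ r := Real.sqrt_nonneg _
  have h1 : (X * X * X).trace ≤ r ^ 3 := by
    refine abs_le_of_sq_le_sq' ?_ (by positivity) |>.2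
    refine (trace_mul₃_sq_le X).trans (le_of_eq ?_)
    rw [← hρ, ← hr2]
    ring
  have h2 := sum_M_sq_le hd P X
  rw [← hσ, ← hρ] at h2
  set μ := ∑ i, ∑ j, (σ • X + (d : ℝ)⁻¹ • (1 : Matrix (Fin d) (Fin d) ℝ)) i j ^ 2 with hμ
  have h3 : θ * (D * (v ^ 2 * μ)) ≤ m * (r ^ 4 + v ^ 4) + 2 * (θ * D) * v ^ 2 := by
    have h4 : v ^ 2 * μ ≤ v ^ 2 * (2 * σ ^ 2 * ρ + 2) := mul_le_mul_of_nonneg_left h2 (sq_nonneg v)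
    have h5 : 2 * (v ^ 2 * ρ) ≤ r ^ 4 + v ^ 4 := by
      rw [← hr2]
      nlinarith [sq_nonneg (r ^ 2 - v ^ 2)]
    have h6 : 0 ≤ θ * D := by positivity
    have h7 := mul_le_mul_of_nonneg_left h4 h6
    have h8 := mul_le_mul_of_nonneg_left h5 (by positivity : 0 ≤ θ * (D * σ ^ 2))
    have h9 := mul_le_mul_of_nonneg_right hθm (by positivity : 0 ≤ r ^ 4 + v ^ 4)
    calc θ * (D * (v ^ 2 * μ)) = θ * D * (v ^ 2 * μ) := by ring
      _ ≤ θ * D * (v ^ 2 * (2 * σ ^ 2 * ρ + 2)) := h7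
      _ = θ * (D * σ ^ 2) * (2 * (v ^ 2 * ρ)) + 2 * (θ * D) * v ^ 2 := by ring
      _ ≤ _ := by linarith
  have h10 := hK₁ r
  have h11 := hK₂ v
  have h12 : P.A / 2 * r ^ 2 - P.B / 3 * r ^ 3 + P.C / 4 * r ^ 4 ≤ P.fbn X := by
    rw [fbn, trace_mul_self_of_isSymm hX, ← hρ, ← hr2]
    have := mul_le_mul_of_nonneg_left h1 (by positivity : 0 ≤ P.B / 3)
    have e : P.C / 4 * r ^ 4 = P.C / 4 * (r ^ 2) ^ 2 := by ring
    linarith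
  have h13 := mul_le_mul_of_nonneg_right hmC (by positivity : 0 ≤ r ^ 4)
  have h14 := mul_le_mul_of_nonneg_right hmc (by positivity : 0 ≤ v ^ 4)
  rw [fs, ← hr2]
  nlinarith

/-- The size of a state in the energy space. -/
def energySize (P : Params) (Q : TGrid d J) (u : Grid d J) : ℝ :=
  (∑ i, ∑ j, sob (P.h J) 1 (comp Q i j) ^ 2) + sob (P.h J) 2 u ^ 2

lemma energySize_nonneg (P : Params) (Q : TGrid d J) (u : Grid d J) : 0 ≤ P.energySize Q u :=
  add_nonneg (Finset.sum_nonneg fun _ _ => Finset.sum_nonneg fun _ _ => sq_nonneg _) (sq_nonneg _)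

end Coercive

/-- The discrete energy is coercive, uniformly in the mesh. -/
theorem exists_energy_coercive {d : ℕ} {P : Params} (hd : 0 < d) (hP : P.Admissible d) :
    ∃ c K : ℝ, 0 < c ∧ ∀ (J : ℕ) [NeZero J] (Q : TGrid d J) (u : Grid d J),
      (∀ x, (Q x).IsSymm) → c * P.energySize Q u ≤ P.elastic Q u + P.E1 Q u + K := by
  obtain ⟨θ, K, hθ0, hθ1, hbulk⟩ := exists_bulk_lower_bound hd hP
  have hKpos := hP.K_pos
  have hB₀ := hP.B₀_pos
  have hL := hP.L_pos
  -- The four bounds match ‖Q‖², ‖∇_h Q‖², ‖u‖² and ‖Δ_h u‖²; the last two also allow for the factor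
  -- 2 in bounding ‖u‖²_{H²} by ‖u‖² and ‖Δ_h u‖².
  set c := min (min 1 (P.K / 2)) (min (1 / 2) (θ * P.B₀ / 4)) with hc
  have hc0 : 0 < c := by positivity
  have hc1 : c ≤ 1 := (min_le_left _ _).trans (min_le_left _ _)
  have hc2 : c ≤ P.K / 2 := (min_le_left _ _).trans (min_le_right _ _)
  have hc3 : c ≤ 1 / 2 := (min_le_right _ _).trans (min_le_left _ _)
  have hc4 : c ≤ θ * P.B₀ / 4 := (min_le_right _ _).trans (min_le_right _ _)
  refine ⟨c, K * P.L ^ d, hc0, fun J _ Q u hQ => ?_⟩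
  have hJ := natCast_J_pos (J := J)
  have hh := hP.h_pos (J := J)
  set x := sob (P.h J) 0 (lap (P.h J) u) with hx
  have hx0 : 0 ≤ x := apply_nonneg _ _
  set y := l2T (P.h J) (P.Mu Q u) with hy
  have hy0 : 0 ≤ y := Real.sqrt_nonneg _
  set I := ipT (P.h J) (hess (P.h J) u) (P.Mu Q u) with hI
  have hIxy : -(x * y) ≤ I := by
    refine abs_le_of_sq_le_sq' ?_ (by positivity) |>.1
    rw [mul_pow]
    exact ipT_hess_sq_le hP u _
  -- The elastic and coupling terms together are at least B₀(x - q²y)², which by itself does not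
  -- control x. Keeping a fraction θ of it and using (x - q²y)² ≥ x²/2 - q⁴y² gives control of x at
  -- the price of θB₀q⁴y², which the quartic bulk energy can pay.
  have hcoup : θ * (P.B₀ / 2 * x ^ 2 - P.B₀ * P.q ^ 4 * y ^ 2) ≤
      P.B₀ * x ^ 2 + 2 * P.B₀ * P.q ^ 2 * I + P.B₀ * P.q ^ 4 * y ^ 2 := by
    have h1 : P.B₀ * (x - P.q ^ 2 * y) ^ 2 ≤
        P.B₀ * x ^ 2 + 2 * P.B₀ * P.q ^ 2 * I + P.B₀ * P.q ^ 4 * y ^ 2 := by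
      have := mul_le_mul_of_nonneg_left hIxy (by positivity : 0 ≤ 2 * P.B₀ * P.q ^ 2)
      nlinarith
    have h2 : x ^ 2 / 2 - P.q ^ 4 * y ^ 2 ≤ (x - P.q ^ 2 * y) ^ 2 := by
      nlinarith [sq_nonneg (x - 2 * (P.q ^ 2 * y))]
    have h3 : θ * (x ^ 2 / 2 - P.q ^ 4 * y ^ 2) ≤ (x - P.q ^ 2 * y) ^ 2 := by
      have h4 := mul_le_mul_of_nonneg_left h2 hθ0.le
      have h5 := mul_le_mul_of_nonneg_right hθ1 (sq_nonneg (x - P.q ^ 2 * y))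
      linarith
    have h6 := mul_le_mul_of_nonneg_left h3 hB₀.le
    refine le_trans (le_of_eq ?_) (h6.trans h1)
    ring
  have hy2 : y ^ 2 = P.h J ^ d * ∑ z, u z ^ 2 * ∑ i, ∑ j, ((P.sPlus d)⁻¹ • Q z +
      (d : ℝ)⁻¹ • (1 : Matrix (Fin d) (Fin d) ℝ)) i j ^ 2 := by
    rw [hy, l2T_sq hP, sum_sob_zero_sq P hP]
    congr 1
    refine Finset.sum_congr rfl fun z _ => ?_
    rw [Finset.mul_sum]
    refine Finset.sum_congr rfl fun i _ => ?_
    rw [Finset.mul_sum]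
    refine Finset.sum_congr rfl fun j _ => ?_
    simp only [Mu, M, Matrix.smul_apply, smul_eq_mul]
    ring
  have hsum : (∑ i, ∑ j, sob (P.h J) 0 (comp Q i j) ^ 2) + sob (P.h J) 0 u ^ 2 - K * P.L ^ d ≤
      ip (P.h J) (fun z => P.fbn (Q z)) (fun _ => 1) + ip (P.h J) (fun z => P.fs (u z)) (fun _ => 1)
        - θ * (P.B₀ * P.q ^ 4 * y ^ 2) := by
    have h1 : ∑ z, ((∑ i, ∑ j, Q z i j ^ 2) + u z ^ 2 - K) ≤ ∑ z, (P.fbn (Q z) + P.fs (u z) -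
        θ * (P.B₀ * P.q ^ 4 * (u z ^ 2 * ∑ i, ∑ j, ((P.sPlus d)⁻¹ • Q z +
          (d : ℝ)⁻¹ • (1 : Matrix (Fin d) (Fin d) ℝ)) i j ^ 2))) :=
      Finset.sum_le_sum fun z _ => hbulk (Q z) (u z) (hQ z)
    have h2 := mul_le_mul_of_nonneg_left h1 (by positivity : 0 ≤ P.h J ^ d)
    simp only [Finset.sum_add_distrib, Finset.sum_sub_distrib, ← Finset.mul_sum, Finset.sum_const,
      Finset.card_univ, Fintype.card_pi_const, ZMod.card, nsmul_eq_mul, Nat.cast_pow] at h2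
    have e : P.h J ^ d * ((J : ℝ) ^ d * K) = K * P.L ^ d := by
      rw [Params.h, div_pow]
      field_simp
    rw [sum_sob_zero_sq P hP, sob_zero_sq hh, hy2]
    simp only [ip, mul_one]
    rw [← e]
    linarith
  have hQ1 : ∑ i, ∑ j, sob (P.h J) 1 (comp Q i j) ^ 2 = (∑ i, ∑ j, sob (P.h J) 0 (comp Q i j) ^ 2)
      + ∑ i, ∑ j, ∑ l, sob (P.h J) 0 (Dp (P.h J) l (comp Q i j)) ^ 2 := by
    simp_rw [sob_one_sq hh, Finset.sum_add_distrib]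
  have hu2 := sob_two_sq_le hh u
  set a := ∑ i, ∑ j, sob (P.h J) 0 (comp Q i j) ^ 2 with ha
  have ha0 : 0 ≤ a := Finset.sum_nonneg fun i _ => Finset.sum_nonneg fun j _ => sq_nonneg _
  set b := ∑ i, ∑ j, ∑ l, sob (P.h J) 0 (Dp (P.h J) l (comp Q i j)) ^ 2 with hb
  have hb0 : 0 ≤ b := Finset.sum_nonneg fun i _ => Finset.sum_nonneg fun j _ =>
    Finset.sum_nonneg fun l _ => sq_nonneg _
  set w := sob (P.h J) 0 u ^ 2 with hw
  have hw0 : 0 ≤ w := sq_nonneg _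
  rw [energySize, hQ1]
  have t1 := mul_le_mul_of_nonneg_right hc1 ha0
  have t2 := mul_le_mul_of_nonneg_right hc2 hb0
  have t3 := mul_le_mul_of_nonneg_right hc3 hw0
  have t4 := mul_le_mul_of_nonneg_right hc4 (sq_nonneg x)
  have t5 := mul_le_mul_of_nonneg_left hu2 hc0.le
  simp only [elastic, E1, ← hb, ← hx, ← hy, ← hI]
  nlinarith

/-! ### Bounds for the nonlinear terms -/

section Nonlinear

variable {d J : ℕ} {P : Params}

/-- The discrete Hessian component `D_k^c D_l^c u`. -/
def hc (P : Params) (u : Grid d J) (k l : Fin d) : Grid d J := Dc (P.h J) k (Dc (P.h J) l u)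

/-- The diagonal coefficient `δ_{ij} / d`. -/
def dg (d : ℕ) (i j : Fin d) : ℝ := if i = j then (d : ℝ)⁻¹ else 0

lemma abs_dg_le (i j : Fin d) : |dg d i j| ≤ 1 := by
  unfold dg
  have hd : (1 : ℝ) ≤ d := by exact_mod_cast (Nat.one_le_iff_ne_zero.mpr (by
    rintro rfl
    exact i.elim0))
  split_ifs
  · rw [abs_of_nonneg (by positivity)]
    exact inv_le_one_of_one_le₀ hd
  · simp

/-- Each component becomes a sum of products of grid functions, the form in which seminorm estimates
apply term by term. -/
lemma comp_HQ (Q : TGrid d J) (u : Grid d J) (i j : Fin d) :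
    comp (P.HQ Q u) i j =
      P.A • comp Q i j
      - P.B • (∑ k, comp Q i k * comp Q k j - dg d i j • ∑ k, ∑ l, comp Q k l * comp Q l k)
      + P.C • (∑ k, ∑ l, comp Q k l * comp Q l k * comp Q i j)
      + (2 * P.B₀ * P.q ^ 2 / P.sPlus d) •
        (u * P.hc u i j - dg d i j • ∑ k, u * P.hc u k k)
      + (2 * P.B₀ * P.q ^ 4 / P.sPlus d ^ 2) • (u * u * comp Q i j) := by
  ext x
  simp only [comp, HQ, hc, dg, hess, Matrix.add_apply, Matrix.sub_apply, Matrix.smul_apply,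
    Matrix.one_apply, Matrix.trace, Matrix.diag_apply, Matrix.mul_apply, Matrix.of_apply,
    smul_eq_mul, Pi.add_apply, Pi.sub_apply, Pi.smul_apply, Finset.sum_apply, Pi.mul_apply,
    ← Finset.sum_mul]
  split_ifs <;> ring

lemma comp_M (Q : TGrid d J) (i j : Fin d) :
    comp (P.M Q) i j = (P.sPlus d)⁻¹ • comp Q i j + dg d i j • (1 : Grid d J) := by
  ext x
  simp only [comp, M, dg, Matrix.add_apply, Matrix.smul_apply, Matrix.one_apply, smul_eq_mul,
    Pi.add_apply, Pi.smul_apply, Pi.one_apply]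
  split_ifs <;> simp

lemma comp_Mu (Q : TGrid d J) (u : Grid d J) (i j : Fin d) :
    comp (P.Mu Q u) i j = u * comp (P.M Q) i j := by
  ext x
  simp [comp, Mu]

lemma mu_eq (Q : TGrid d J) (u : Grid d J) :
    P.mu Q u = P.a • u + P.b • (u * u) + P.c • (u * u * u)
      + (2 * P.B₀ * P.q ^ 2) • (∑ k, ∑ l, comp (P.M Q) k l * P.hc u k l)
      + (2 * P.B₀ * P.q ^ 2) •
        (∑ k, ∑ l, Dm (P.h J) k (Dm (P.h J) l (u * comp (P.M Q) k l)))
      + (2 * P.B₀ * P.q ^ 4) • (∑ k, ∑ l, comp (P.M Q) k l * comp (P.M Q) k l * u) := by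
  have h1 : divdiv (P.h J) (P.Mu Q u) =
      ∑ k, ∑ l, Dm (P.h J) k (Dm (P.h J) l (u * comp (P.M Q) k l)) := by
    simp only [divdiv, map_sum, comp_Mu]
  ext x
  simp only [mu, h1, hc, hess, Pi.add_apply, Pi.smul_apply, Pi.mul_apply, smul_eq_mul,
    Finset.sum_apply, Matrix.of_apply, comp, ← Finset.sum_mul]
  simp only [pow_succ, pow_zero, one_mul]
  ring

/-- The constant in the bounds for `H_h`. -/
def KH (P : Params) (d : ℕ) : ℝ :=
  |P.A| + |P.B| * (d + d * d) + |P.C| * (d * d) + |2 * P.B₀ * P.q ^ 2 / P.sPlus d| * (1 + d)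
    + |2 * P.B₀ * P.q ^ 4 / P.sPlus d ^ 2|

lemma KH_nonneg (P : Params) (d : ℕ) : 0 ≤ P.KH d := by
  unfold KH; positivity

lemma seminorm_sum_le {E : Type*} [AddCommGroup E] [Module ℝ E] (p : Seminorm ℝ E) {f : Fin d → E}
    {N : ℝ} (hf : ∀ i, p (f i) ≤ N) : p (∑ i, f i) ≤ d * N := by
  refine (Finset.le_sum_of_subadditive p (map_zero p).le (map_add_le_add p) Finset.univ f).trans ?_
  refine (Finset.sum_le_sum fun i _ => hf i).trans (le_of_eq ?_)
  simp

lemma seminorm_smul_le {E : Type*} [AddCommGroup E] [Module ℝ E] (p : Seminorm ℝ E) (c : ℝ) {f : E}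
    {N : ℝ} (hf : p f ≤ N) : p (c • f) ≤ |c| * N := by
  rw [map_smul_eq_mul, Real.norm_eq_abs]
  exact mul_le_mul_of_nonneg_left hf (abs_nonneg _)

lemma seminorm_add_le {E : Type*} [AddCommGroup E] [Module ℝ E] (p : Seminorm ℝ E) {f g : E}
    {M N : ℝ} (hf : p f ≤ M) (hg : p g ≤ N) : p (f + g) ≤ M + N :=
  (map_add_le_add p f g).trans (add_le_add hf hg)

lemma seminorm_sub_le {E : Type*} [AddCommGroup E] [Module ℝ E] (p : Seminorm ℝ E) {f g : E}
    {M N : ℝ} (hf : p f ≤ M) (hg : p g ≤ N) : p (f - g) ≤ M + N :=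
  (map_sub_le_add p f g).trans (add_le_add hf hg)

/-- Stated for an arbitrary seminorm so that the ℓ² and the H¹ bounds of H share one computation. -/
lemma seminorm_HQ_le (p : Seminorm ℝ (Grid d J)) {Q : TGrid d J} {u : Grid d J} {N : ℝ}
    (h₁ : ∀ i j, p (comp Q i j) ≤ N) (h₂ : ∀ i j k l, p (comp Q i j * comp Q k l) ≤ N)
    (h₃ : ∀ i j k l m n, p (comp Q i j * comp Q k l * comp Q m n) ≤ N)
    (h₄ : ∀ k l, p (u * P.hc u k l) ≤ N) (h₅ : ∀ i j, p (u * u * comp Q i j) ≤ N) (i j : Fin d) :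
    p (comp (P.HQ Q u) i j) ≤ P.KH d * N := by
  have hN : 0 ≤ N := (apply_nonneg _ _).trans (h₁ i j)
  have hdg : ∀ {f : Grid d J} {M : ℝ}, p f ≤ M → p (dg d i j • f) ≤ M := by
    intro f M hf
    refine (seminorm_smul_le p _ hf).trans ?_
    exact mul_le_of_le_one_left ((apply_nonneg _ _).trans hf) (abs_dg_le i j)
  rw [comp_HQ]
  refine (seminorm_add_le p (seminorm_add_le p (seminorm_add_le p (seminorm_sub_le p
    (seminorm_smul_le p P.A (h₁ i j))
    (seminorm_smul_le p P.B (seminorm_sub_le p (seminorm_sum_le p fun k => h₂ i k k j)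
      (hdg (seminorm_sum_le p fun k => seminorm_sum_le p fun l => h₂ k l l k)))))
    (seminorm_smul_le p P.C (seminorm_sum_le p fun k => seminorm_sum_le p fun l =>
      h₃ k l l k i j)))
    (seminorm_smul_le p _ (seminorm_sub_le p (h₄ i j) (hdg (seminorm_sum_le p fun k => h₄ k k)))))
    (seminorm_smul_le p _ (h₅ i j))).trans (le_of_eq ?_)
  unfold KH
  ring

variable [NeZero J]

lemma sob_hc_le (hP : P.Admissible d) (s : ℕ) (u : Grid d J) (k l : Fin d) :
    sob (P.h J) s (P.hc u k l) ≤ sob (P.h J) (s + 2) u :=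
  (sob_Dc_le hP.h_pos s k _).trans (sob_Dc_le hP.h_pos (s + 1) l u)

variable {S : ℝ}

/-- `‖H_h‖` is controlled by the energy norms of `Q` and `u`. -/
lemma sob_zero_HQ_le (hP : P.Admissible d) (hS : SobolevConst d P.L S) {Q : TGrid d J}
    {u : Grid d J} {Y : ℝ} (hY : 1 ≤ Y) (hQ : ∀ i j, sob (P.h J) 1 (comp Q i j) ≤ Y)
    (hu : sob (P.h J) 2 u ≤ Y) (i j : Fin d) :
    sob (P.h J) 0 (comp (P.HQ Q u) i j) ≤ P.KH d * (S * Y ^ 3) := by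
  have hh := hP.h_pos (J := J)
  have hS0 := hS.C_pos
  have hS1 := hS.one_le
  have hY0 : 0 < Y := by linarith
  have hY2 : S * (Y * Y) ≤ S * Y ^ 3 := by
    gcongr
    nlinarith [mul_pos hY0 hY0]
  have hu1 : sob (P.h J) 1 u ≤ Y := (sob_mono hh (by norm_num) u).trans hu
  have tri : ∀ {f g k : Grid d J}, sob (P.h J) 1 f ≤ Y → sob (P.h J) 1 g ≤ Y →
      sob (P.h J) 1 k ≤ Y → sob (P.h J) 0 (f * g * k) ≤ S * Y ^ 3 := by
    intro f g k hf hg hk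
    refine (hS.mul₃_le J f g k).trans ?_
    calc _ ≤ S * (Y * Y * Y) := by
          gcongr <;> assumption
      _ = _ := by ring
  refine seminorm_HQ_le _ (fun i j => ?_) (fun i j k l => ?_) (fun i j k l m n => ?_)
    (fun k l => ?_) (fun i j => ?_) i j
  · refine ((sob_mono hh (by norm_num) _).trans (hQ i j)).trans ?_
    calc Y ≤ Y * (Y * Y) := le_mul_of_one_le_right hY0.le (by nlinarith)
      _ ≤ S * Y ^ 3 := by nlinarith [pow_pos hY0 3]
  · refine ((hS.mul₂_le J _ _).trans ?_).trans hY2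
    exact mul_le_mul_of_nonneg_left
      (mul_le_mul (hQ i j) (hQ k l) (apply_nonneg _ _) hY0.le) hS0.le
  · exact tri (hQ i j) (hQ k l) (hQ m n)
  · refine ((hS.sob_zero_mul_le _ _).trans ?_).trans hY2
    exact mul_le_mul_of_nonneg_left
      (mul_le_mul hu ((sob_hc_le hP 0 u k l).trans hu) (apply_nonneg _ _) hY0.le) hS0.le
  · exact tri hu1 hu1 (hQ i j)

/-- The first differences of `H_h` are controlled linearly by the higher norms. -/
lemma sob_one_HQ_le (hP : P.Admissible d) (hS : SobolevConst d P.L S) {Q : TGrid d J}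
    {u : Grid d J} {Y Z : ℝ} (hY : 1 ≤ Y) (hYZ : Y ≤ Z)
    (hQ : ∀ i j, sob (P.h J) 1 (comp Q i j) ≤ Y) (hQ' : ∀ i j, sob (P.h J) 2 (comp Q i j) ≤ Z)
    (hu : sob (P.h J) 2 u ≤ Y) (hu' : sob (P.h J) 3 u ≤ Z) (i j : Fin d) :
    sob (P.h J) 1 (comp (P.HQ Q u) i j) ≤ P.KH d * ((1 + 3 * d) * S * (Y ^ 2 * Z)) := by
  have hh := hP.h_pos (J := J)
  have hS0 := hS.C_pos
  have hS1 := hS.one_le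
  have hY0 : 0 < Y := by linarith
  have hZ0 : 0 < Z := by linarith
  have hYZ2 : (1 + 2 * d) * S * (Y * Z) ≤ (1 + 3 * d) * S * (Y ^ 2 * Z) := by
    gcongr
    · norm_num
    · nlinarith
  have hu1 : sob (P.h J) 1 u ≤ Y := (sob_mono hh (by norm_num) u).trans hu
  refine seminorm_HQ_le _ (fun i j => ?_) (fun i j k l => ?_) (fun i j k l m n => ?_)
    (fun k l => ?_) (fun i j => ?_) i j
  · refine (hQ i j).trans (le_trans ?_ hYZ2)
    have h1 : 1 ≤ (1 + 2 * (d : ℝ)) * S :=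
      one_le_mul_of_one_le_of_one_le (by linarith [(Nat.cast_nonneg d : (0 : ℝ) ≤ d)]) hS1
    have h2 : Y ≤ Y * Z := le_mul_of_one_le_right hY0.le (hY.trans hYZ)
    nlinarith [mul_pos hY0 hZ0]
  · refine ((hS.sob_one_mul_le _ _).trans ?_).trans hYZ2
    rw [mul_comm Y Z]
    exact mul_le_mul_of_nonneg_left
      (mul_le_mul (hQ' i j) (hQ k l) (apply_nonneg _ _) hZ0.le) (by positivity)
  · exact hS.sob_one_mul₃_le hYZ (hQ i j) (hQ k l) (hQ m n) (hQ' i j) (hQ' k l) (hQ' m n)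
  · refine ((hS.sob_one_mul_le _ _).trans ?_).trans hYZ2
    exact mul_le_mul_of_nonneg_left
      (mul_le_mul hu ((sob_hc_le hP 1 u k l).trans hu') (apply_nonneg _ _) hY0.le) (by positivity)
  · exact hS.sob_one_mul₃_le hYZ hu1 hu1 (hQ i j) (hu.trans hYZ) (hu.trans hYZ) (hQ' i j)

/-- The constant in the bounds for `μ_h`. -/
def Kμ (P : Params) (d : ℕ) : ℝ :=
  |P.a| + |P.b| + |P.c| + 2 * |2 * P.B₀ * P.q ^ 2| * (d * d) + |2 * P.B₀ * P.q ^ 4| * (d * d)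

/-- The factor relating the norms of `M_h` and `Q_h`. -/
def KM (P : Params) (d : ℕ) : ℝ := |(P.sPlus d)⁻¹| + √(P.L ^ d) + 1

lemma Kμ_nonneg (P : Params) (d : ℕ) : 0 ≤ P.Kμ d := by
  unfold Kμ; positivity

lemma one_le_KM (P : Params) (d : ℕ) : 1 ≤ P.KM d := by
  unfold KM
  have h1 := abs_nonneg (P.sPlus d)⁻¹
  have h2 := Real.sqrt_nonneg (P.L ^ d)
  linarith

lemma sob_two_const (hP : P.Admissible d) : sob (P.h J) 2 (1 : Grid d J) = √(P.L ^ d) := by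
  have hh := hP.h_pos (J := J)
  have h1 : ∀ j : Fin d, Dp (P.h J) j (1 : Grid d J) = 0 := by
    intro j
    ext x
    simp [Dp, shiftF, LinearMap.funLeft_apply]
  have h2 : lap (P.h J) (1 : Grid d J) = 0 := by
    ext x
    simp [lap, Dp, Dm, shiftF, shiftB, LinearMap.funLeft_apply]
  have h3 := sob_two_sq hh (1 : Grid d J)
  have h4 : sob (P.h J) 0 (1 : Grid d J) ^ 2 = P.L ^ d := sob_zero_const hP.L_pos
  rw [h2, h4] at h3
  simp only [h1, map_zero] at h3
  rw [← Real.sqrt_sq (apply_nonneg (sob (P.h J) 2) (1 : Grid d J)), h3]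
  simp

/-- The constant part I/d of M has norm at most L^(d/2), absorbed into the factor Y because Y ≥ 1.
-/
lemma sob_M_le (hP : P.Admissible d) {s : ℕ} (hs : s ≤ 2) {Q : TGrid d J} {Y : ℝ} (hY : 1 ≤ Y)
    (hQ : ∀ i j, sob (P.h J) s (comp Q i j) ≤ Y) (i j : Fin d) :
    sob (P.h J) s (comp (P.M Q) i j) ≤ P.KM d * Y := by
  have hh := hP.h_pos (J := J)
  rw [comp_M]
  have h1 : sob (P.h J) s (1 : Grid d J) ≤ √(P.L ^ d) :=
    (sob_mono hh hs _).trans (sob_two_const hP).le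
  refine (seminorm_add_le _ (seminorm_smul_le _ _ (hQ i j)) (seminorm_smul_le _ _ h1)).trans ?_
  have h2 := Real.sqrt_nonneg (P.L ^ d)
  have h3 := mul_le_of_le_one_left h2 (abs_dg_le i j)
  unfold KM
  nlinarith [abs_nonneg (P.sPlus d)⁻¹]

/-- `‖μ_h‖` is controlled by the energy norms and, linearly, by the second differences of `Q`. -/
lemma sob_zero_mu_le (hP : P.Admissible d) (hS : SobolevConst d P.L S) {Q : TGrid d J}
    {u : Grid d J} {Y Z : ℝ} (hY : 1 ≤ Y) (hZ : 1 ≤ Z)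
    (hQ : ∀ i j, sob (P.h J) 1 (comp Q i j) ≤ Y) (hQ' : ∀ i j, sob (P.h J) 2 (comp Q i j) ≤ Z)
    (hu : sob (P.h J) 2 u ≤ Y) :
    sob (P.h J) 0 (P.mu Q u) ≤
      P.Kμ d * (2 * ((1 + 2 * d) * S) * P.KM d ^ 2 * (Y ^ 3 * Z)) := by
  have hh := hP.h_pos (J := J)
  have hS0 := hS.C_pos
  have hS1 := hS.one_le
  have hY0 : 0 < Y := by linarith
  have hZ0 : 0 < Z := by linarith
  have hm1 := one_le_KM P d
  set m := P.KM d with hm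
  have hm0 : 0 < m := by linarith
  set N := 2 * ((1 + 2 * d) * S) * m ^ 2 * (Y ^ 3 * Z) with hN
  have hd0 : (0 : ℝ) ≤ d := Nat.cast_nonneg d
  have hm2 : 1 ≤ m ^ 2 := one_le_pow₀ hm1
  have hmm : m ≤ m ^ 2 := le_self_pow₀ hm1 (by norm_num)
  have hY3 : Y ≤ Y ^ 3 := le_self_pow₀ hY (by norm_num)
  have hY23 : Y ^ 2 ≤ Y ^ 3 := pow_le_pow_right₀ hY (by norm_num)
  have hSd : S ≤ 2 * ((1 + 2 * d) * S) := by nlinarith [mul_nonneg hd0 hS0.le]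
  have hbig : ∀ {t : ℝ}, t ≤ S * (m ^ 2 * (Y ^ 3 * Z)) → t ≤ N := by
    intro t ht
    refine ht.trans ?_
    rw [hN, mul_assoc (2 * ((1 + 2 * d) * S))]
    gcongr
  have hu1 : sob (P.h J) 1 u ≤ Y := (sob_mono hh (by norm_num) u).trans hu
  have hu0 : sob (P.h J) 0 u ≤ Y := (sob_mono hh (by norm_num) u).trans hu
  have hM1 := sob_M_le hP (by norm_num) hY hQ
  have hM2 := sob_M_le hP le_rfl hZ hQ'
  rw [← hm] at hM1 hM2
  have t1 : sob (P.h J) 0 u ≤ N := hbig (hu0.trans (by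
    calc Y ≤ 1 * (1 * (Y ^ 3 * 1)) := by linarith
      _ ≤ _ := by gcongr))
  have t2 : sob (P.h J) 0 (u * u) ≤ N := hbig ((hS.mul₂_le J u u).trans (by
    calc S * (sob (P.h J) 1 u * sob (P.h J) 1 u) ≤ S * (Y * Y) := by gcongr
      _ = S * (1 * (Y ^ 2 * 1)) := by ring
      _ ≤ _ := by gcongr))
  have t3 : sob (P.h J) 0 (u * u * u) ≤ N := hbig ((hS.mul₃_le J u u u).trans (by
    calc S * (sob (P.h J) 1 u * sob (P.h J) 1 u * sob (P.h J) 1 u) ≤ S * (Y * Y * Y) := by gcongr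
      _ = S * (1 * (Y ^ 3 * 1)) := by ring
      _ ≤ _ := by gcongr))
  have t4 : ∀ k l, sob (P.h J) 0 (comp (P.M Q) k l * P.hc u k l) ≤ N := fun k l =>
    hbig ((hS.sob_zero_mul_le _ _).trans (by
      calc S * (sob (P.h J) 2 (comp (P.M Q) k l) * sob (P.h J) 0 (P.hc u k l))
          ≤ S * (m * Z * Y) := by
            gcongr
            · exact hM2 k l
            · exact (sob_hc_le hP 0 u k l).trans hu
        _ = S * (m * (Y * Z)) := by ring
        _ ≤ _ := by gcongr))
  have t5 : ∀ k l, sob (P.h J) 0 (Dm (P.h J) k (Dm (P.h J) l (u * comp (P.M Q) k l))) ≤ N :=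
    fun k l => (hS.sob_zero_Dm_Dm_mul_le k l _ _).trans (by
      calc 2 * ((1 + 2 * d) * S) * (sob (P.h J) 2 u * sob (P.h J) 2 (comp (P.M Q) k l))
          ≤ 2 * ((1 + 2 * d) * S) * (Y * (m * Z)) := by
            gcongr
            exact hM2 k l
        _ = 2 * ((1 + 2 * d) * S) * m * (Y * Z) := by ring
        _ ≤ _ := by rw [hN]; gcongr)
  have t6 : ∀ k l, sob (P.h J) 0 (comp (P.M Q) k l * comp (P.M Q) k l * u) ≤ N := fun k l =>
    hbig ((hS.mul₃_le J _ _ _).trans (by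
      calc S * (sob (P.h J) 1 (comp (P.M Q) k l) * sob (P.h J) 1 (comp (P.M Q) k l)
            * sob (P.h J) 1 u) ≤ S * (m * Y * (m * Y) * Y) := by
            gcongr
            · exact hM1 k l
            · exact hM1 k l
        _ = S * (m ^ 2 * (Y ^ 3 * 1)) := by ring
        _ ≤ _ := by gcongr))
  rw [mu_eq]
  refine (seminorm_add_le _ (seminorm_add_le _ (seminorm_add_le _ (seminorm_add_le _
    (seminorm_add_le _ (seminorm_smul_le _ P.a t1) (seminorm_smul_le _ P.b t2))
    (seminorm_smul_le _ P.c t3))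
    (seminorm_smul_le _ _ (seminorm_sum_le _ fun k => seminorm_sum_le _ fun l => t4 k l)))
    (seminorm_smul_le _ _ (seminorm_sum_le _ fun k => seminorm_sum_le _ fun l => t5 k l)))
    (seminorm_smul_le _ _ (seminorm_sum_le _ fun k => seminorm_sum_le _ fun l => t6 k l))).trans
    (le_of_eq ?_)
  unfold Kμ
  ring

end Nonlinear

/-! ### Bounds at a state of bounded energy -/

section Bounds

variable {d J : ℕ} [NeZero J] {P : Params}

lemma ip_one_le (hP : P.Admissible d) {f : Grid d J} {b : ℝ} (hf : ∀ x, f x ≤ b) :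
    ip (P.h J) f (fun _ => 1) ≤ P.L ^ d * b := by
  have hJ := natCast_J_pos (J := J)
  have hh := hP.h_pos (J := J)
  have h1 : ∑ x, f x * 1 ≤ ∑ _x : Fin d → ZMod J, b :=
    Finset.sum_le_sum fun x _ => by rw [mul_one]; exact hf x
  have h2 := mul_le_mul_of_nonneg_left h1 (pow_pos hh d).le
  refine h2.trans (le_of_eq ?_)
  simp only [Finset.sum_const, Finset.card_univ, Fintype.card_pi_const, ZMod.card, nsmul_eq_mul,
    Nat.cast_pow]
  rw [Params.h, div_pow]
  field_simp

lemma fbn_le (hP : P.Admissible d) {X : Matrix (Fin d) (Fin d) ℝ} (hX : X.IsSymm) {ρ : ℝ}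
    (hρ : ∑ i, ∑ j, X i j ^ 2 ≤ ρ) :
    P.fbn X ≤ |P.A| / 2 * ρ + P.B / 3 * (1 + ρ ^ 3) + P.C / 4 * ρ ^ 2 := by
  have hB := hP.B_pos
  have hC := hP.C_pos
  set r := ∑ i, ∑ j, X i j ^ 2 with hr
  have hr0 : 0 ≤ r := Finset.sum_nonneg fun i _ => Finset.sum_nonneg fun j _ => sq_nonneg _
  have h1 : -(X * X * X).trace ≤ 1 + ρ ^ 3 := by
    have h2 := trace_mul₃_sq_le X
    rw [← hr] at h2
    have h3 : r ^ 3 ≤ ρ ^ 3 := pow_le_pow_left₀ hr0 hρ 3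
    nlinarith [sq_nonneg ((X * X * X).trace + 1)]
  rw [fbn, trace_mul_self_of_isSymm hX, ← hr]
  have h4 : P.A / 2 * r ≤ |P.A| / 2 * ρ :=
    mul_le_mul (by gcongr; exact le_abs_self _) hρ hr0 (by positivity)
  have h5 : r ^ 2 ≤ ρ ^ 2 := pow_le_pow_left₀ hr0 hρ 2
  have h6 := mul_le_mul_of_nonneg_left h1 (by positivity : 0 ≤ P.B / 3)
  have h7 := mul_le_mul_of_nonneg_left h5 (by positivity : 0 ≤ P.C / 4)
  linarith

lemma fs_le (hP : P.Admissible d) {v ρ : ℝ} (hv : |v| ≤ ρ) :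
    P.fs v ≤ |P.a| / 2 * ρ ^ 2 + P.b / 3 * ρ ^ 3 + P.c / 4 * ρ ^ 4 := by
  have hb := hP.b_nonneg
  have hc := hP.c_pos
  have h2 : v ^ 2 ≤ ρ ^ 2 := by rw [← sq_abs]; exact pow_le_pow_left₀ (abs_nonneg _) hv 2
  have h3 : v ^ 3 ≤ ρ ^ 3 := (le_abs_self _).trans (by
    rw [abs_pow]; exact pow_le_pow_left₀ (abs_nonneg _) hv 3)
  have h4 : v ^ 4 ≤ ρ ^ 4 := (le_abs_self _).trans (by
    rw [abs_pow]; exact pow_le_pow_left₀ (abs_nonneg _) hv 4)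
  have h5 : P.a / 2 * v ^ 2 ≤ |P.a| / 2 * ρ ^ 2 :=
    mul_le_mul (by gcongr; exact le_abs_self _) h2 (sq_nonneg _) (by positivity)
  have h6 := mul_le_mul_of_nonneg_left h3 (by positivity : 0 ≤ P.b / 3)
  have h7 := mul_le_mul_of_nonneg_left h4 (by positivity : 0 ≤ P.c / 4)
  rw [fs]
  linarith

lemma l2T_Mu_sq (hP : P.Admissible d) (Q : TGrid d J) (u : Grid d J) :
    l2T (P.h J) (P.Mu Q u) ^ 2 = ip (P.h J) (fun x => u x ^ 2 * ∑ i, ∑ j, ((P.sPlus d)⁻¹ • Q x +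
      (d : ℝ)⁻¹ • (1 : Matrix (Fin d) (Fin d) ℝ)) i j ^ 2) (fun _ => 1) := by
  rw [l2T_sq hP, sum_sob_zero_sq P hP, ip]
  congr 1
  refine Finset.sum_congr rfl fun z _ => ?_
  rw [mul_one, Finset.mul_sum]
  refine Finset.sum_congr rfl fun i _ => ?_
  rw [Finset.mul_sum]
  refine Finset.sum_congr rfl fun j _ => ?_
  simp only [Mu, M, Matrix.smul_apply, smul_eq_mul]
  ring

end Bounds

/-- `E_{1h}` is bounded above on bounded sets of the discrete `H²` norms. -/
lemma exists_E1_le {d : ℕ} {P : Params} (hd : 0 < d) (hP : P.Admissible d) {S : ℝ}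
    (hS : SobolevConst d P.L S) (R : ℝ) :
    ∃ C : ℝ, ∀ (J : ℕ) [NeZero J] (Q : TGrid d J) (u : Grid d J), (∀ x, (Q x).IsSymm) →
      (∀ i j, sob (P.h J) 2 (comp Q i j) ≤ R) → sob (P.h J) 2 u ≤ R → P.E1 Q u ≤ C := by
  have hB₀ := hP.B₀_pos
  have hq := hP.q_pos
  have hL := hP.L_pos
  set ρ := (d : ℝ) * d * (S * R) ^ 2 with hρ
  set m := (S * R) ^ 2 * (2 * ((P.sPlus d)⁻¹) ^ 2 * ρ + 2) with hm
  refine ⟨2 * P.B₀ * P.q ^ 2 * (R ^ 2 + P.L ^ d * m) + P.B₀ * P.q ^ 4 * (P.L ^ d * m)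
    + P.L ^ d * (|P.A| / 2 * ρ + P.B / 3 * (1 + ρ ^ 3) + P.C / 4 * ρ ^ 2)
    + P.L ^ d * (|P.a| / 2 * (S * R) ^ 2 + P.b / 3 * (S * R) ^ 3 + P.c / 4 * (S * R) ^ 4),
    fun J _ Q u hsym hQ hu => ?_⟩
  have hh := hP.h_pos (J := J)
  have hS0 := hS.C_pos
  have hR0 : 0 ≤ R := (apply_nonneg _ _).trans hu
  have hub : ∀ x, |u x| ≤ S * R := fun x =>
    (hS.sup_le J u x).trans (mul_le_mul_of_nonneg_left hu hS0.le)
  have hQb : ∀ x, ∑ i, ∑ j, Q x i j ^ 2 ≤ ρ := by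
    intro x
    have h1 : ∀ i j, Q x i j ^ 2 ≤ (S * R) ^ 2 := by
      intro i j
      rw [← sq_abs]
      exact pow_le_pow_left₀ (abs_nonneg _) ((hS.sup_le J (comp Q i j) x).trans
        (mul_le_mul_of_nonneg_left (hQ i j) hS0.le)) 2
    refine (Finset.sum_le_sum fun i _ => Finset.sum_le_sum fun j _ => h1 i j).trans (le_of_eq ?_)
    simp only [Finset.sum_const, Finset.card_univ, Fintype.card_fin, nsmul_eq_mul]
    rw [hρ]
    ring
  have hMu : l2T (P.h J) (P.Mu Q u) ^ 2 ≤ P.L ^ d * m := by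
    rw [l2T_Mu_sq hP]
    refine ip_one_le hP fun x => ?_
    refine mul_le_mul ?_ ((sum_M_sq_le hd P (Q x)).trans ?_) (Finset.sum_nonneg fun i _ =>
      Finset.sum_nonneg fun j _ => sq_nonneg _) (sq_nonneg _)
    · rw [← sq_abs]
      exact pow_le_pow_left₀ (abs_nonneg _) (hub x) 2
    · have := mul_le_mul_of_nonneg_left (hQb x) (by positivity : 0 ≤ 2 * ((P.sPlus d)⁻¹) ^ 2)
      linarith
  have hI : ipT (P.h J) (hess (P.h J) u) (P.Mu Q u) ≤ R ^ 2 + P.L ^ d * m := by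
    have h1 := ipT_hess_sq_le hP u (P.Mu Q u)
    have h2 : sob (P.h J) 0 (lap (P.h J) u) ≤ R := (sob_lap_le hh 0 u).trans hu
    have h3 : sob (P.h J) 0 (lap (P.h J) u) ^ 2 ≤ R ^ 2 :=
      pow_le_pow_left₀ (apply_nonneg _ _) h2 2
    have h4 : ipT (P.h J) (hess (P.h J) u) (P.Mu Q u) ^ 2 ≤ R ^ 2 * (P.L ^ d * m) :=
      h1.trans (mul_le_mul h3 hMu (sq_nonneg _) (sq_nonneg _))
    have h5 : 0 ≤ P.L ^ d * m := (sq_nonneg _).trans hMu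
    refine (le_abs_self _).trans (abs_le_of_sq_le_sq ?_ (by positivity))
    nlinarith [sq_nonneg R, mul_nonneg (sq_nonneg R) h5]
  have hN := ip_one_le (J := J) hP fun x => fbn_le hP (hsym x) (hQb x)
  have hF := ip_one_le (J := J) hP fun x => fs_le hP (hub x)
  have h1 := mul_le_mul_of_nonneg_left hI (by positivity : 0 ≤ 2 * P.B₀ * P.q ^ 2)
  have h2 := mul_le_mul_of_nonneg_left hMu (by positivity : 0 ≤ P.B₀ * P.q ^ 4)
  rw [E1]
  linarith

/-- At bounded energy the factor `g` decays faster than any power of the energy norms. -/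
lemma exists_g_mul_pow_le {d : ℕ} {P : Params} (hd : 0 < d) (hP : P.Admissible d) (C₀ : ℝ)
    (p : ℕ) : ∃ C : ℝ, 0 ≤ C ∧ ∀ (J : ℕ) [NeZero J] (Q : TGrid d J) (u : Grid d J) (s : ℝ),
      (∀ x, (Q x).IsSymm) → P.elastic Q u + s ≤ C₀ →
        P.g Q u s * (1 + P.energySize Q u) ^ p ≤ C := by
  obtain ⟨c, K, hc, hcoer⟩ := exists_energy_coercive hd hP
  refine ⟨Real.exp (C₀ + K + c) * (p.factorial / c ^ p), by positivity,
    fun J _ Q u s hsym hE => ?_⟩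
  have hY : 0 ≤ 1 + P.energySize Q u := by linarith [P.energySize_nonneg Q u]
  set Y := 1 + P.energySize Q u with hYdef
  -- The energy bound and coercivity give s - E₁ ≤ C₀ - (elastic + E₁) ≤ C₀ + K - c · energySize.
  -- The extra c in the exponent replaces energySize by Y = 1 + energySize.
  have h1 : P.g Q u s ≤ Real.exp (C₀ + K + c) / Real.exp (c * Y) := by
    rw [g, ← Real.exp_sub, ← Real.exp_sub]
    refine Real.exp_le_exp.mpr ?_
    have := hcoer J Q u hsym
    rw [hYdef]
    linarith
  have h2 := Real.pow_div_factorial_le_exp (c * Y) (by positivity) p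
  have h3 : Y ^ p ≤ Real.exp (c * Y) * (p.factorial / c ^ p) := by
    rw [mul_pow] at h2
    rw [mul_div_assoc', le_div_iff₀ (by positivity)]
    rw [div_le_iff₀ (by positivity)] at h2
    linarith
  calc P.g Q u s * Y ^ p ≤ Real.exp (C₀ + K + c) / Real.exp (c * Y) *
        (Real.exp (c * Y) * (p.factorial / c ^ p)) := by gcongr
    _ = _ := by field_simp

section

variable {d J : ℕ} [NeZero J] {P : Params}

lemma sob_one_le_energySize (P : Params) (Q : TGrid d J) (u : Grid d J) (i j : Fin d) :
    sob (P.h J) 1 (comp Q i j) ≤ 1 + P.energySize Q u := by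
  have h1 : sob (P.h J) 1 (comp Q i j) ^ 2 ≤ ∑ i, ∑ j, sob (P.h J) 1 (comp Q i j) ^ 2 := by
    refine le_trans ?_ (Finset.single_le_sum (f := fun i => ∑ j, sob (P.h J) 1 (comp Q i j) ^ 2)
      (fun i _ => Finset.sum_nonneg fun j _ => sq_nonneg _) (Finset.mem_univ i))
    exact Finset.single_le_sum (f := fun j => sob (P.h J) 1 (comp Q i j) ^ 2)
      (fun j _ => sq_nonneg _) (Finset.mem_univ j)
  rw [energySize]
  nlinarith [sq_nonneg (sob (P.h J) 2 u), sq_nonneg (sob (P.h J) 1 (comp Q i j) - 1)]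

lemma sob_two_le_energySize (P : Params) (Q : TGrid d J) (u : Grid d J) :
    sob (P.h J) 2 u ≤ 1 + P.energySize Q u := by
  have h1 : 0 ≤ ∑ i, ∑ j, sob (P.h J) 1 (comp Q i j) ^ 2 :=
    Finset.sum_nonneg fun i _ => Finset.sum_nonneg fun j _ => sq_nonneg _
  rw [energySize]
  nlinarith [sq_nonneg (sob (P.h J) 2 u - 1)]

end

/-- Bounds for the nonlinear terms at a state of bounded energy. -/
structure NonlinearBound {d J : ℕ} [NeZero J] (P : Params) (C : ℝ) (Q : TGrid d J) (u : Grid d J)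
    (s : ℝ) : Prop where
  HQ_le : ∀ i j, P.g Q u s * sob (P.h J) 0 (comp (P.HQ Q u) i j) ≤ C
  mu_le : ∀ W, 1 ≤ W → (∀ i j, sob (P.h J) 2 (comp Q i j) ≤ W) →
    P.g Q u s * sob (P.h J) 0 (P.mu Q u) ≤ C * W
  NQ_le : ∀ i j, sob (P.h J) 0 (comp (P.NQ Q u s) i j) ≤ C
  Nu_le : ∀ W, 1 ≤ W → (∀ i j, sob (P.h J) 2 (comp Q i j) ≤ W) →
    sob (P.h J) 0 (P.Nu Q u s) ≤ C * W
  sob_one_NQ_le : ∀ W, 1 ≤ W → (∀ i j, sob (P.h J) 2 (comp Q i j) ≤ W) → sob (P.h J) 3 u ≤ W →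
    ∀ i j, sob (P.h J) 1 (comp (P.NQ Q u s) i j) ≤ C * W

/-- With Y = 1 + energySize, every bound for H and μ carries at most Y³ apart from a higher norm,
which occurs linearly. Since g Y³ is bounded, only that linear dependence remains. -/
lemma exists_nonlinearBound {d : ℕ} {P : Params} (hd : 0 < d) (hP : P.Admissible d) {S : ℝ}
    (hS : SobolevConst d P.L S) (C₀ : ℝ) : ∃ C : ℝ, 0 ≤ C ∧
      ∀ (J : ℕ) [NeZero J] (Q : TGrid d J) (u : Grid d J) (s : ℝ), (∀ x, (Q x).IsSymm) →
        P.elastic Q u + s ≤ C₀ → P.NonlinearBound C Q u s := by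
  obtain ⟨G, hG0, hG⟩ := exists_g_mul_pow_le hd hP C₀ 3
  have hS0 := hS.C_pos
  have hκ₁ := hP.κ₁_pos
  have hκ₂ := hP.κ₂_pos
  have hKH := P.KH_nonneg d
  have hKμ := P.Kμ_nonneg d
  set c₁ := P.KH d * S with hc₁
  set c₂ := P.KH d * ((1 + 3 * d) * S) with hc₂
  set c₃ := P.Kμ d * (2 * ((1 + 2 * d) * S) * P.KM d ^ 2) with hc₃
  have h₁ : 0 ≤ c₁ := by positivity
  have h₂ : 0 ≤ c₂ := by positivity
  have h₃ : 0 ≤ c₃ := by positivity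
  refine ⟨(c₁ + c₂ + c₃ + P.κ₁ + P.κ₂) * G, by positivity, fun J _ Q u s hsym hE => ?_⟩
  have hh := hP.h_pos (J := J)
  have hE0 := P.energySize_nonneg Q u
  have hgY := hG J Q u s hsym hE
  have hQ1 := P.sob_one_le_energySize Q u
  have hu2 := P.sob_two_le_energySize Q u
  have hγ := g_pos (P := P) Q u s
  set γ := P.g Q u s with hγdef
  set Y := 1 + P.energySize Q u with hY
  have hY1 : 1 ≤ Y := by linarith
  have hY0 : 0 < Y := by linarith
  have hYp : Y ≤ Y ^ 3 := le_self_pow₀ hY1 (by norm_num)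
  have hγY : γ * Y ≤ G := (mul_le_mul_of_nonneg_left hYp hγ.le).trans hgY
  have hYW : ∀ {W : ℝ}, 1 ≤ W → Y ≤ Y * W := fun hW => le_mul_of_one_le_right hY0.le hW
  have bH : ∀ i j, γ * sob (P.h J) 0 (comp (P.HQ Q u) i j) ≤ c₁ * G := by
    intro i j
    calc _ ≤ γ * (P.KH d * (S * Y ^ 3)) :=
          mul_le_mul_of_nonneg_left (sob_zero_HQ_le hP hS hY1 hQ1 hu2 i j) hγ.le
      _ = c₁ * (γ * Y ^ 3) := by rw [hc₁]; ring
      _ ≤ _ := mul_le_mul_of_nonneg_left hgY h₁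
  have bμ : ∀ W, 1 ≤ W → (∀ i j, sob (P.h J) 2 (comp Q i j) ≤ W) →
      γ * sob (P.h J) 0 (P.mu Q u) ≤ c₃ * G * W := by
    intro W hW hQ2
    calc _ ≤ γ * (P.Kμ d * (2 * ((1 + 2 * d) * S) * P.KM d ^ 2 * (Y ^ 3 * W))) :=
          mul_le_mul_of_nonneg_left (sob_zero_mu_le hP hS hY1 hW hQ1 hQ2 hu2) hγ.le
      _ = c₃ * (γ * Y ^ 3) * W := by rw [hc₃]; ring
      _ ≤ _ := by gcongr
  have bH1 : ∀ W, 1 ≤ W → (∀ i j, sob (P.h J) 2 (comp Q i j) ≤ W) → sob (P.h J) 3 u ≤ W →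
      ∀ i j, γ * sob (P.h J) 1 (comp (P.HQ Q u) i j) ≤ c₂ * G * W := by
    intro W hW hQ2 hu3 i j
    -- The H¹ bound for H requires a higher norm that dominates Y, so Y · W is used in place of W.
    -- This raises Y² to Y³, which g still absorbs.
    have hWW : W ≤ Y * W := le_mul_of_one_le_left (by linarith) hY1
    calc _ ≤ γ * (P.KH d * ((1 + 3 * d) * S * (Y ^ 2 * (Y * W)))) :=
          mul_le_mul_of_nonneg_left (sob_one_HQ_le hP hS hY1 (hYW hW) hQ1
            (fun i j => (hQ2 i j).trans hWW) hu2 (hu3.trans hWW) i j) hγ.le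
      _ = c₂ * (γ * Y ^ 3) * W := by rw [hc₂]; ring
      _ ≤ _ := by gcongr
  have hN : ∀ (r : ℕ) (f k : Grid d J) (κ : ℝ), 0 < κ →
      sob (P.h J) r (-(γ • f) + (γ * κ) • k) ≤
        γ * sob (P.h J) r f + κ * (γ * sob (P.h J) r k) := by
    intro r f k κ hκ
    refine (map_add_le_add _ _ _).trans (le_of_eq ?_)
    rw [map_neg_eq_map, map_smul_eq_mul, map_smul_eq_mul, Real.norm_of_nonneg hγ.le,
      Real.norm_of_nonneg (by positivity)]
    ring
  have hQ0 : ∀ i j, γ * sob (P.h J) 1 (comp Q i j) ≤ G := fun i j =>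
    (mul_le_mul_of_nonneg_left (hQ1 i j) hγ.le).trans hγY
  have p₁ : 0 ≤ c₁ * G := by positivity
  have p₂ : 0 ≤ c₂ * G := by positivity
  have p₃ : 0 ≤ c₃ * G := by positivity
  have p₄ : 0 ≤ P.κ₁ * G := by positivity
  have p₅ : 0 ≤ P.κ₂ * G := by positivity
  have hC : (c₁ + c₂ + c₃ + P.κ₁ + P.κ₂) * G =
      c₁ * G + c₂ * G + c₃ * G + P.κ₁ * G + P.κ₂ * G := by ring
  have hWm : ∀ {W t : ℝ}, 1 ≤ W → 0 ≤ t → t ≤ t * W := fun hW ht => le_mul_of_one_le_right ht hW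
  refine ⟨fun i j => ?_, fun W hW hQ2 => ?_, fun i j => ?_, fun W hW hQ2 => ?_,
    fun W hW hQ2 hu3 i j => ?_⟩
  · rw [hC]
    linarith [bH i j]
  · refine (bμ W hW hQ2).trans (mul_le_mul_of_nonneg_right ?_ (by linarith))
    rw [hC]
    linarith
  · rw [comp_NQ]
    refine (hN 0 _ _ _ hκ₁).trans ?_
    have h1 := mul_le_mul_of_nonneg_left ((mul_le_mul_of_nonneg_left
      (sob_mono hh zero_le_one (comp Q i j)) hγ.le).trans (hQ0 i j)) hκ₁.le
    rw [hC]
    linarith [bH i j]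
  · rw [Nu_eq]
    refine (hN 0 _ _ _ hκ₂).trans ?_
    have h1 := mul_le_mul_of_nonneg_left ((mul_le_mul_of_nonneg_left
      ((sob_mono hh (Nat.zero_le 2) u).trans hu2) hγ.le).trans hγY) hκ₂.le
    rw [hC]
    have := bμ W hW hQ2
    have := hWm hW p₁
    have := hWm hW p₂
    have := hWm hW p₄
    have := hWm hW p₅
    linarith
  · rw [comp_NQ]
    refine (hN 1 _ _ _ hκ₁).trans ?_
    have h1 := mul_le_mul_of_nonneg_left (hQ0 i j) hκ₁.le
    rw [hC]
    have := bH1 W hW hQ2 hu3 i j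
    have := hWm hW p₁
    have := hWm hW p₃
    have := hWm hW p₄
    have := hWm hW p₅
    linarith

end Params

/-- A discrete Gronwall inequality with a dissipative term. -/
lemma discrete_gronwall {τ : ℝ} (hτ : 0 < τ) {N : ℕ} {y D F : ℕ → ℝ}
    (hy : 0 ≤ y 0) (hD : ∀ n, 0 ≤ D n) (hF : ∀ n, 0 ≤ F n)
    (hstep : ∀ n < N, y (n + 1) + τ * D n ≤ (1 + τ) ^ 2 * (y n + τ * F n)) :
    ∀ n ≤ N, y n + τ * ∑ k ∈ Finset.range n, D k ≤
      Real.exp (2 * (n * τ)) * (y 0 + τ * ∑ k ∈ Finset.range n, F k) := by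
  intro n
  induction n with
  | zero => intro _; simp
  | succ n ih =>
    intro hn
    have h1 := ih (by omega)
    have h2 := hstep n (by omega)
    have hexp : (1 + τ) ^ 2 ≤ Real.exp (2 * τ) := by
      have := Real.add_one_le_exp τ
      have e : Real.exp (2 * τ) = Real.exp τ ^ 2 := by
        rw [sq, ← Real.exp_add]
        congr 1
        ring
      rw [e]
      exact pow_le_pow_left₀ (by linarith) (by linarith) 2
    have hone : 1 ≤ (1 + τ) ^ 2 := one_le_pow₀ (by linarith)
    have hSD : 0 ≤ τ * ∑ k ∈ Finset.range n, D k :=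
      mul_nonneg hτ.le (Finset.sum_nonneg fun k _ => hD k)
    have hFn : 0 ≤ τ * F n := mul_nonneg hτ.le (hF n)
    have hE1 : 1 ≤ Real.exp (2 * (n * τ)) := Real.one_le_exp (by positivity)
    have hE : Real.exp (2 * ((n + 1 : ℕ) * τ)) = Real.exp (2 * τ) * Real.exp (2 * (n * τ)) := by
      rw [← Real.exp_add]
      congr 1
      push_cast
      ring
    rw [Finset.sum_range_succ, Finset.sum_range_succ, hE]
    set A := Real.exp (2 * (n * τ)) * (y 0 + τ * ∑ k ∈ Finset.range n, F k) with hA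
    set SD := τ * ∑ k ∈ Finset.range n, D k with hSDdef
    have h3 : y (n + 1) + τ * (∑ k ∈ Finset.range n, D k + D n) ≤
        (1 + τ) ^ 2 * (A + Real.exp (2 * (n * τ)) * (τ * F n)) := by
      calc y (n + 1) + τ * (∑ k ∈ Finset.range n, D k + D n)
          = (y (n + 1) + τ * D n) + SD := by rw [hSDdef]; ring
        _ ≤ (1 + τ) ^ 2 * (y n + τ * F n) + (1 + τ) ^ 2 * SD :=
            add_le_add h2 (le_mul_of_one_le_left hSD hone)
        _ = (1 + τ) ^ 2 * ((y n + SD) + τ * F n) := by ring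
        _ ≤ _ := by
            refine mul_le_mul_of_nonneg_left (add_le_add h1 ?_) (by positivity)
            exact le_mul_of_one_le_left hFn hE1
    have h4 : 0 ≤ A + Real.exp (2 * (n * τ)) * (τ * F n) := by
      have := mul_nonneg hτ.le (Finset.sum_nonneg fun k (_ : k ∈ Finset.range n) => hF k)
      positivity
    refine (h3.trans (mul_le_mul_of_nonneg_right hexp h4)).trans (le_of_eq ?_)
    rw [hA]
    ring

namespace Params

/-! ### Estimates for one step in discrete Sobolev norms -/

section StepBounds

variable {d J : ℕ} [NeZero J] {P : Params}

/-- The squared discrete Sobolev norm of order `r` of a matrix-valued grid function. -/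
def sobT (P : Params) (r : ℕ) (Q : TGrid d J) : ℝ := ∑ i, ∑ j, sob (P.h J) r (comp Q i j) ^ 2

lemma sobT_nonneg (P : Params) (r : ℕ) (Q : TGrid d J) : 0 ≤ P.sobT r Q :=
  Finset.sum_nonneg fun _ _ => Finset.sum_nonneg fun _ _ => sq_nonneg _

lemma sob_sq_le_sobT (P : Params) (r : ℕ) (Q : TGrid d J) (i j : Fin d) :
    sob (P.h J) r (comp Q i j) ^ 2 ≤ P.sobT r Q := by
  refine le_trans ?_ (Finset.single_le_sum (f := fun i => ∑ j, sob (P.h J) r (comp Q i j) ^ 2)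
    (fun i _ => Finset.sum_nonneg fun j _ => sq_nonneg _) (Finset.mem_univ i))
  exact Finset.single_le_sum (f := fun j => sob (P.h J) r (comp Q i j) ^ 2)
    (fun j _ => sq_nonneg _) (Finset.mem_univ j)

/-- The parabolicity constant of `-K Δ_h`. -/
def cQ (P : Params) : ℝ := min 1 P.K

/-- The parabolicity constant of `2 B₀ Δ_h²`. -/
def cu (P : Params) : ℝ := min 1 (2 * P.B₀) / 2

lemma Admissible.cQ_pos (hP : P.Admissible d) : 0 < P.cQ := lt_min one_pos hP.K_pos

lemma Admissible.cu_pos (hP : P.Admissible d) : 0 < P.cu := by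
  have := hP.B₀_pos
  unfold cu
  positivity

lemma Admissible.cQ_mul_le (hP : P.Admissible d) {γ : ℝ} (hγ : 0 ≤ γ) (k : Fin d → ZMod J) :
    P.cQ * (1 + lam (P.h J) k) ≤ 1 + (P.K * lam (P.h J) k + γ * P.κ₁) := by
  have h1 := lam_nonneg (P.h J) k
  have h2 := mul_nonneg hγ hP.κ₁_pos.le
  have h3 : P.cQ ≤ 1 := min_le_left _ _
  have h4 := mul_le_mul_of_nonneg_right (min_le_right 1 P.K) h1
  unfold cQ at *
  linarith

lemma Admissible.cu_mul_sq_le (hP : P.Admissible d) {γ : ℝ} (hγ : 0 ≤ γ) (k : Fin d → ZMod J) :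
    P.cu * (1 + lam (P.h J) k) ^ 2 ≤ 1 + (2 * P.B₀ * lam (P.h J) k ^ 2 + γ * P.κ₂) := by
  have h1 := lam_nonneg (P.h J) k
  have h2 := mul_nonneg hγ hP.κ₂_pos.le
  have h0 := hP.cu_pos
  have h3 : 2 * P.cu ≤ 1 := by unfold cu; linarith [min_le_left 1 (2 * P.B₀)]
  have h4 : 2 * P.cu ≤ 2 * P.B₀ := by unfold cu; linarith [min_le_right 1 (2 * P.B₀)]
  have h5 := mul_le_mul_of_nonneg_right h4 (sq_nonneg (lam (P.h J) k))
  nlinarith [mul_nonneg h0.le (sq_nonneg (1 - lam (P.h J) k))]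

lemma Admissible.cu_mul_le (hP : P.Admissible d) {γ : ℝ} (hγ : 0 ≤ γ) (k : Fin d → ZMod J) :
    P.cu * (1 + lam (P.h J) k) ≤ 1 + (2 * P.B₀ * lam (P.h J) k ^ 2 + γ * P.κ₂) := by
  refine le_trans ?_ (hP.cu_mul_sq_le hγ k)
  have h1 := lam_nonneg (P.h J) k
  refine mul_le_mul_of_nonneg_left ?_ hP.cu_pos.le
  exact le_self_pow₀ (by linarith) (by norm_num)

lemma sobT_le_const {r : ℕ} {F : TGrid d J} {C : ℝ}
    (hF : ∀ i j, sob (P.h J) r (comp F i j) ≤ C) : P.sobT r F ≤ d * d * C ^ 2 := by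
  refine (Finset.sum_le_sum fun i _ => Finset.sum_le_sum fun j _ =>
    pow_le_pow_left₀ (apply_nonneg _ _) (hF i j) 2).trans (le_of_eq ?_)
  simp only [Finset.sum_const, Finset.card_univ, Fintype.card_fin, nsmul_eq_mul]
  ring

/-- Supplies the parameter W of the linear bounds: W = 1 + √(‖Q‖²_{H²} + f), whose square is again
linear in the summable quantities. The cases used are f = 0 and f = ‖u‖²_{H⁴}. -/
lemma exists_dominating (P : Params) (Q : TGrid d J) {f : ℝ} (hf : 0 ≤ f) :
    ∃ W : ℝ, 1 ≤ W ∧ (∀ i j, sob (P.h J) 2 (comp Q i j) ≤ W) ∧ √f ≤ W ∧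
      W ^ 2 ≤ 2 * (1 + (P.sobT 2 Q + f)) := by
  have h0 := P.sobT_nonneg 2 Q
  have h1 := Real.sq_sqrt (add_nonneg h0 hf)
  have h2 := Real.sqrt_nonneg (P.sobT 2 Q + f)
  refine ⟨1 + √(P.sobT 2 Q + f), by linarith, fun i j => ?_, ?_, ?_⟩
  · have h3 : sob (P.h J) 2 (comp Q i j) ≤ √(P.sobT 2 Q + f) :=
      Real.le_sqrt_of_sq_le (by linarith [P.sob_sq_le_sobT 2 Q i j])
    linarith
  · have := Real.sqrt_le_sqrt (by linarith : f ≤ P.sobT 2 Q + f)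
    linarith
  · nlinarith [sq_nonneg (1 - √(P.sobT 2 Q + f))]

variable {τ C : ℝ} {Q Q' : TGrid d J} {u u' : Grid d J} {s s' : ℝ}

lemma Step.sobT_add_le (hP : P.Admissible d) (hτ : 0 < τ) (hS : P.Step τ Q u s Q' u' s')
    (r : ℕ) : P.sobT (1 + r) Q' + τ * (P.cQ * P.sobT (2 + r) Q') ≤
      (1 + τ) ^ 2 * (P.sobT (1 + r) Q + τ * (4 / P.cQ * P.sobT r (P.NQ Q u s))) := by
  have hγ := (g_pos (P := P) Q u s).le
  have h1 : ∀ i j, sob (P.h J) (1 + r) (comp Q' i j) ^ 2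
      + τ * P.cQ * sob (P.h J) (2 + r) (comp Q' i j) ^ 2 ≤
      (1 + τ) ^ 2 * (sob (P.h J) (1 + r) (comp Q i j) ^ 2
        + 4 * τ / P.cQ * sob (P.h J) r (comp (P.NQ Q u s) i j) ^ 2) := fun i j =>
    (hS.etdQ i j).sob_sq_add_le (m := 1) hτ hP.h_pos hP.cQ_pos r (hP.symbolQ_nonneg hγ)
      (fun k => by rw [pow_one]; exact hP.cQ_mul_le hγ k)
  have h2 := Finset.sum_le_sum fun i (_ : i ∈ Finset.univ) =>
    Finset.sum_le_sum fun j (_ : j ∈ Finset.univ) => h1 i j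
  simp only [Finset.sum_add_distrib, ← Finset.mul_sum] at h2
  simp only [sobT]
  refine le_trans (le_of_eq ?_) (h2.trans (le_of_eq ?_)) <;> ring

lemma Step.sob_u_add_le (hP : P.Admissible d) (hτ : 0 < τ) (hS : P.Step τ Q u s Q' u' s') :
    sob (P.h J) 2 u' ^ 2 + τ * (P.cu * sob (P.h J) 4 u' ^ 2) ≤
      (1 + τ) ^ 2 * (sob (P.h J) 2 u ^ 2 + τ * (4 / P.cu * sob (P.h J) 0 (P.Nu Q u s) ^ 2)) := by
  have hγ := (g_pos (P := P) Q u s).le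
  have h1 := hS.etdu.sob_sq_add_le (m := 2) hτ hP.h_pos hP.cu_pos 0 (hP.symbolu_nonneg hγ)
    (hP.cu_mul_sq_le hγ)
  refine le_trans (le_of_eq ?_) (h1.trans (le_of_eq ?_)) <;> ring

lemma Step.sobT_jump_le (hP : P.Admissible d) (hτ : 0 < τ) (hS : P.Step τ Q u s Q' u' s') :
    P.sobT 2 Q' ≤ 2 * P.sobT 2 Q + 2 * ((1 + τ) / P.cQ) ^ 2 * P.sobT 0 (P.NQ Q u s) := by
  have hγ := (g_pos (P := P) Q u s).le
  have h2 := Finset.sum_le_sum fun i (_ : i ∈ Finset.univ) =>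
    Finset.sum_le_sum fun j (_ : j ∈ Finset.univ) =>
      (hS.etdQ i j).sob_two_sq_le hτ hP.h_pos hP.cQ_pos (hP.symbolQ_nonneg hγ) (hP.cQ_mul_le hγ)
  simp only [Finset.sum_add_distrib, ← Finset.mul_sum] at h2
  exact h2

lemma Step.sob_u_jump_le (hP : P.Admissible d) (hτ : 0 < τ) (hS : P.Step τ Q u s Q' u' s') :
    sob (P.h J) 2 u' ^ 2 ≤
      2 * sob (P.h J) 2 u ^ 2 + 2 * ((1 + τ) / P.cu) ^ 2 * sob (P.h J) 0 (P.Nu Q u s) ^ 2 :=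
  hS.etdu.sob_two_sq_le hτ hP.h_pos hP.cu_pos (hP.symbolu_nonneg (g_pos (P := P) Q u s).le)
    (hP.cu_mul_le (g_pos (P := P) Q u s).le)

lemma NonlinearBound.sobT_zero_NQ_le (hB : P.NonlinearBound C Q u s) :
    P.sobT 0 (P.NQ Q u s) ≤ d * d * C ^ 2 := sobT_le_const hB.NQ_le

lemma NonlinearBound.sob_Nu_sq_le (hB : P.NonlinearBound C Q u s) :
    sob (P.h J) 0 (P.Nu Q u s) ^ 2 ≤ C ^ 2 * (2 * (1 + P.sobT 2 Q)) := by
  obtain ⟨W, hW1, hW2, -, hW3⟩ := P.exists_dominating Q le_rfl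
  refine (pow_le_pow_left₀ (apply_nonneg _ _) (hB.Nu_le W hW1 hW2) 2).trans ?_
  rw [mul_pow]
  rw [add_zero] at hW3
  exact mul_le_mul_of_nonneg_left hW3 (sq_nonneg _)

/-- The third-order norm of u is replaced by the fourth-order one because the latter is the
dissipation of the u-equation, hence summable in time. -/
lemma NonlinearBound.sobT_one_NQ_le (hP : P.Admissible d) (hB : P.NonlinearBound C Q u s) :
    P.sobT 1 (P.NQ Q u s) ≤
      d * d * (C ^ 2 * (2 * (1 + (P.sobT 2 Q + sob (P.h J) 4 u ^ 2)))) := by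
  obtain ⟨W, hW1, hW2, hW3, hW4⟩ := P.exists_dominating Q (sq_nonneg (sob (P.h J) 4 u))
  rw [Real.sqrt_sq (apply_nonneg _ _)] at hW3
  refine (sobT_le_const (hB.sob_one_NQ_le W hW1 hW2
    ((sob_mono hP.h_pos (by norm_num) u).trans hW3))).trans ?_
  rw [mul_pow]
  exact mul_le_mul_of_nonneg_left (mul_le_mul_of_nonneg_left hW4 (sq_nonneg _)) (by positivity)

/-- A state bounded in the discrete `H²` norms, with bounded modified energy. -/
structure BoundedState (P : Params) (R : ℝ) (Q : TGrid d J) (u : Grid d J) (s : ℝ) : Prop where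
  symm : ∀ x, (Q x).IsSymm
  Q_le : P.sobT 2 Q ≤ R
  u_le : sob (P.h J) 2 u ^ 2 ≤ R
  energy_le : P.elastic Q u + s ≤ R

lemma BoundedState.mono {R R' : ℝ} (h : P.BoundedState R Q u s) (hR : R ≤ R') :
    P.BoundedState R' Q u s :=
  ⟨h.symm, h.Q_le.trans hR, h.u_le.trans hR, h.energy_le.trans hR⟩

lemma elastic_le (hP : P.Admissible d) (Q : TGrid d J) (u : Grid d J) :
    P.elastic Q u ≤ P.K / 2 * P.sobT 2 Q + P.B₀ * sob (P.h J) 2 u ^ 2 := by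
  have hh := hP.h_pos (J := J)
  have hK := hP.K_pos
  have hB := hP.B₀_pos
  refine add_le_add (mul_le_mul_of_nonneg_left ?_ (by positivity))
    (mul_le_mul_of_nonneg_left ?_ hB.le)
  · refine Finset.sum_le_sum fun i _ => Finset.sum_le_sum fun j _ => ?_
    have h1 := sob_one_sq hh (comp Q i j)
    have h2 := pow_le_pow_left₀ (apply_nonneg _ _) (sob_mono hh one_le_two (comp Q i j)) 2
    linarith [sq_nonneg (sob (P.h J) 0 (comp Q i j))]
  · exact pow_le_pow_left₀ (apply_nonneg _ _) (sob_lap_le hh 0 u) 2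

end StepBounds

/-! ### Propagation of bounds along the scheme -/

section

variable {d J : ℕ} [NeZero J] {P : Params} {τ : ℝ} {Q Q' : TGrid d J} {u u' : Grid d J} {s s' : ℝ}

/-- The energy identity solved for the rate: s cancels between the two sides, the new elastic energy
and the stabilization terms are dropped, and Cauchy–Schwarz bounds the work of H and μ. -/
lemma Step.rate_le (hP : P.Admissible d) (hτ : 0 < τ) (hS : P.Step τ Q u s Q' u' s') :
    P.rate τ Q u s Q' u' ≤ P.elastic Q u
      + (∑ i, ∑ j, P.g Q u s * sob (P.h J) 0 (comp (P.HQ Q u) i j) *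
        (sob (P.h J) 0 (comp Q' i j) + sob (P.h J) 0 (comp Q i j)))
      + P.g Q u s * sob (P.h J) 0 (P.mu Q u) * (sob (P.h J) 0 u' + sob (P.h J) 0 u) := by
  have hh := hP.h_pos (J := J)
  have hγ := (g_pos (P := P) Q u s).le
  have h1 := hS.energy_identity hP hτ
  have h2 := hP.elastic_nonneg Q' u'
  have hκ₁ := hP.κ₁_pos
  have hκ₂ := hP.κ₂_pos
  have h3 : 0 ≤ P.g Q u s * P.κ₁ / 2 * (∑ i, ∑ j, sob (P.h J) 0 (comp (Q' - Q) i j) ^ 2) := by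
    have : 0 ≤ ∑ i, ∑ j, sob (P.h J) 0 (comp (Q' - Q) i j) ^ 2 :=
      Finset.sum_nonneg fun i _ => Finset.sum_nonneg fun j _ => sq_nonneg _
    positivity
  have h4 : 0 ≤ P.g Q u s * P.κ₂ / 2 * sob (P.h J) 0 (u' - u) ^ 2 := by positivity
  have hip : ∀ U V W : Grid d J, -(P.g Q u s * ip (P.h J) U (V - W)) ≤
      P.g Q u s * sob (P.h J) 0 U * (sob (P.h J) 0 V + sob (P.h J) 0 W) := by
    intro U V W
    have h5 := (neg_le_abs (ip (P.h J) U (V - W))).trans (abs_ip_le hh U (V - W))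
    have h6 := mul_le_mul_of_nonneg_left (map_sub_le_add (sob (d := d) (J := J) (P.h J) 0) V W)
      (apply_nonneg (sob (d := d) (J := J) (P.h J) 0) U)
    have h7 := mul_le_mul_of_nonneg_left (h5.trans h6) hγ
    linarith
  have h8 : -(P.g Q u s * ipT (P.h J) (P.HQ Q u) (Q' - Q)) ≤
      ∑ i, ∑ j, P.g Q u s * sob (P.h J) 0 (comp (P.HQ Q u) i j) *
        (sob (P.h J) 0 (comp Q' i j) + sob (P.h J) 0 (comp Q i j)) := by
    rw [ipT, Finset.mul_sum, ← Finset.sum_neg_distrib]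
    refine Finset.sum_le_sum fun i _ => ?_
    rw [Finset.mul_sum, ← Finset.sum_neg_distrib]
    exact Finset.sum_le_sum fun j _ => hip _ _ _
  have h9 := hip (P.mu Q u) u' u
  have h10 : P.sTilde Q u s Q' u' = s + P.g Q u s * ipT (P.h J) (P.HQ Q u) (Q' - Q)
      + P.g Q u s * ip (P.h J) (P.mu Q u) (u' - u) := by
    rw [sTilde]
    ring
  linarith

/-- Serves large time steps, where η₀τ may exceed 1 and relaxation may raise the modified energy.
The rise is at most T times the rate, which is bounded separately. -/
lemma Step.energy_le_add (hP : P.Admissible d) {T : ℝ} (hτ : 0 < τ) (hτT : τ ≤ T)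
    (hS : P.Step τ Q u s Q' u' s') :
    P.elastic Q' u' + s' ≤ P.elastic Q u + s + T * P.rate τ Q u s Q' u' := by
  have h1 := hS.energy_identity hP hτ
  obtain ⟨ξ, _, _, h2⟩ := hS.s_eq
  have h3 := hP.rate_nonneg hτ Q Q' u u' s
  have h4 := hP.η₀_mem
  have hγ := (g_pos (P := P) Q u s).le
  have hκ₁ := hP.κ₁_pos
  have hκ₂ := hP.κ₂_pos
  have h5 : 0 ≤ P.g Q u s * P.κ₁ / 2 * (∑ i, ∑ j, sob (P.h J) 0 (comp (Q' - Q) i j) ^ 2) := by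
    have : 0 ≤ ∑ i, ∑ j, sob (P.h J) 0 (comp (Q' - Q) i j) ^ 2 :=
      Finset.sum_nonneg fun i _ => Finset.sum_nonneg fun j _ => sq_nonneg _
    positivity
  have h6 : 0 ≤ P.g Q u s * P.κ₂ / 2 * sob (P.h J) 0 (u' - u) ^ 2 := by positivity
  have h7 : P.η₀ * τ ≤ T := by
    have := mul_le_mul_of_nonneg_right h4.2 hτ.le
    linarith
  have h8 := mul_le_mul_of_nonneg_right h7 h3
  linarith

end

/-- A single step maps bounded states to bounded states. -/
lemma exists_boundedState_step {d : ℕ} {P : Params} (hd : 0 < d) (hP : P.Admissible d) {S : ℝ}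
    (hS : SobolevConst d P.L S) (T R : ℝ) : ∃ R' : ℝ,
      ∀ (J : ℕ) [NeZero J] (τ : ℝ) (Q Q' : TGrid d J) (u u' : Grid d J) (s s' : ℝ),
        0 < τ → τ ≤ T → P.BoundedState R Q u s → P.Step τ Q u s Q' u' s' →
          P.BoundedState R' Q' u' s' := by
  obtain ⟨C, hC0, hC⟩ := exists_nonlinearBound hd hP hS R
  have hcQ := hP.cQ_pos
  have hcu := hP.cu_pos
  have hK := hP.K_pos
  have hB₀ := hP.B₀_pos
  set R₁ := 2 * R + 2 * ((1 + T) / P.cQ) ^ 2 * (d * d * C ^ 2) with hR₁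
  set R₂ := 2 * R + 2 * ((1 + T) / P.cu) ^ 2 * (C ^ 2 * (2 * (1 + R))) with hR₂
  set E := P.K / 2 * R + P.B₀ * R + d * d * (C * (2 + R₁ + R)) + C * (1 + R) * (2 + R₂ + R) with hE
  refine ⟨max (max R₁ R₂) (R + T * E), fun J _ τ Q Q' u u' s s' hτ hτT hB hst => ?_⟩
  have hh := hP.h_pos (J := J)
  have hN := hC J Q u s hB.symm hB.energy_le
  have hR0 : 0 ≤ R := (P.sobT_nonneg 2 Q).trans hB.Q_le
  have hQ' : P.sobT 2 Q' ≤ R₁ := by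
    refine (hst.sobT_jump_le hP hτ).trans ?_
    have h1 := hB.Q_le
    have h2 := hN.sobT_zero_NQ_le
    have h3 := P.sobT_nonneg 0 (P.NQ Q u s)
    rw [hR₁]
    gcongr
  have hu' : sob (P.h J) 2 u' ^ 2 ≤ R₂ := by
    refine (hst.sob_u_jump_le hP hτ).trans ?_
    have h1 := hB.u_le
    have h2 : sob (P.h J) 0 (P.Nu Q u s) ^ 2 ≤ C ^ 2 * (2 * (1 + R)) :=
      hN.sob_Nu_sq_le.trans (by have := hB.Q_le; gcongr)
    rw [hR₂]
    gcongr
  -- From x ≤ 1 + x²; this avoids square roots in the constants.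
  have hself : ∀ {x b : ℝ}, x ^ 2 ≤ b → x ≤ 1 + b := fun {x b} h => by
    nlinarith [sq_nonneg (x - 1)]
  have hcomp : ∀ {Φ : TGrid d J} {b : ℝ}, P.sobT 2 Φ ≤ b → ∀ i j,
      sob (P.h J) 2 (comp Φ i j) ≤ 1 + b := fun h i j =>
    hself ((P.sob_sq_le_sobT 2 _ i j).trans h)
  have hsob0 : ∀ {U : Grid d J} {b : ℝ}, sob (P.h J) 2 U ≤ b → sob (P.h J) 0 U ≤ b :=
    fun h => (sob_mono hh (Nat.zero_le 2) _).trans h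
  have hrate : P.rate τ Q u s Q' u' ≤ E := by
    refine (hst.rate_le hP hτ).trans ?_
    refine add_le_add (add_le_add ((elastic_le hP Q u).trans ?_) ?_) ?_
    · have h1 := hB.Q_le
      have h2 := hB.u_le
      gcongr
    · have h1 : ∀ i j, P.g Q u s * sob (P.h J) 0 (comp (P.HQ Q u) i j) *
          (sob (P.h J) 0 (comp Q' i j) + sob (P.h J) 0 (comp Q i j)) ≤ C * (2 + R₁ + R) := by
        intro i j
        refine mul_le_mul (hN.HQ_le i j) ?_ (add_nonneg (apply_nonneg _ _) (apply_nonneg _ _)) hC0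
        linarith [hsob0 (hcomp hQ' i j), hsob0 (hcomp hB.Q_le i j)]
      refine (Finset.sum_le_sum fun i _ => Finset.sum_le_sum fun j _ => h1 i j).trans
        (le_of_eq ?_)
      simp only [Finset.sum_const, Finset.card_univ, Fintype.card_fin, nsmul_eq_mul]
      ring
    · refine mul_le_mul (hN.mu_le (1 + R) (by linarith) (hcomp hB.Q_le)) ?_
        (add_nonneg (apply_nonneg _ _) (apply_nonneg _ _)) (by positivity)
      linarith [hsob0 (hself hu'), hsob0 (hself hB.u_le)]
  refine ⟨hst.symm hB.symm, hQ'.trans ((le_max_left _ _).trans (le_max_left _ _)),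
    hu'.trans ((le_max_right _ _).trans (le_max_left _ _)), ?_⟩
  refine (hst.energy_le_add hP hτ hτT).trans (le_trans ?_ (le_max_right _ _))
  have := mul_le_mul_of_nonneg_left hrate (hτ.le.trans hτT)
  linarith [hB.energy_le]

/-- The numerical solutions stay bounded over any fixed number of steps. -/
lemma exists_boundedState_iterate {d : ℕ} {P : Params} (hd : 0 < d) (hP : P.Admissible d) {S : ℝ}
    (hS : SobolevConst d P.L S) (T R : ℝ) (n : ℕ) : ∃ M : ℝ,
      ∀ (J : ℕ) [NeZero J] (τ : ℝ) (N : ℕ) (Q : ℕ → TGrid d J) (u : ℕ → Grid d J) (s : ℕ → ℝ),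
        0 < τ → τ ≤ T → P.BoundedState R (Q 0) (u 0) (s 0) →
          (∀ n < N, P.Step τ (Q n) (u n) (s n) (Q (n + 1)) (u (n + 1)) (s (n + 1))) →
          ∀ k ≤ N, k ≤ n → P.BoundedState M (Q k) (u k) (s k) := by
  induction n with
  | zero =>
    refine ⟨R, fun J _ τ N Q u s _ _ h0 _ k _ hk => ?_⟩
    obtain rfl : k = 0 := by omega
    exact h0
  | succ n ih =>
    obtain ⟨M, hM⟩ := ih
    obtain ⟨M', hM'⟩ := exists_boundedState_step hd hP hS T M
    refine ⟨max M M', fun J _ τ N Q u s hτ hτT h0 hst k hkN hk => ?_⟩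
    rcases Nat.lt_or_ge n k with h | h
    · obtain rfl : k = n + 1 := by omega
      exact (hM' J τ _ _ _ _ _ _ hτ hτT (hM J τ N Q u s hτ hτT h0 hst n (by omega) le_rfl)
        (hst n (by omega))).mono (le_max_right _ _)
    · exact (hM J τ N Q u s hτ hτT h0 hst k hkN h).mono (le_max_left _ _)

/-- For time steps at most one the bounds hold uniformly on `[0, T]`. -/
lemma exists_boundedState_of_le_one {d : ℕ} {P : Params} (hd : 0 < d) (hP : P.Admissible d) {S : ℝ}
    (hS : SobolevConst d P.L S) (T R : ℝ) : ∃ M : ℝ,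
      ∀ (J : ℕ) [NeZero J] (τ : ℝ) (N : ℕ) (Q : ℕ → TGrid d J) (u : ℕ → Grid d J) (s : ℕ → ℝ),
        0 < τ → τ ≤ 1 → N * τ ≤ T → P.BoundedState R (Q 0) (u 0) (s 0) →
          (∀ n < N, P.Step τ (Q n) (u n) (s n) (Q (n + 1)) (u (n + 1)) (s (n + 1))) →
          ∀ n ≤ N, P.BoundedState M (Q n) (u n) (s n) := by
  obtain ⟨C, hC0, hC⟩ := exists_nonlinearBound hd hP hS R
  have hcQ := hP.cQ_pos
  have hcu := hP.cu_pos
  set X := Real.exp (2 * T) with hX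
  have hX0 : 0 < X := Real.exp_pos _
  set k₁ := 4 / P.cQ * (d * d * C ^ 2) with hk₁
  set B₁ := X * (R + T * k₁) / P.cQ with hB₁
  set k₂ := 4 / P.cu * (C ^ 2 * 2) with hk₂
  set B₂ := X * (R + k₂ * (T + R + B₁)) with hB₂
  set k₃ := 4 / P.cQ * (d * d * (C ^ 2 * 2)) with hk₃
  set R₁ := 2 * R + 2 * ((1 + 1) / P.cQ) ^ 2 * (d * d * C ^ 2) with hR₁
  set B₃ := X * (R₁ + k₃ * (T + B₁ + B₂ / P.cu)) with hB₃
  refine ⟨max (max R B₂) B₃, fun J _ τ N Q u s hτ hτ1 hNT h0 hst => ?_⟩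
  have hh := hP.h_pos (J := J)
  have hR0 : 0 ≤ R := (P.sobT_nonneg 2 _).trans h0.Q_le
  have hsym : ∀ n ≤ N, ∀ x, (Q n x).IsSymm := by
    intro n
    induction n with
    | zero => exact fun _ => h0.symm
    | succ n ih => exact fun hn => (hst n (by omega)).symm (ih (by omega))
  have hen : ∀ n ≤ N, P.elastic (Q n) (u n) + s n ≤ R := by
    intro n
    induction n with
    | zero => exact fun _ => h0.energy_le
    | succ n ih => exact fun hn => ((hst n (by omega)).energy_le hP hτ hτ1).trans (ih (by omega))
  have hN : ∀ n ≤ N, P.NonlinearBound C (Q n) (u n) (s n) := fun n hn =>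
    hC J _ _ _ (hsym n hn) (hen n hn)
  have hnT : ∀ n ≤ N, (n : ℝ) * τ ≤ T := fun n hn =>
    (mul_le_mul_of_nonneg_right (Nat.cast_le.mpr hn) hτ.le).trans hNT
  have hexp : ∀ n ≤ N, Real.exp (2 * (n * τ)) ≤ X := fun n hn =>
    Real.exp_le_exp.mpr (by linarith [hnT n hn])
  have hk₁0 : 0 ≤ k₁ := by positivity
  have hk₂0 : 0 ≤ k₂ := by positivity
  have hk₃0 : 0 ≤ k₃ := by positivity
  -- summability of the second differences of `Q`
  have s₁ : ∀ n ≤ N, τ * ∑ k ∈ Finset.range n, P.sobT 2 (Q (k + 1)) ≤ B₁ := by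
    intro n hn
    have h1 := discrete_gronwall (N := N) (y := fun n => P.sobT 1 (Q n))
      (D := fun n => P.cQ * P.sobT 2 (Q (n + 1))) (F := fun _ => k₁) hτ (P.sobT_nonneg 1 _)
      (fun n => mul_nonneg hcQ.le (P.sobT_nonneg 2 _)) (fun _ => hk₁0) (fun n hn => by
        refine ((hst n hn).sobT_add_le hP hτ 0).trans ?_
        have := (hN n hn.le).sobT_zero_NQ_le
        refine mul_le_mul_of_nonneg_left (add_le_add le_rfl
          (mul_le_mul_of_nonneg_left ?_ hτ.le)) (by positivity)
        exact mul_le_mul_of_nonneg_left this (by positivity)) n hn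
    simp only [Finset.sum_const, Finset.card_range, nsmul_eq_mul, ← Finset.mul_sum] at h1
    have h2 : P.sobT 1 (Q 0) ≤ R := le_trans (Finset.sum_le_sum fun i _ =>
      Finset.sum_le_sum fun j _ => pow_le_pow_left₀ (apply_nonneg _ _)
        (sob_mono hh one_le_two _) 2) h0.Q_le
    have h3 : Real.exp (2 * (n * τ)) * (P.sobT 1 (Q 0) + τ * (n * k₁)) ≤ X * (R + T * k₁) := by
      refine mul_le_mul (hexp n hn) (add_le_add h2 ?_) (add_nonneg (P.sobT_nonneg 1 _)
        (by positivity)) hX0.le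
      have := mul_le_mul_of_nonneg_right (hnT n hn) hk₁0
      linarith
    rw [hB₁, le_div_iff₀ hcQ]
    linarith [P.sobT_nonneg 1 (Q n)]
  -- The forcing of the u-equation is explicit, so the sum has to start at Q⁰; the added term τ‖Q⁰‖²
  -- is harmless for τ ≤ 1.
  have s₁' : ∀ n ≤ N, τ * ∑ k ∈ Finset.range n, P.sobT 2 (Q k) ≤ R + B₁ := by
    intro n hn
    have h1 : ∑ k ∈ Finset.range n, P.sobT 2 (Q k) ≤
        P.sobT 2 (Q 0) + ∑ k ∈ Finset.range n, P.sobT 2 (Q (k + 1)) := by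
      rw [add_comm, ← Finset.sum_range_succ' (fun k => P.sobT 2 (Q k)), Finset.sum_range_succ]
      linarith [P.sobT_nonneg 2 (Q n)]
    have h2 := mul_le_mul_of_nonneg_left h1 hτ.le
    have h3 : τ * P.sobT 2 (Q 0) ≤ 1 * R :=
      mul_le_mul hτ1 h0.Q_le (P.sobT_nonneg 2 _) zero_le_one
    linarith [s₁ n hn]
  -- Now ‖N_u‖² ≤ C(1 + ‖Q‖²_{H²}) is summable in time, and Gronwall bounds u in H² and sums its H⁴
  -- norms.
  have s₂ : ∀ n ≤ N, sob (P.h J) 2 (u n) ^ 2 +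
      τ * ∑ k ∈ Finset.range n, P.cu * sob (P.h J) 4 (u (k + 1)) ^ 2 ≤ B₂ := by
    intro n hn
    have h1 := discrete_gronwall (N := N) (y := fun n => sob (P.h J) 2 (u n) ^ 2)
      (D := fun n => P.cu * sob (P.h J) 4 (u (n + 1)) ^ 2) (F := fun n => k₂ * (1 + P.sobT 2 (Q n)))
      hτ (sq_nonneg _) (fun n => mul_nonneg hcu.le (sq_nonneg _))
      (fun n => mul_nonneg hk₂0 (by linarith [P.sobT_nonneg 2 (Q n)])) (fun n hn => by
        refine ((hst n hn).sob_u_add_le hP hτ).trans ?_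
        have h2 := (hN n hn.le).sob_Nu_sq_le
        refine mul_le_mul_of_nonneg_left (add_le_add le_rfl
          (mul_le_mul_of_nonneg_left ?_ hτ.le)) (by positivity)
        refine (mul_le_mul_of_nonneg_left h2 (by positivity)).trans (le_of_eq ?_)
        rw [hk₂]
        ring) n hn
    refine h1.trans ?_
    simp only [← Finset.mul_sum, Finset.sum_add_distrib, Finset.sum_const, Finset.card_range,
      nsmul_eq_mul, mul_one]
    have h3 : τ * (k₂ * (n + ∑ k ∈ Finset.range n, P.sobT 2 (Q k))) ≤ k₂ * (T + R + B₁) := by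
      have h4 : n * τ + τ * ∑ k ∈ Finset.range n, P.sobT 2 (Q k) ≤ T + R + B₁ := by
        linarith [hnT n hn, s₁' n hn]
      refine le_trans (le_of_eq ?_) (mul_le_mul_of_nonneg_left h4 hk₂0)
      ring
    refine mul_le_mul (hexp n hn) (add_le_add h0.u_le h3) (add_nonneg (sq_nonneg _) ?_) hX0.le
    exact mul_nonneg hτ.le (mul_nonneg hk₂0 (add_nonneg (Nat.cast_nonneg _)
      (Finset.sum_nonneg fun _ _ => P.sobT_nonneg 2 _)))
  -- The H² estimate for Q starts at n = 1: its forcing involves ‖u‖_{H⁴}, whose sum is controlled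
  -- only from u¹ on. The dissipation of this third estimate is discarded.
  have s₃ : ∀ n, n + 1 ≤ N → P.sobT 2 (Q (n + 1)) ≤ B₃ := by
    intro n hn
    have h1 := discrete_gronwall (N := N - 1) (y := fun n => P.sobT 2 (Q (n + 1)))
      (D := fun _ => 0)
      (F := fun n => k₃ * (1 + (P.sobT 2 (Q (n + 1)) + sob (P.h J) 4 (u (n + 1)) ^ 2)))
      hτ (P.sobT_nonneg 2 _) (fun n => le_rfl)
      (fun n => mul_nonneg hk₃0 (by
        have := P.sobT_nonneg 2 (Q (n + 1))
        positivity)) (fun n hn => by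
        have h2 := (hst (n + 1) (by omega)).sobT_add_le hP hτ 1
        have h3 := mul_nonneg hτ.le (mul_nonneg hcQ.le (P.sobT_nonneg (2 + 1) (Q (n + 1 + 1))))
        refine (le_trans (by simpa using h3) h2).trans ?_
        have h4 := (hN (n + 1) (by omega)).sobT_one_NQ_le hP
        refine mul_le_mul_of_nonneg_left (add_le_add le_rfl
          (mul_le_mul_of_nonneg_left ?_ hτ.le)) (by positivity)
        refine (mul_le_mul_of_nonneg_left h4 (by positivity)).trans (le_of_eq ?_)
        rw [hk₃]
        ring) n (by omega)
    simp only [Finset.sum_const_zero, mul_zero, add_zero] at h1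
    refine h1.trans ?_
    simp only [← Finset.mul_sum, Finset.sum_add_distrib, Finset.sum_const, Finset.card_range,
      nsmul_eq_mul, mul_one]
    have hu4 : τ * ∑ k ∈ Finset.range n, sob (P.h J) 4 (u (k + 1)) ^ 2 ≤ B₂ / P.cu := by
      rw [le_div_iff₀ hcu]
      have := s₂ n (by omega)
      rw [← Finset.mul_sum] at this
      linarith [sq_nonneg (sob (P.h J) 2 (u n))]
    have h3 : τ * (k₃ * (n + (∑ k ∈ Finset.range n, P.sobT 2 (Q (k + 1)) +
        ∑ k ∈ Finset.range n, sob (P.h J) 4 (u (k + 1)) ^ 2))) ≤ k₃ * (T + B₁ + B₂ / P.cu) := by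
      have h4 : n * τ + (τ * ∑ k ∈ Finset.range n, P.sobT 2 (Q (k + 1)) +
          τ * ∑ k ∈ Finset.range n, sob (P.h J) 4 (u (k + 1)) ^ 2) ≤ T + B₁ + B₂ / P.cu := by
        linarith [hnT n (by omega), s₁ n (by omega)]
      refine le_trans (le_of_eq ?_) (mul_le_mul_of_nonneg_left h4 hk₃0)
      ring
    -- The first step is crossed by the jump estimate, which needs only an ℓ² bound on N_Q.
    have hjump : P.sobT 2 (Q 1) ≤ R₁ := by
      refine ((hst 0 (by omega)).sobT_jump_le hP hτ).trans ?_
      have h1 := h0.Q_le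
      have h2 := (hN 0 (by omega)).sobT_zero_NQ_le
      have h3 := P.sobT_nonneg 0 (P.NQ (Q 0) (u 0) (s 0))
      rw [hR₁]
      gcongr
    refine mul_le_mul (hexp n (by omega)) (add_le_add hjump h3)
      (add_nonneg (P.sobT_nonneg 2 _) ?_) hX0.le
    exact mul_nonneg hτ.le (mul_nonneg hk₃0 (add_nonneg (Nat.cast_nonneg _) (add_nonneg
      (Finset.sum_nonneg fun _ _ => P.sobT_nonneg 2 _)
      (Finset.sum_nonneg fun _ _ => sq_nonneg _))))
  intro n hn
  refine ⟨hsym n hn, ?_, ?_, (hen n hn).trans ((le_max_left _ _).trans (le_max_left _ _))⟩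
  · cases n with
    | zero => exact h0.Q_le.trans ((le_max_left _ _).trans (le_max_left _ _))
    | succ n => exact (s₃ n hn).trans (le_max_right _ _)
  · have h1 := s₂ n hn
    have h2 : 0 ≤ τ * ∑ k ∈ Finset.range n, P.cu * sob (P.h J) 4 (u (k + 1)) ^ 2 :=
      mul_nonneg hτ.le (Finset.sum_nonneg fun k _ => mul_nonneg hcu.le (sq_nonneg _))
    exact (by linarith : _ ≤ B₂).trans ((le_max_right _ _).trans (le_max_left _ _))

/-- Uniform bounds for all time steps. -/
theorem exists_boundedState {d : ℕ} {P : Params} (hd : 0 < d) (hP : P.Admissible d) {S : ℝ}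
    (hS : SobolevConst d P.L S) (T R : ℝ) : ∃ M : ℝ,
      ∀ (J : ℕ) [NeZero J] (τ : ℝ) (N : ℕ) (Q : ℕ → TGrid d J) (u : ℕ → Grid d J) (s : ℕ → ℝ),
        0 < τ → N * τ ≤ T → P.BoundedState R (Q 0) (u 0) (s 0) →
          (∀ n < N, P.Step τ (Q n) (u n) (s n) (Q (n + 1)) (u (n + 1)) (s (n + 1))) →
          ∀ n ≤ N, P.BoundedState M (Q n) (u n) (s n) := by
  obtain ⟨M₁, hM₁⟩ := exists_boundedState_of_le_one hd hP hS T R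
  obtain ⟨M₂, hM₂⟩ := exists_boundedState_iterate hd hP hS T R ⌈T⌉₊
  refine ⟨max R (max M₁ M₂), fun J _ τ N Q u s hτ hNT h0 hst n hn => ?_⟩
  rcases le_or_gt τ 1 with h1 | h1
  · exact (hM₁ J τ N Q u s hτ h1 hNT h0 hst n hn).mono ((le_max_left _ _).trans (le_max_right _ _))
  -- For τ > 1 the bound Nτ ≤ T forces N ≤ T, so the number of steps is bounded independently of the
  -- mesh and of τ.
  · cases n with
    | zero => exact h0.mono (le_max_left _ _)
    | succ n =>
      have h2 : (1 : ℝ) ≤ N := by exact_mod_cast (by omega : 1 ≤ N)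
      have h3 : τ ≤ T := (le_mul_of_one_le_left hτ.le h2).trans hNT
      have h4 : (N : ℝ) ≤ T := (le_mul_of_one_le_right (Nat.cast_nonneg N) h1.le).trans hNT
      have h5 : N ≤ ⌈T⌉₊ := by exact_mod_cast h4.trans (Nat.le_ceil T)
      exact (hM₂ J τ N Q u s hτ h3 h0 hst (n + 1) hn (hn.trans h5)).mono
        ((le_max_right _ _).trans (le_max_right _ _))

end Params

/-! ### Fourier coefficients of periodic functions on the cube -/

open MeasureTheory

section Torus

variable {d : ℕ}

/-- The normalized Haar measure on the unit circle, as used for Fourier series on the torus. -/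
local instance haarMeasureSpace : MeasureSpace UnitAddCircle := ⟨AddCircle.haarAddCircle⟩

/-- The representative in `(0, L]^d` of a point of the torus. -/
def torusRep (d : ℕ) (L : ℝ) (t : UnitAddTorus (Fin d)) : Fin d → ℝ :=
  L • fun i => ((AddCircle.equivIoc (1 : ℝ) 0 (t i) : Set.Ioc (0 : ℝ) (0 + 1)) : ℝ)

/-- The normalized Lebesgue measure of the cell. -/
def cellMeasure (d : ℕ) (L : ℝ) : Measure (Fin d → ℝ) :=
  ENNReal.ofReal ((L ^ d)⁻¹) • volume.restrict (cell d L)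

/-- Lebesgue measure on (0, 1]^d, dilated by L, becomes L^(-d) times Lebesgue measure on (0, L]^d,
which differs from the closed cell by a null set. -/
lemma measurePreserving_torusRep {L : ℝ} (hL : 0 < L) :
    MeasurePreserving (torusRep d L) volume (cellMeasure d L) := by
  have h1 := UnitAddTorus.measurePreserving_equivPiIoc (d := Fin d) (fun _ => (0 : ℝ))
  set box : Set (Fin d → ℝ) := {x | ∀ i, x i ∈ Set.Ioc (0 : ℝ) (0 + 1)} with hbox
  have hboxm : MeasurableSet box := MeasurableSet.univ_pi' fun i => measurableSet_Ioc
  have h2 : MeasurePreserving (Subtype.val : box → Fin d → ℝ) (Measure.comap Subtype.val volume)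
      (volume.restrict box) := ⟨measurable_subtype_coe, map_comap_subtype_coe hboxm volume⟩
  have h3 : MeasurePreserving (fun x : Fin d → ℝ => L • x) (volume.restrict box)
      (cellMeasure d L) := by
    refine ⟨measurable_const_smul L, ?_⟩
    set boxL : Set (Fin d → ℝ) := Set.pi Set.univ fun _ => Set.Ioc (0 : ℝ) L with hboxL
    have hpre : (fun x : Fin d → ℝ => L • x) ⁻¹' boxL = box := by
      ext x
      simp only [hboxL, hbox, Set.mem_preimage, Set.mem_pi, Set.mem_univ, true_imp_iff,
        Pi.smul_apply, smul_eq_mul, Set.mem_Ioc, zero_add, Set.mem_ofPred_eq]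
      refine forall_congr' fun i => ?_
      rw [mul_pos_iff_of_pos_left hL, mul_le_iff_le_one_right hL]
    rw [← hpre, ← Measure.restrict_map (measurable_const_smul L)
      (MeasurableSet.univ_pi fun i => measurableSet_Ioc), Measure.map_addHaar_smul _ hL.ne',
      Measure.restrict_smul, cellMeasure]
    have h4 : boxL =ᵐ[volume] cell d L := Measure.univ_pi_Ioc_ae_eq_Icc
    rw [Measure.restrict_congr_set h4, abs_of_pos (by positivity)]
    simp
  exact h3.comp (h2.comp h1)

/-- The quotient map onto the torus. -/
def torusMk (x : Fin d → ℝ) : UnitAddTorus (Fin d) := fun i => (x i : UnitAddCircle)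

lemma isOpenQuotientMap_torusMk : IsOpenQuotientMap (torusMk (d := d)) :=
  IsOpenQuotientMap.piMap (f := fun (_ : Fin d) (x : ℝ) => (x : UnitAddCircle)) fun _ =>
    QuotientAddGroup.isOpenQuotientMap_mk

lemma IsPer.add_int {L : ℝ} {f : (Fin d → ℝ) → ℝ} (hf : IsPer L f) (n : Fin d → ℤ)
    (x : Fin d → ℝ) : f (x + L • fun i => (n i : ℝ)) = f x := by
  have h1 : ∀ s : Finset (Fin d), ∀ x, f (x + ∑ k ∈ s, n k • Pi.single k L) = f x := by
    intro s
    induction s using Finset.induction_on with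
    | empty => simp
    | insert k s hk ih =>
      intro x
      have hper : Function.Periodic f (Pi.single k L) := fun x => hf x k
      rw [Finset.sum_insert hk, add_comm (n k • _), ← add_assoc, hper.zsmul (n k), ih]
  have h2 : (L • fun i => (n i : ℝ)) = ∑ k, n k • (Pi.single k L : Fin d → ℝ) := by
    ext i
    simp [Finset.sum_apply, Pi.single_apply, mul_comm]
  rw [h2, h1]

lemma comp_torusRep_torusMk {L : ℝ} {f : (Fin d → ℝ) → ℝ} (hf : IsPer L f) (x : Fin d → ℝ) :
    f (torusRep d L (torusMk x)) = f (L • x) := by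
  have h1 : ∀ i, ∃ n : ℤ, ((AddCircle.equivIoc (1 : ℝ) 0 ((x i : ℝ) : UnitAddCircle) :
      Set.Ioc (0 : ℝ) (0 + 1)) : ℝ) = x i + n := by
    intro i
    have h2 := AddCircle.coe_equivIoc (p := (1 : ℝ)) (a := 0) (y := ((x i : ℝ) : UnitAddCircle))
    rw [← sub_eq_zero, ← AddCircle.coe_sub, AddCircle.coe_eq_zero_iff] at h2
    obtain ⟨n, hn⟩ := h2
    refine ⟨n, ?_⟩
    rw [zsmul_eq_mul, mul_one] at hn
    linarith
  choose n hn using h1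
  rw [← hf.add_int n (L • x), ← smul_add]
  congr 1
  rw [torusRep]
  congr 1
  ext i
  exact hn i

/-- The representative itself jumps across the faces of the cell. Periodicity hides the jump: after
composition with the open quotient map the function is x ↦ f(Lx). -/
lemma continuous_comp_torusRep {L : ℝ} {f : (Fin d → ℝ) → ℝ} (hf : IsPer L f)
    (hc : Continuous f) : Continuous fun t => f (torusRep d L t) := by
  rw [← isOpenQuotientMap_torusMk.continuous_comp_iff]
  have : (fun t => f (torusRep d L t)) ∘ torusMk = fun x => f (L • x) :=
    funext fun x => comp_torusRep_torusMk hf x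
  rw [this]
  fun_prop

/-- The phase `2π m·x / L`. -/
def phase (L : ℝ) (m : Fin d → ℤ) (x : Fin d → ℝ) : ℝ := 2 * Real.pi / L * ∑ i, m i * x i

/-- The cosine coefficient of a function on the cell. -/
def cosCoeff (L : ℝ) (m : Fin d → ℤ) (f : (Fin d → ℝ) → ℝ) : ℝ :=
  ∫ x in cell d L, f x * Real.cos (phase L m x)

/-- The sine coefficient of a function on the cell. -/
def sinCoeff (L : ℝ) (m : Fin d → ℤ) (f : (Fin d → ℝ) → ℝ) : ℝ :=
  ∫ x in cell d L, f x * Real.sin (phase L m x)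

lemma mFourier_torusMk (m : Fin d → ℤ) (x : Fin d → ℝ) :
    UnitAddTorus.mFourier m (torusMk x) = Complex.exp (Complex.I * (2 * Real.pi * ∑ i, m i * x i)) := by
  simp only [UnitAddTorus.mFourier, ContinuousMap.coe_mk, torusMk, fourier_coe_apply]
  rw [← Complex.exp_sum]
  congr 1
  push_cast
  rw [Finset.mul_sum, Finset.mul_sum]
  refine Finset.sum_congr rfl fun i _ => ?_
  ring

lemma torusMk_torusRep {L : ℝ} (hL : 0 < L) (t : UnitAddTorus (Fin d)) :
    torusMk (L⁻¹ • torusRep d L t) = t := by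
  funext i
  simp only [torusMk, torusRep, smul_smul, inv_mul_cancel₀ hL.ne', one_smul]
  exact AddCircle.coe_equivIoc

lemma mFourier_neg_eq {L : ℝ} (hL : 0 < L) (m : Fin d → ℤ) (t : UnitAddTorus (Fin d)) :
    UnitAddTorus.mFourier (-m) t = (Real.cos (phase L m (torusRep d L t)) : ℂ)
      - Real.sin (phase L m (torusRep d L t)) * Complex.I := by
  conv_lhs => rw [← torusMk_torusRep hL t, mFourier_torusMk]
  set y := torusRep d L t
  have h1 : (Complex.I * (2 * Real.pi * ∑ i, ((-m) i : ℤ) * ((L⁻¹ • y) i : ℝ)) : ℂ)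
      = ((-phase L m y : ℝ) : ℂ) * Complex.I := by
    simp only [phase, Pi.neg_apply, Pi.smul_apply, smul_eq_mul]
    push_cast
    rw [Finset.mul_sum, Finset.mul_sum, Finset.mul_sum, neg_mul, Finset.sum_mul,
      ← Finset.sum_neg_distrib]
    refine Finset.sum_congr rfl fun i _ => ?_
    field_simp
  rw [h1, Complex.exp_mul_I, Complex.ofReal_neg, Complex.cos_neg, Complex.sin_neg,
    Complex.ofReal_cos, Complex.ofReal_sin]
  ring

lemma continuous_phase (L : ℝ) (m : Fin d → ℤ) : Continuous (phase L m) := by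
  unfold phase
  fun_prop

lemma mFourierCoeff_comp_torusRep {L : ℝ} (hL : 0 < L) {g : (Fin d → ℝ) → ℝ}
    (hg : MemLp g 2 (volume.restrict (cell d L))) (m : Fin d → ℤ) :
    UnitAddTorus.mFourierCoeff (fun t => (g (torusRep d L t) : ℂ)) m =
      ((L ^ d)⁻¹ : ℝ) * ((cosCoeff L m g : ℂ) - sinCoeff L m g * Complex.I) := by
  have hfin : IsFiniteMeasure (volume.restrict (cell d L)) :=
    ⟨by rw [Measure.restrict_apply_univ]; exact isCompact_Icc.measure_lt_top⟩
  have hgi : Integrable g (volume.restrict (cell d L)) := hg.integrable one_le_two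
  have hc : Integrable (fun x => g x * Real.cos (phase L m x)) (volume.restrict (cell d L)) := by
    refine hgi.mul_bdd (c := 1) ?_ ?_
    · exact (Real.continuous_cos.comp (continuous_phase L m)).aestronglyMeasurable
    · exact Filter.Eventually.of_forall fun x => Real.abs_cos_le_one _
  have hs : Integrable (fun x => g x * Real.sin (phase L m x)) (volume.restrict (cell d L)) := by
    refine hgi.mul_bdd (c := 1) ?_ ?_
    · exact (Real.continuous_sin.comp (continuous_phase L m)).aestronglyMeasurable
    · exact Filter.Eventually.of_forall fun x => Real.abs_sin_le_one _
  have hc' : Integrable (fun x => ((g x * Real.cos (phase L m x) : ℝ) : ℂ))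
      (volume.restrict (cell d L)) := hc.ofReal
  have hs' : Integrable (fun x => ((g x * Real.sin (phase L m x) : ℝ) : ℂ))
      (volume.restrict (cell d L)) := hs.ofReal
  set G : (Fin d → ℝ) → ℂ := fun x => ((g x * Real.cos (phase L m x) : ℝ) : ℂ)
    - ((g x * Real.sin (phase L m x) : ℝ) : ℂ) * Complex.I with hG
  have h1 : ∀ t, UnitAddTorus.mFourier (-m) t • (g (torusRep d L t) : ℂ) = G (torusRep d L t) := by
    intro t
    rw [hG]
    rw [mFourier_neg_eq hL, smul_eq_mul]
    push_cast
    ring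
  have h2 := measurePreserving_torusRep (d := d) hL
  unfold UnitAddTorus.mFourierCoeff
  simp_rw [h1]
  have h3 : AEStronglyMeasurable G (cellMeasure d L) := by
    refine AEStronglyMeasurable.smul_measure ?_ _
    exact (hc'.sub (hs'.mul_const _)).aestronglyMeasurable
  rw [← integral_map h2.measurable.aemeasurable (by rw [h2.map_eq]; exact h3), h2.map_eq,
    cellMeasure, integral_smul_measure, integral_sub hc' (hs'.mul_const _),
    integral_mul_const, integral_complex_ofReal, integral_complex_ofReal, ENNReal.toReal_ofReal (by positivity)]
  rw [Complex.real_smul]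
  rfl

/-- Bessel's inequality on the cell. -/
lemma summable_sq_coeff {L : ℝ} (hL : 0 < L) {g : (Fin d → ℝ) → ℝ}
    (hg : MemLp g 2 (volume.restrict (cell d L))) :
    Summable fun m : Fin d → ℤ => cosCoeff L m g ^ 2 + sinCoeff L m g ^ 2 := by
  have h0 : MemLp g 2 (cellMeasure d L) := hg.smul_measure ENNReal.ofReal_ne_top
  have h1 : MemLp (fun t => (g (torusRep d L t) : ℂ)) 2 (volume : Measure (UnitAddTorus (Fin d))) :=
    (h0.comp_measurePreserving (measurePreserving_torusRep hL)).ofReal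
  have h2 := (UnitAddTorus.hasSum_sq_mFourierCoeff (h1.toLp _)).summable
  have h3 : ∀ m, UnitAddTorus.mFourierCoeff (h1.toLp _) m =
      ((L ^ d)⁻¹ : ℝ) * ((cosCoeff L m g : ℂ) - sinCoeff L m g * Complex.I) := by
    intro m
    rw [← mFourierCoeff_comp_torusRep hL hg m]
    exact integral_congr_ae (by
      filter_upwards [h1.coeFn_toLp] with t ht
      rw [ht])
  have h4 : ∀ a b : ℝ, ‖(a : ℂ) - b * Complex.I‖ ^ 2 = a ^ 2 + b ^ 2 := by
    intro a b
    rw [← Complex.normSq_eq_norm_sq, Complex.normSq_apply]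
    simp
    ring
  simp_rw [h3, norm_mul, mul_pow, h4, Complex.norm_real] at h2
  exact (summable_mul_left_iff (by simp [hL.ne'])).mp h2

end Torus

/-! ### Fourier coefficients of weak derivatives -/

section WeakDerivatives

variable {d : ℕ} {L : ℝ}

/-- The phase as a continuous linear form. -/
def phaseL (L : ℝ) (m : Fin d → ℤ) : (Fin d → ℝ) →L[ℝ] ℝ :=
  (2 * Real.pi / L) • ∑ i, (m i : ℝ) • ContinuousLinearMap.proj i

lemma phaseL_apply (m : Fin d → ℤ) (x : Fin d → ℝ) : phaseL L m x = phase L m x := by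
  simp [phaseL, phase]

lemma phaseL_single (m : Fin d → ℤ) (k : Fin d) (t : ℝ) :
    phaseL L m (Pi.single k t) = 2 * Real.pi / L * (m k * t) := by
  simp [phaseL_apply, phase, Pi.single_apply]

lemma phase_add_single (hL : 0 < L) (m : Fin d → ℤ) (k : Fin d) (x : Fin d → ℝ) :
    phase L m (x + Pi.single k L) = phase L m x + m k * (2 * Real.pi) := by
  rw [← phaseL_apply, map_add, phaseL_single, phaseL_apply]
  field_simp

/-- Tests the weak derivative against cos(2πm·x/L). Real trigonometric functions are used because
the test functions are real valued. -/
lemma IsWeakPartial.mul_sinCoeff (hL : 0 < L) {k : Fin d} {f g : (Fin d → ℝ) → ℝ}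
    (h : IsWeakPartial L k f g) (m : Fin d → ℤ) :
    2 * Real.pi / L * m k * sinCoeff L m f = cosCoeff L m g := by
  have hφ : (fun x => Real.cos (phase L m x)) = fun x => Real.cos (phaseL L m x) :=
    funext fun x => by rw [phaseL_apply]
  have h1 := h (fun x => Real.cos (phase L m x)) (by rw [hφ]; fun_prop) (fun x k => by
    simp only [phase_add_single hL, Real.cos_add_int_mul_two_pi])
  have h2 : ∀ x, fderiv ℝ (fun x => Real.cos (phase L m x)) x (Pi.single k 1) =
      -(2 * Real.pi / L * m k) * Real.sin (phase L m x) := by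
    intro x
    rw [hφ, ((phaseL L m).hasFDerivAt.cos).fderiv]
    simp only [smul_apply, phaseL_single, smul_eq_mul]
    rw [phaseL_apply]
    ring
  simp only [h2] at h1
  simp only [mul_left_comm (f _), integral_const_mul] at h1
  unfold sinCoeff cosCoeff
  linarith

lemma IsWeakPartial.mul_cosCoeff (hL : 0 < L) {k : Fin d} {f g : (Fin d → ℝ) → ℝ}
    (h : IsWeakPartial L k f g) (m : Fin d → ℤ) :
    2 * Real.pi / L * m k * cosCoeff L m f = -sinCoeff L m g := by
  have hφ : (fun x => Real.sin (phase L m x)) = fun x => Real.sin (phaseL L m x) :=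
    funext fun x => by rw [phaseL_apply]
  have h1 := h (fun x => Real.sin (phase L m x)) (by rw [hφ]; fun_prop) (fun x k => by
    simp only [phase_add_single hL, Real.sin_add_int_mul_two_pi])
  have h2 : ∀ x, fderiv ℝ (fun x => Real.sin (phase L m x)) x (Pi.single k 1) =
      (2 * Real.pi / L * m k) * Real.cos (phase L m x) := by
    intro x
    rw [hφ, ((phaseL L m).hasFDerivAt.sin).fderiv]
    simp only [smul_apply, phaseL_single, smul_eq_mul]
    rw [phaseL_apply]
    ring
  simp only [h2] at h1
  simp only [mul_left_comm (f _), integral_const_mul] at h1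
  unfold sinCoeff cosCoeff
  linarith

/-- The squared modulus of the Fourier coefficient. -/
def coeffSq (L : ℝ) (m : Fin d → ℤ) (f : (Fin d → ℝ) → ℝ) : ℝ :=
  cosCoeff L m f ^ 2 + sinCoeff L m f ^ 2

lemma coeffSq_nonneg (L : ℝ) (m : Fin d → ℤ) (f : (Fin d → ℝ) → ℝ) : 0 ≤ coeffSq L m f := by
  unfold coeffSq; positivity

lemma coeffSq_weakPartial (hL : 0 < L) {k : Fin d} {f g : (Fin d → ℝ) → ℝ}
    (h : IsWeakPartial L k f g) (m : Fin d → ℤ) :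
    coeffSq L m g = (2 * Real.pi / L * m k) ^ 2 * coeffSq L m f := by
  have h1 := h.mul_sinCoeff hL m
  have h2 := h.mul_cosCoeff hL m
  have h3 : sinCoeff L m g = -(2 * Real.pi / L * m k * cosCoeff L m f) := by linarith
  unfold coeffSq
  rw [← h1, h3]
  ring

lemma MemH.memLp {n : ℕ} {f : (Fin d → ℝ) → ℝ} (h : MemH L n f) :
    MemLp f 2 (volume.restrict (cell d L)) := by
  cases n with
  | zero => exact h.2
  | succ n => exact h.1.2

lemma MemH.isPer {n : ℕ} {f : (Fin d → ℝ) → ℝ} (h : MemH L n f) : IsPer L f := by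
  cases n with
  | zero => exact h.1
  | succ n => exact h.1.1

/-- The Fourier coefficients of an `H²` function are square summable with weight `(1 + |m|²)²`. -/
lemma MemH.summable_coeffSq (hL : 0 < L) {n : ℕ} {f : (Fin d → ℝ) → ℝ} (h : MemH L (n + 2) f) :
    Summable fun m : Fin d → ℤ => (1 + ∑ k, (m k : ℝ) ^ 2) ^ 2 * coeffSq L m f := by
  have h1 : ∀ k : Fin d, ∃ g₂ : (Fin d → ℝ) → ℝ, MemLp g₂ 2 (volume.restrict (cell d L)) ∧
      ∀ m : Fin d → ℤ, coeffSq L m g₂ = (2 * Real.pi / L * m k) ^ 4 * coeffSq L m f := by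
    intro k
    obtain ⟨g, hg, hg'⟩ := h.2 k
    obtain ⟨g₂, hg₂, hg₂'⟩ := hg'.2 k
    refine ⟨g₂, hg₂'.memLp, fun m => ?_⟩
    rw [coeffSq_weakPartial hL hg₂, coeffSq_weakPartial hL hg]
    ring
  choose G hG hGc using h1
  have h2 : Summable fun m : Fin d → ℤ => (2 + 2 * d) *
      (coeffSq L m f + ∑ k, (L / (2 * Real.pi)) ^ 4 * coeffSq L m (G k)) :=
    ((summable_sq_coeff hL h.memLp).add (summable_sum fun k _ =>
      (summable_sq_coeff hL (hG k)).mul_left _)).mul_left _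
  refine Summable.of_nonneg_of_le (fun m => mul_nonneg (sq_nonneg _) (coeffSq_nonneg _ _ _))
    (fun m => ?_) h2
  have hp := coeffSq_nonneg L m f
  have h3 : ∀ k, (L / (2 * Real.pi)) ^ 4 * coeffSq L m (G k) = (m k : ℝ) ^ 4 * coeffSq L m f := by
    intro k
    rw [hGc]
    have := Real.pi_pos
    field_simp
  simp_rw [h3]
  rw [← Finset.sum_mul, ← one_add_mul, ← mul_assoc]
  refine mul_le_mul_of_nonneg_right ?_ hp
  -- Pure second derivatives suffice: |m|⁴ ≤ d ∑ m_k⁴ gives (1 + |m|²)² ≤ 2 + 2|m|⁴ ≤ (2 + 2d)(1 + ∑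
  -- m_k⁴).
  have h4 := sq_sum_le_card_mul_sum_sq (s := Finset.univ) (f := fun k => (m k : ℝ) ^ 2)
  simp only [Finset.card_univ, Fintype.card_fin, ← pow_mul] at h4
  norm_num at h4
  set A := ∑ k, (m k : ℝ) ^ 2
  set B := ∑ k, (m k : ℝ) ^ 4 with hB
  have hB0 : 0 ≤ B := Finset.sum_nonneg fun k _ => by positivity
  have hd0 : (0 : ℝ) ≤ d := Nat.cast_nonneg d
  nlinarith [sq_nonneg (A - 1)]

end WeakDerivatives

/-! ### Aliased frequencies on the mesh -/

section Aliasing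

variable {d : ℕ}

/-- Every finite set of indices lies in a product of finite sets, over which the sum factors. -/
lemma summable_prod_wt (d : ℕ) : Summable fun l : Fin d → ℤ => ∏ j, wt (l j) := by
  have hw : ∀ m : ℤ, 0 ≤ wt m := fun m => (wt_pos _).le
  refine summable_of_sum_le (c := ∏ _j : Fin d, ∑' m : ℤ, wt m)
    (fun l => Finset.prod_nonneg fun j _ => hw _) fun s => ?_
  obtain ⟨T, hT⟩ : ∃ T : Fin d → Finset ℤ, s ⊆ Fintype.piFinset T := by
    refine ⟨fun j => s.image fun l => l j, fun l hl => ?_⟩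
    rw [Fintype.mem_piFinset]
    exact fun j => Finset.mem_image_of_mem _ hl
  have h1 : ∑ l ∈ Fintype.piFinset T, ∏ j, wt (l j) = ∏ j, ∑ m ∈ T j, wt (m : ℝ) :=
    (Finset.prod_univ_sum T fun _ (m : ℤ) => wt (m : ℝ)).symm
  refine (Finset.sum_le_sum_of_subset_of_nonneg hT fun l _ _ =>
    Finset.prod_nonneg fun j _ => hw _).trans ?_
  rw [h1]
  exact Finset.prod_le_prod (fun j _ => Finset.sum_nonneg fun m _ => hw m)
    fun j _ => summable_wt.sum_le_tsum _ fun m _ => hw m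

lemma summable_one_add_sum_sq_inv (hd : d ≤ 3) :
    Summable fun l : Fin d → ℤ => ((1 + ∑ j, (l j : ℝ) ^ 2) ^ 2)⁻¹ :=
  Summable.of_nonneg_of_le (fun l => by positivity)
    (fun l => one_add_sum_sq_inv_le hd fun j => (l j : ℝ)) (summable_prod_wt d)

/-- The Cauchy–Schwarz inequality for series. -/
lemma summable_mul_and_tsum_sq_le {ι : Type*} {x y : ι → ℝ} (hx : ∀ i, 0 ≤ x i)
    (hy : ∀ i, 0 ≤ y i) (hx2 : Summable fun i => x i ^ 2) (hy2 : Summable fun i => y i ^ 2) :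
    (Summable fun i => x i * y i) ∧
      (∑' i, x i * y i) ^ 2 ≤ (∑' i, x i ^ 2) * ∑' i, y i ^ 2 := by
  have h0 : Summable fun i => x i * y i := by
    refine Summable.of_nonneg_of_le (fun i => mul_nonneg (hx i) (hy i)) (fun i => ?_)
      (hx2.add hy2)
    nlinarith [sq_nonneg (x i - y i), sq_nonneg (x i), sq_nonneg (y i)]
  refine ⟨h0, ?_⟩
  have hX : 0 ≤ ∑' i, x i ^ 2 := tsum_nonneg fun i => sq_nonneg _
  have hY : 0 ≤ ∑' i, y i ^ 2 := tsum_nonneg fun i => sq_nonneg _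
  have h1 : ∑' i, x i * y i ≤ √((∑' i, x i ^ 2) * ∑' i, y i ^ 2) := by
    refine h0.tsum_le_of_sum_le fun s => Real.le_sqrt_of_sq_le ?_
    refine (Finset.sum_mul_sq_le_sq_mul_sq s x y).trans ?_
    exact mul_le_mul (hx2.sum_le_tsum s fun i _ => sq_nonneg _)
      (hy2.sum_le_tsum s fun i _ => sq_nonneg _) (Finset.sum_nonneg fun i _ => sq_nonneg _) hX
  calc _ ≤ √((∑' i, x i ^ 2) * ∑' i, y i ^ 2) ^ 2 :=
        pow_le_pow_left₀ (tsum_nonneg fun i => mul_nonneg (hx i) (hy i)) h1 2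
    _ = _ := Real.sq_sqrt (mul_nonneg hX hY)

variable {J : ℕ}

/-- The frequencies that coincide with `k` on the mesh. -/
def freq (k : Fin d → ZMod J) (l : Fin d → ℤ) : Fin d → ℤ :=
  fun j => (k j).valMinAbs + J * l j

lemma cast_freq (k : Fin d → ZMod J) (l : Fin d → ℤ) :
    (fun j => ((freq k l j : ℤ) : ZMod J)) = k := by
  funext j
  simp [freq]

lemma mem_range_freq {k : Fin d → ZMod J} {m : Fin d → ℤ}
    (h : (fun j => ((m j : ℤ) : ZMod J)) = k) : m ∈ Set.range (freq k) := by
  have h1 : ∀ j, ∃ l : ℤ, m j = (k j).valMinAbs + J * l := by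
    intro j
    have h2 : ((m j - (k j).valMinAbs : ℤ) : ZMod J) = 0 := by
      rw [← h]
      simp
    obtain ⟨l, hl⟩ := (ZMod.intCast_zmod_eq_zero_iff_dvd _ J).mp h2
    exact ⟨l, by linarith⟩
  choose l hl using h1
  exact ⟨l, funext fun j => (hl j).symm⟩

variable [NeZero J]

lemma freq_injective :
    Function.Injective fun p : (Fin d → ZMod J) × (Fin d → ℤ) => freq p.1 p.2 := by
  rintro ⟨k, l⟩ ⟨k', l'⟩ h
  have h' : freq k l = freq k' l' := h
  have hk : k = k' := by rw [← cast_freq k l, ← cast_freq k' l', h']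
  subst hk
  have hl : l = l' := by
    funext j
    have := congrFun h' j
    simpa [freq, NeZero.ne J] using this
  rw [hl]

lemma lamj_le {L : ℝ} (hL : 0 < L) (k : Fin d → ZMod J) (j : Fin d) :
    lamj (L / J) k j ≤ (2 * Real.pi / L) ^ 2 * ((k j).valMinAbs : ℝ) ^ 2 := by
  have hJ := natCast_J_pos (J := J)
  set v := (k j).valMinAbs with hv
  have hkv : k j = (v : ZMod J) := (ZMod.coe_valMinAbs (k j)).symm
  rw [lamj, hkv, norm_stdAddChar_sub_one]
  have h1 : |Real.sin (Real.pi * v / J)| ^ 2 ≤ |Real.pi * v / J| ^ 2 :=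
    pow_le_pow_left₀ (abs_nonneg _) (Real.abs_sin_le_abs) 2
  rw [sq_abs (Real.pi * v / J)] at h1
  rw [mul_pow, div_le_iff₀ (by positivity)]
  refine (mul_le_mul_of_nonneg_left h1 (by norm_num)).trans (le_of_eq ?_)
  field_simp

lemma abs_valMinAbs_le (a : ZMod J) : |(a.valMinAbs : ℝ)| ≤ J / 2 := by
  have h1 : a.valMinAbs.natAbs ≤ J / 2 := ZMod.natAbs_valMinAbs_le a
  have h2 : ((a.valMinAbs.natAbs : ℕ) : ℝ) ≤ ((J / 2 : ℕ) : ℝ) := by exact_mod_cast h1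
  rw [Nat.cast_natAbs, Int.cast_abs] at h2
  exact h2.trans Nat.cast_div_le

/-- Since |v| ≤ J/2, any l ≠ 0 gives |v + Jl| ≥ J|l| - J/2 ≥ J|l|/2 ≥ |v|. -/
lemma freq_bounds (k : Fin d → ZMod J) (l : Fin d → ℤ) (j : Fin d) :
    ((k j).valMinAbs : ℝ) ^ 2 ≤ (freq k l j : ℝ) ^ 2 ∧
      (J : ℝ) ^ 2 * (l j : ℝ) ^ 2 ≤ 4 * (freq k l j : ℝ) ^ 2 := by
  have hJ := natCast_J_pos (J := J)
  have hv := abs_valMinAbs_le (k j)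
  set v : ℝ := ((k j).valMinAbs : ℝ) with hvdef
  have hm : (freq k l j : ℝ) = v + J * l j := by
    simp [freq, hvdef]
  rw [hm]
  by_cases hl : l j = 0
  · rw [hl]
    simp
    positivity
  · have h1 : (1 : ℝ) ≤ |(l j : ℝ)| := by exact_mod_cast Int.one_le_abs hl
    have h2 : (J : ℝ) * |(l j : ℝ)| / 2 ≤ |v + J * l j| := by
      have h3 : |(J : ℝ) * l j| ≤ |v + J * l j| + |v| := by
        have := abs_sub (v + J * l j) v
        rwa [add_sub_cancel_left] at this
      rw [abs_mul, abs_of_pos hJ] at h3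
      nlinarith
    have h4 : |v| ≤ |v + J * l j| := by nlinarith
    refine ⟨sq_le_sq.mpr h4, ?_⟩
    have h5 := pow_le_pow_left₀ (by positivity) h2 2
    rw [sq_abs, div_pow, mul_pow, sq_abs] at h5
    linarith

/-- The weight at an alias dominates the product of the mesh weight and a weight in l. The mixed
term is controlled because the mesh frequency is O(J) and J|l| is at most twice the aliased
frequency. -/
lemma exists_one_add_lam_mul_le (d : ℕ) {L : ℝ} (hL : 0 < L) : ∃ C : ℝ, 0 ≤ C ∧
    ∀ (J : ℕ) [NeZero J] (k : Fin d → ZMod J) (l : Fin d → ℤ),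
      (1 + lam (L / J) k) * (1 + ∑ j, (l j : ℝ) ^ 2) ≤ C * (1 + ∑ j, (freq k l j : ℝ) ^ 2) := by
  set p := (2 * Real.pi / L) ^ 2 with hp
  refine ⟨(1 + p) * (5 + d), by positivity, fun J _ k l => ?_⟩
  have hJ := natCast_J_pos (J := J)
  have hJ1 : (1 : ℝ) ≤ J := by exact_mod_cast Nat.one_le_iff_ne_zero.mpr (NeZero.ne J)
  set V := ∑ j, ((k j).valMinAbs : ℝ) ^ 2 with hV
  set Λ := ∑ j, (l j : ℝ) ^ 2 with hΛ
  set M := ∑ j, (freq k l j : ℝ) ^ 2 with hM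
  have hV0 : 0 ≤ V := Finset.sum_nonneg fun j _ => sq_nonneg _
  have hΛ0 : 0 ≤ Λ := Finset.sum_nonneg fun j _ => sq_nonneg _
  have hM0 : 0 ≤ M := Finset.sum_nonneg fun j _ => sq_nonneg _
  have hp0 : 0 ≤ p := sq_nonneg _
  have h1 : lam (L / J) k ≤ p * V := by
    rw [hV, Finset.mul_sum]
    exact Finset.sum_le_sum fun j _ => lamj_le hL k j
  have h2 : V ≤ M := Finset.sum_le_sum fun j _ => (freq_bounds k l j).1
  have h3 : (J : ℝ) ^ 2 * Λ ≤ 4 * M := by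
    rw [hΛ, hM, Finset.mul_sum, Finset.mul_sum]
    exact Finset.sum_le_sum fun j _ => (freq_bounds k l j).2
  have h4 : V ≤ d * ((J : ℝ) ^ 2 / 4) := by
    have h5 : ∀ j, ((k j).valMinAbs : ℝ) ^ 2 ≤ (J : ℝ) ^ 2 / 4 := by
      intro j
      have := pow_le_pow_left₀ (abs_nonneg _) (abs_valMinAbs_le (k j)) 2
      rw [sq_abs] at this
      linarith
    refine (Finset.sum_le_sum fun j _ => h5 j).trans (le_of_eq ?_)
    simp
  have h6 : V * Λ ≤ d * M := by
    have h7 := mul_le_mul_of_nonneg_right h4 hΛ0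
    have h8 := mul_le_mul_of_nonneg_left h3 (by positivity : 0 ≤ (d : ℝ) / 4)
    linarith
  have h9 : Λ ≤ 4 * M := by
    have : Λ ≤ (J : ℝ) ^ 2 * Λ := le_mul_of_one_le_left hΛ0 (one_le_pow₀ hJ1)
    linarith
  have hd0 : (0 : ℝ) ≤ d := Nat.cast_nonneg d
  calc (1 + lam (L / J) k) * (1 + Λ) ≤ (1 + p) * ((1 + V) * (1 + Λ)) := by
        rw [← mul_assoc]
        refine mul_le_mul_of_nonneg_right ?_ (by linarith)
        nlinarith
    _ ≤ (1 + p) * ((5 + d) * (1 + M)) := by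
        refine mul_le_mul_of_nonneg_left ?_ (by linarith)
        nlinarith
    _ = _ := by ring

end Aliasing

/-! ### Nodal values and their discrete Fourier coefficients -/

section Sampling

variable {d J : ℕ} [NeZero J]

lemma freq_right_injective (k : Fin d → ZMod J) : Function.Injective (freq k) := fun l l' hl => by
  have := freq_injective (a₁ := (k, l)) (a₂ := (k, l')) hl
  exact (Prod.mk.inj this).2

lemma mFourier_node (m : Fin d → ℤ) (x : Fin d → ZMod J) :
    UnitAddTorus.mFourier m (torusMk fun j => ((x j).val : ℝ) / J) =
      chi (fun j => ((m j : ℤ) : ZMod J)) x := by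
  have h1 : (fun j => ((m j : ℤ) : ZMod J)) ⬝ᵥ x = ((∑ j, m j * (x j).val : ℤ) : ZMod J) := by
    simp [dotProduct]
  rw [mFourier_torusMk, chi, h1, ZMod.stdAddChar_coe]
  congr 1
  push_cast
  rw [Finset.mul_sum, Finset.mul_sum, Finset.mul_sum, Finset.sum_div]
  refine Finset.sum_congr rfl fun j _ => ?_
  ring

lemma sum_chi_mul_chi_neg (a k : Fin d → ZMod J) :
    ∑ x, chi a x * chi k (-x) = if a = k then (J : ℂ) ^ d else 0 := by
  have h1 : ∀ x, chi a x * chi k (-x) = chi x (a - k) := by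
    intro x
    rw [← chi_neg_left, chi_comm a, chi_comm (-k), ← chi_add, sub_eq_add_neg]
  simp_rw [h1, sum_chi, sub_eq_zero]

/-- Aliasing: the discrete Fourier coefficients of the nodal values. -/
lemma hasSum_fhat_sample {U : Grid d J} {c : (Fin d → ℤ) → ℂ}
    (h : ∀ x, HasSum (fun m => c m * chi (fun j => ((m j : ℤ) : ZMod J)) x) (U x : ℂ))
    (k : Fin d → ZMod J) : HasSum (fun l => (J : ℂ) ^ d * c (freq k l)) (fhat k U) := by
  have h1 : HasSum (fun m => ∑ x, c m * chi (fun j => ((m j : ℤ) : ZMod J)) x * chi k (-x))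
      (fhat k U) := by
    rw [fhat_apply]
    exact hasSum_sum fun x _ => (h x).mul_right _
  have h2 : ∀ m, ∑ x, c m * chi (fun j => ((m j : ℤ) : ZMod J)) x * chi k (-x) =
      c m * if (fun j => ((m j : ℤ) : ZMod J)) = k then (J : ℂ) ^ d else 0 := by
    intro m
    rw [← sum_chi_mul_chi_neg, Finset.mul_sum]
    exact Finset.sum_congr rfl fun x _ => mul_assoc _ _ _
  simp_rw [h2] at h1
  rw [← (freq_right_injective k).hasSum_iff (fun m hm => by
    rw [if_neg fun hk => hm (mem_range_freq hk), mul_zero])] at h1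
  refine h1.congr_fun fun l => ?_
  simp only [Function.comp_apply, cast_freq, if_true]
  ring

end Sampling

/-- The nodal values of a continuous periodic `H²` function are bounded in the discrete `H²` norm,
uniformly in the mesh. -/
theorem exists_sob_two_sample_le {d : ℕ} (hd : d ≤ 3) {L : ℝ} (hL : 0 < L) {n : ℕ}
    {f : (Fin d → ℝ) → ℝ} (hf : MemH L (n + 2) f) (hc : Continuous f) :
    ∃ C : ℝ, ∀ (J : ℕ) [NeZero J], sob (L / J) 2 (sample L J f) ≤ C := by
  obtain ⟨C₁, hC₁, hlam⟩ := exists_one_add_lam_mul_le d hL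
  have hper := hf.isPer
  set F : C(UnitAddTorus (Fin d), ℂ) :=
    ⟨fun t => (f (torusRep d L t) : ℂ), Complex.continuous_ofReal.comp
      (continuous_comp_torusRep hper hc)⟩ with hF
  set c := UnitAddTorus.mFourierCoeff F with hcdef
  have hnorm : ∀ m, ‖c m‖ ^ 2 = ((L ^ d)⁻¹) ^ 2 * coeffSq L m f := by
    intro m
    have h1 : c m = ((L ^ d)⁻¹ : ℝ) * ((cosCoeff L m f : ℂ) - sinCoeff L m f * Complex.I) :=
      mFourierCoeff_comp_torusRep hL hf.memLp m
    rw [h1, norm_mul, mul_pow, Complex.norm_real, Real.norm_eq_abs, sq_abs, coeffSq]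
    congr 1
    rw [← Complex.normSq_eq_norm_sq, Complex.normSq_apply]
    simp
    ring
  set e : (Fin d → ℤ) → ℝ := fun m => 1 + ∑ j, (m j : ℝ) ^ 2 with he
  have he0 : ∀ m, 0 < e m := fun m => by
    have : 0 ≤ ∑ j, (m j : ℝ) ^ 2 := Finset.sum_nonneg fun j _ => sq_nonneg _
    simp only [he]
    linarith
  set w : (Fin d → ℤ) → ℝ := fun m => e m * ‖c m‖ with hw
  have hw0 : ∀ m, 0 ≤ w m := fun m => mul_nonneg (he0 m).le (norm_nonneg _)
  have hw2 : Summable fun m => w m ^ 2 := by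
    refine ((hf.summable_coeffSq hL).mul_left (((L ^ d)⁻¹) ^ 2)).congr fun m => ?_
    simp only [hw, he]
    rw [mul_pow, hnorm]
    ring
  have hinv2 : Summable fun m => ((e m)⁻¹) ^ 2 := by
    refine (summable_one_add_sum_sq_inv hd).congr fun m => ?_
    simp only [he]
    rw [inv_pow]
  have hinv0 : ∀ m, 0 ≤ (e m)⁻¹ := fun m => (inv_pos.mpr (he0 m)).le
  -- Absolute summability makes the Fourier series converge pointwise to the continuous
  -- representative, in particular at the nodes.
  have hcsum : Summable c := by
    refine Summable.of_norm ((summable_mul_and_tsum_sq_le hinv0 hw0 hinv2 hw2).1.congr fun m => ?_)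
    simp only [hw]
    rw [inv_mul_cancel_left₀ (he0 m).ne']
  have hseries := fun t => UnitAddTorus.hasSum_mFourier_series_apply_of_summable hcsum t
  set Ω := ∑' l : Fin d → ℤ, ((e l)⁻¹) ^ 2 with hΩ
  set W := ∑' m, w m ^ 2 with hW
  have hΩ0 : 0 ≤ Ω := tsum_nonneg fun l => sq_nonneg _
  refine ⟨√(L ^ d * (C₁ ^ 2 * Ω * W)), fun J _ => Real.le_sqrt_of_sq_le ?_⟩
  have hJ := natCast_J_pos (J := J)
  have hh : 0 < L / J := by positivity
  have hU : ∀ x : Fin d → ZMod J, HasSum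
      (fun m => c m * chi (fun j => ((m j : ℤ) : ZMod J)) x) ((sample L J f x : ℝ) : ℂ) := by
    intro x
    have h1 := hseries (torusMk fun j => ((x j).val : ℝ) / J)
    simp only [mFourier_node, smul_eq_mul] at h1
    have h2 : F (torusMk fun j => ((x j).val : ℝ) / J) = ((sample L J f x : ℝ) : ℂ) := by
      simp only [hF, ContinuousMap.coe_mk, comp_torusRep_torusMk hper, sample]
      congr 2
      ext j
      simp only [Pi.smul_apply, smul_eq_mul]
      ring
    rwa [h2] at h1
  have hk : ∀ k : Fin d → ZMod J, (1 + lam (L / J) k) ^ 2 * ‖fhat k (sample L J f)‖ ^ 2 ≤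
      ((J : ℝ) ^ d) ^ 2 * (C₁ ^ 2 * Ω * ∑' l, w (freq k l) ^ 2) := by
    intro k
    have h0 := lam_nonneg (L / J) k
    have h1 := hasSum_fhat_sample hU k
    have hsw : Summable fun l => w (freq k l) ^ 2 := hw2.comp_injective (freq_right_injective k)
    obtain ⟨hs, hcs⟩ := summable_mul_and_tsum_sq_le hinv0 (fun l => hw0 (freq k l)) hinv2 hsw
    -- The weight inequality extracts (1 + λ_k)⁻¹ from each alias and leaves (1 + |l|²)⁻¹, square
    -- summable for d ≤ 3, times the weighted coefficient; Cauchy–Schwarz in l follows.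
    have h2 : ∀ l, ‖(J : ℂ) ^ d * c (freq k l)‖ ≤
        (J : ℝ) ^ d * (C₁ / (1 + lam (L / J) k)) * ((e l)⁻¹ * w (freq k l)) := by
      intro l
      rw [norm_mul, norm_pow, Complex.norm_natCast, mul_assoc]
      refine mul_le_mul_of_nonneg_left ?_ (by positivity)
      have h3 : (1 + lam (L / J) k) * e l ≤ C₁ * e (freq k l) := hlam J k l
      simp only [hw]
      have h4 : 1 ≤ C₁ / (1 + lam (L / J) k) * (e l)⁻¹ * e (freq k l) := by
        rw [div_mul_eq_mul_div, div_mul_eq_mul_div, le_div_iff₀ (by linarith), one_mul]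
        have := he0 l
        rw [← mul_le_mul_iff_left₀ this]
        refine h3.trans (le_of_eq ?_)
        field_simp
      calc ‖c (freq k l)‖ ≤ C₁ / (1 + lam (L / J) k) * (e l)⁻¹ * e (freq k l) * ‖c (freq k l)‖ :=
            le_mul_of_one_le_left (norm_nonneg _) h4
        _ = _ := by ring
    have h5 := tsum_of_norm_bounded (hs.hasSum.mul_left _) h2
    rw [h1.tsum_eq] at h5
    have h6 := pow_le_pow_left₀ (norm_nonneg _) h5 2
    rw [mul_pow] at h6
    have h7 : ‖fhat k (sample L J f)‖ ^ 2 ≤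
        ((J : ℝ) ^ d * (C₁ / (1 + lam (L / J) k))) ^ 2 * (Ω * ∑' l, w (freq k l) ^ 2) :=
      h6.trans (mul_le_mul_of_nonneg_left hcs (sq_nonneg _))
    refine (mul_le_mul_of_nonneg_left h7 (sq_nonneg _)).trans (le_of_eq ?_)
    have : 1 + lam (L / J) k ≠ 0 := by linarith
    field_simp
  -- Distinct pairs (k, l) give distinct frequencies, so the double sum is part of the sum over ℤ^d
  -- and independent of J.
  have htot : ∑ k : Fin d → ZMod J, ∑' l, w (freq k l) ^ 2 ≤ W := by
    have hsp : Summable fun p : (Fin d → ZMod J) × (Fin d → ℤ) => w (freq p.1 p.2) ^ 2 :=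
      hw2.comp_injective freq_injective
    have h1 := hsp.tsum_prod
    have h2 : ∑ k : Fin d → ZMod J, ∑' l, w (freq k l) ^ 2 =
        ∑' (k : Fin d → ZMod J) (l : Fin d → ℤ), w (freq k l) ^ 2 := (tsum_fintype _).symm
    rw [h2]
    refine h1.symm.le.trans ?_
    exact tsum_comp_le_tsum_of_inj hw2 (fun m => sq_nonneg _) freq_injective
  rw [sob_sq hh]
  calc (L / J) ^ d / (J : ℝ) ^ d *
        ∑ k, (1 + lam (L / J) k) ^ 2 * ‖fhat k (sample L J f)‖ ^ 2
      ≤ (L / J) ^ d / (J : ℝ) ^ d *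
        ∑ k : Fin d → ZMod J, ((J : ℝ) ^ d) ^ 2 * (C₁ ^ 2 * Ω * ∑' l, w (freq k l) ^ 2) :=
        mul_le_mul_of_nonneg_left (Finset.sum_le_sum fun k _ => hk k) (by positivity)
    _ = L ^ d * (C₁ ^ 2 * Ω * ∑ k : Fin d → ZMod J, ∑' l, w (freq k l) ^ 2) := by
        rw [← Finset.mul_sum, ← Finset.mul_sum, div_pow]
        field_simp
    _ ≤ _ := by gcongr

lemma maxUpTo_le {N : ℕ} {f : ℕ → ℝ} {C : ℝ} (h : ∀ n ≤ N, f n ≤ C) : maxUpTo N f ≤ C :=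
  Finset.sup'_le _ _ fun n hn => h n (Nat.lt_succ_iff.mp (Finset.mem_range.mp hn))

/-! ### Discrete H² norms and initial states -/

namespace Params

lemma H2T_sq_le {d J : ℕ} [NeZero J] {P : Params} (hP : P.Admissible d) (Q : TGrid d J) :
    H2T (P.h J) Q ^ 2 ≤ P.sobT 2 Q := by
  have hh := hP.h_pos (J := J)
  have h1 : l2T (P.h J) Q ^ 2 = ∑ i, ∑ j, sob (P.h J) 0 (comp Q i j) ^ 2 := l2T_sq hP Q
  have h2 : gradT (P.h J) Q ^ 2 =
      ∑ i, ∑ j, ∑ k, sob (P.h J) 0 (Dp (P.h J) k (comp Q i j)) ^ 2 := by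
    rw [gradT, Real.sq_sqrt (Finset.sum_nonneg fun k _ => Finset.sum_nonneg fun i _ =>
      Finset.sum_nonneg fun j _ => sq_nonneg _), Finset.sum_comm]
    refine Finset.sum_congr rfl fun i _ => ?_
    rw [Finset.sum_comm]
    simp_rw [l2_eq_sob hh]
  have h3 : lapT (P.h J) Q ^ 2 = ∑ i, ∑ j, sob (P.h J) 0 (lap (P.h J) (comp Q i j)) ^ 2 := by
    rw [lapT, Real.sq_sqrt (Finset.sum_nonneg fun i _ => Finset.sum_nonneg fun j _ => sq_nonneg _)]
    simp_rw [l2_eq_sob hh]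
  rw [H2T, Real.sq_sqrt (by positivity), H1T, Real.sq_sqrt (by positivity), h1, h2, h3, sobT]
  simp only [← Finset.sum_add_distrib]
  refine Finset.sum_le_sum fun i _ => Finset.sum_le_sum fun j _ => ?_
  rw [sob_two_sq hh]
  have : 0 ≤ ∑ k, sob (P.h J) 0 (Dp (P.h J) k (comp Q i j)) ^ 2 :=
    Finset.sum_nonneg fun k _ => sq_nonneg _
  linarith

/-- The initial states are bounded uniformly in the mesh. -/
lemma exists_boundedState_initial {d : ℕ} (hd : d = 2 ∨ d = 3) {P : Params} (hP : P.Admissible d)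
    {Q₀ : (Fin d → ℝ) → Matrix (Fin d) (Fin d) ℝ} {u₀ : (Fin d → ℝ) → ℝ}
    (hQsymm : ∀ x, (Q₀ x).IsSymm) (hQcont : Continuous Q₀) (hucont : Continuous u₀)
    (hQ₀ : ∀ i j, MemH P.L 2 (fun x => Q₀ x i j)) (hu₀ : MemH P.L 4 u₀) (σ₀ : ℝ) :
    ∃ R : ℝ, ∀ (J : ℕ) [NeZero J] (τ : ℝ) (N : ℕ) (Q : ℕ → TGrid d J) (u : ℕ → Grid d J)
      (s : ℕ → ℝ), P.IsSolution Q₀ u₀ σ₀ τ N Q u s → P.BoundedState R (Q 0) (u 0) (s 0) := by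
  obtain ⟨S, hS⟩ := exists_sobolevConst d hd hP.L_pos
  have h1 : ∀ i j, ∃ C : ℝ, ∀ (J : ℕ) [NeZero J],
      sob (P.L / J) 2 (sample P.L J fun x => Q₀ x i j) ≤ C := fun i j =>
    exists_sob_two_sample_le (n := 0) (by omega) hP.L_pos (hQ₀ i j)
      (hQcont.matrix_elem i j)
  choose CQ hCQ using h1
  obtain ⟨Cu, hCu⟩ := exists_sob_two_sample_le (n := 2) (by omega) hP.L_pos hu₀ hucont
  set R := (∑ i, ∑ j, |CQ i j|) + |Cu| with hR
  have hRu : Cu ≤ R := by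
    have : 0 ≤ ∑ i, ∑ j, |CQ i j| :=
      Finset.sum_nonneg fun i _ => Finset.sum_nonneg fun j _ => abs_nonneg _
    linarith [le_abs_self Cu]
  have hRQ : ∀ i j, CQ i j ≤ R := by
    intro i j
    have h2 : |CQ i j| ≤ ∑ j, |CQ i j| :=
      Finset.single_le_sum (f := fun j => |CQ i j|) (fun j _ => abs_nonneg _) (Finset.mem_univ j)
    have h3 : ∑ j, |CQ i j| ≤ ∑ i, ∑ j, |CQ i j| :=
      Finset.single_le_sum (f := fun i => ∑ j, |CQ i j|)
        (fun i _ => Finset.sum_nonneg fun j _ => abs_nonneg _) (Finset.mem_univ i)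
    linarith [le_abs_self (CQ i j), abs_nonneg Cu]
  obtain ⟨CE, hCE⟩ := exists_E1_le (by omega) hP hS R
  set RQ := (d : ℝ) * d * R ^ 2 with hRQdef
  refine ⟨max (max RQ (R ^ 2)) (P.K / 2 * RQ + P.B₀ * R ^ 2 + (CE + σ₀)),
    fun J _ τ N Q u s hsol => ?_⟩
  have hsym : ∀ x, (Q 0 x).IsSymm := by
    intro x
    rw [hsol.Q_init]
    exact hQsymm _
  have hQ : ∀ i j, sob (P.h J) 2 (comp (Q 0) i j) ≤ R := by
    intro i j
    rw [hsol.Q_init]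
    exact (hCQ i j J).trans (hRQ i j)
  have hu : sob (P.h J) 2 (u 0) ≤ R := by
    rw [hsol.u_init]
    exact (hCu J).trans hRu
  have hQT : P.sobT 2 (Q 0) ≤ RQ := sobT_le_const hQ
  have huT : sob (P.h J) 2 (u 0) ^ 2 ≤ R ^ 2 := pow_le_pow_left₀ (apply_nonneg _ _) hu 2
  refine ⟨hsym, hQT.trans ((le_max_left _ _).trans (le_max_left _ _)),
    huT.trans ((le_max_right _ _).trans (le_max_left _ _)), le_trans ?_ (le_max_right _ _)⟩
  -- The upper half s⁰ ≤ E_{1h}⁰ + σ₀ suffices, E_{1h}⁰ being bounded above by the discrete H²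
  -- norms.
  have h4 := (abs_le.mp hsol.s_init).2
  have h5 := hCE J (Q 0) (u 0) hsym hQ hu
  have h6 := elastic_le hP (Q 0) (u 0)
  have h7 := mul_le_mul_of_nonneg_left hQT (by have := hP.K_pos; positivity : 0 ≤ P.K / 2)
  have h8 := mul_le_mul_of_nonneg_left huT hP.B₀_pos.le
  linarith

end Params

end Smectic
end

theorem theorem4p1 (d : ℕ) (hd : d = 2 ∨ d = 3)
    (P : Smectic.Params) (hP : P.Admissible d)
    (Q₀ : (Fin d → ℝ) → Matrix (Fin d) (Fin d) ℝ) (u₀ : (Fin d → ℝ) → ℝ)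
    (hQsymm : ∀ x, (Q₀ x).IsSymm) (hQtrace : ∀ x, (Q₀ x).trace = 0)
    (hQcont : Continuous Q₀) (hucont : Continuous u₀)
    (hQ₀ : ∀ i j, Smectic.MemH P.L 2 (fun x => Q₀ x i j))
    (hu₀ : Smectic.MemH P.L 4 u₀)
    (σ₀ : ℝ) (T : ℝ) (hT : 0 < T) :
    (∀ ε : ℝ, 0 < ε → ε < 1 / 4 →
      ∃ Cε : ℝ, ∀ (J : ℕ) [NeZero J] (τ : ℝ) (N : ℕ)
        (Q : ℕ → Smectic.TGrid d J) (u : ℕ → Smectic.Grid d J) (s : ℕ → ℝ),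
        0 < τ → N * τ ≤ T → P.IsSolution Q₀ u₀ σ₀ τ N Q u s →
          Smectic.maxUpTo N (fun n => Smectic.H2T (P.h J) (Q n))
            + Smectic.maxUpTo N (fun n => Smectic.l2 (P.h J) (Smectic.lap (P.h J) (u n))) ≤ Cε) ∧
    (∃ C : ℝ, ∀ (J : ℕ) [NeZero J] (τ : ℝ) (N : ℕ)
        (Q : ℕ → Smectic.TGrid d J) (u : ℕ → Smectic.Grid d J) (s : ℕ → ℝ),
        0 < τ → N * τ ≤ T → P.IsSolution Q₀ u₀ σ₀ τ N Q u s →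
          Smectic.maxUpTo N (fun n => Smectic.l2T (P.h J) (P.NQ (Q n) (u n) (s n)))
            + Smectic.maxUpTo N (fun n => Smectic.l2 (P.h J) (P.Nu (Q n) (u n) (s n))) ≤ C) := by
  have hd0 : 0 < d := by omega
  obtain ⟨S, hS⟩ := Smectic.exists_sobolevConst d hd hP.L_pos
  obtain ⟨R, hR⟩ := Smectic.Params.exists_boundedState_initial hd hP hQsymm hQcont hucont hQ₀ hu₀ σ₀
  obtain ⟨M, hM⟩ := Smectic.Params.exists_boundedState hd0 hP hS T R
  -- The modified energy of every state is at most M, so one constant C serves along the whole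
  -- solution; the factor 1 + ‖Q‖²_{H²} in the bound for ‖N_u‖² is then at most 1 + M.
  obtain ⟨C, hC0, hC⟩ := Smectic.Params.exists_nonlinearBound hd0 hP hS M
  refine ⟨fun ε _ _ => ⟨√M + √M, fun J _ τ N Q u s hτ hNT hsol => ?_⟩,
    √(d * d * C ^ 2) + √(C ^ 2 * (2 * (1 + M))), fun J _ τ N Q u s hτ hNT hsol => ?_⟩
  · have hB := hM J τ N Q u s hτ hNT (hR J τ N Q u s hsol) hsol.step
    have hh := hP.h_pos (J := J)
    refine add_le_add (Smectic.maxUpTo_le fun n hn => Real.le_sqrt_of_sq_le ?_)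
      (Smectic.maxUpTo_le fun n hn => Real.le_sqrt_of_sq_le ?_)
    · exact (Smectic.Params.H2T_sq_le hP (Q n)).trans (hB n hn).Q_le
    · rw [Smectic.l2_eq_sob hh]
      exact (pow_le_pow_left₀ (apply_nonneg _ _) (Smectic.sob_lap_le hh 0 (u n)) 2).trans
        (hB n hn).u_le
  · have hB := hM J τ N Q u s hτ hNT (hR J τ N Q u s hsol) hsol.step
    have hN := fun n hn => hC J (Q n) (u n) (s n) (hB n hn).symm (hB n hn).energy_le
    have hh := hP.h_pos (J := J)
    refine add_le_add (Smectic.maxUpTo_le fun n hn => Real.le_sqrt_of_sq_le ?_)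
      (Smectic.maxUpTo_le fun n hn => Real.le_sqrt_of_sq_le ?_)
    · rw [Smectic.Params.l2T_sq hP]
      exact (hN n hn).sobT_zero_NQ_le
    · rw [Smectic.l2_eq_sob hh]
      refine (hN n hn).sob_Nu_sq_le.trans ?_
      have := (hB n hn).Q_le
      gcongr
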